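/- Local symplectic invariance of the bit quadrature correlations. Consider two bosonic modes $A,B$ with Hilbert space $L^2(\mathbb R)\otimes L^2(\mathbb R)=L^2(\mathbb R^2)$, $[\hat X,\hat P]=i$, displacement operators $D(a,b)=e^{i(b\hat X-a\hat P)}$ and parity $\Pi$, and let $R(\theta)=\begin{pmatrix}\cos\theta&-\sin\theta\\ \sin\theta&\cos\theta\end{pmatrix}$. For a density operator $\rho$ let $$W_\rho(\xi,\eta)=\pi^{-2}\,\mathrm{Tr}\big[\rho\,(D(\xi)\Pi D(\xi)^\dagger\otimes D(\eta)\Pi D(\eta)^\dagger)\big],\qquad \xi,\eta\in\mathbb R^2,$$ be its Wigner function, and let $$W_\rho^{\theta,\varphi}(x_A,x_B)=\iint dp_A\,dp_B\,W_\rho\big(R(\theta)(x_A,p_A),R(\varphi)(x_B,p_B)\big)$$ be the marginal distribution of the rotated positions (where the momentum integral does not converge absolutely it is read as $\lim_{\varepsilon\to0^+}\iint dp_A\,dp_B\,e^{-\varepsilon(p_A^2+p_B^2)}W_\rho$). For $\sigma>0$ let $$\mathcal P^\sigma(x_A,x_B)=\mathrm{Tr}\big[\rho\,(\hat R(\theta)\otimes\hat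 R(\varphi))(\hat\sigma(x_A)\otimes\hat\sigma(x_B))(\hat R(\theta)^\dagger\otimes\hat R(\varphi)^\dagger)\big],$$ where $\hat\sigma(x)$ is the pure one-mode Gaussian state with first moments $(x,0)$ and covariance matrix $\mathrm{diag}(\sigma^2,1/\sigma^2)$ (the vacuum having covariance matrix $\mathbb I$) and $\hat R(\theta)$ is the unitary of the phase-space rotation $R(\theta)$, so that $\hat R(\theta)\hat\sigma(x)\hat R(\theta)^\dagger$ is the pure Gaussian state with first moments $R(\theta)(x,0)$ and covariance matrix $R(\theta)\,\mathrm{diag}(\sigma^2,1/\sigma^2)\,R(\theta)^T$. Put $\mathcal P^{\alpha\beta}=\mathcal P^\sigma(\alpha|x_A|,\beta|x_B|)$ for signs $\alpha,\beta=\pm$, $$P^{=}=\frac{\mathcal P^{++}+\mathcal P^{--}}{\sum_{\alpha,\beta}\mathcal P^{\alpha\beta}},\qquad P^{\ne}=\frac{\mathcal P^{+-}+\mathcal P^{-+}}{\sum_{\alpha,\beta}\mathcal P^{\alpha\beta}},\qquad \mathcal B^\sigma_{\theta,\varphi}(|x_A|,|x_B|)=|P^{=}-P^{\ne}|,$$ and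 define the bit quadrature correlations of $\rho$ by $$Q(\rho)=\sup_{\theta,\varphi\in\mathbb R}\iint dx_A\,dx_B\;W_\rho^{\theta,\varphi}(x_A,x_B)\,\Big[\lim_{\sigma\to0^+}\mathcal B^\sigma_{\theta,\varphi}(|x_A|,|x_B|)\Big].$$ Let $U_A,U_B$ be unitaries on $L^2(\mathbb R)$ that implement symplectic matrices $S_A,S_B\in \mathrm{Sp}(2,\mathbb R)$, that is, $U_AD(\xi)U_A^\dagger=D(S_A\xi)$ and $U_BD(\xi)U_B^\dagger=D(S_B\xi)$ for all $\xi\in\mathbb R^2$. Then, for every density operator $\rho$ on $L^2(\mathbb R^2)$, $$Q\big((U_A\otimes U_B)\,\rho\,(U_A\otimes U_B)^\dagger\big)=Q(\rho).$$ -/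

import Mathlib

open MeasureTheory Filter Topology
open scoped Matrix TensorProduct

noncomputable section

namespace BitCorr

/-! ### Hilbert spaces of one and of two bosonic modes -/

/-- The Hilbert space `L²(ℝ)` of one bosonic mode, in the position representation. -/
abbrev Mode : Type := Lp ℂ 2 (volume : Measure ℝ)

/-- The Hilbert space `L²(ℝ²) = L²(ℝ) ⊗ L²(ℝ)` of two modes, in the position representation. -/
abbrev TwoMode : Type := Lp ℂ 2 (volume : Measure (ℝ × ℝ))

/-- The function `(x, y) ↦ f x * g y` is square integrable. -/
theorem memLp_tmul (f g : Mode) :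
    MemLp (fun z : ℝ × ℝ => f z.1 * g z.2) 2 (volume : Measure (ℝ × ℝ)) := by
  have hf := Lp.memLp f
  have hg := Lp.memLp g
  have hm : AEStronglyMeasurable (fun z : ℝ × ℝ => f z.1 * g z.2)
      (volume : Measure (ℝ × ℝ)) :=
    (hf.1.comp_fst).mul (hg.1.comp_snd)
  rw [memLp_two_iff_integrable_sq_norm hm]
  have h1 := (memLp_two_iff_integrable_sq_norm hf.1).1 hf
  have h2 := (memLp_two_iff_integrable_sq_norm hg.1).1 hg
  have := h1.mul_prod h2
  simpa [mul_pow, Measure.volume_eq_prod] using this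

/-- The elementary tensor `f ⊗ g`, that is `(x, y) ↦ f x * g y`. -/
def tmul (f g : Mode) : TwoMode := (memLp_tmul f g).toLp _

theorem coeFn_tmul (f g : Mode) : tmul f g =ᵐ[volume] fun z : ℝ × ℝ => f z.1 * g z.2 :=
  (memLp_tmul f g).coeFn_toLp

theorem ae_fst {p : ℝ → Prop} (h : ∀ᵐ x ∂(volume : Measure ℝ), p x) :
    ∀ᵐ z ∂(volume : Measure (ℝ × ℝ)), p z.1 :=
  Measure.quasiMeasurePreserving_fst.ae h

theorem ae_snd {p : ℝ → Prop} (h : ∀ᵐ x ∂(volume : Measure ℝ), p x) :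
    ∀ᵐ z ∂(volume : Measure (ℝ × ℝ)), p z.2 :=
  Measure.quasiMeasurePreserving_snd.ae h

/-- The bilinear map `(f, g) ↦ f ⊗ g`. -/
def tmulBilin : Mode →ₗ[ℂ] Mode →ₗ[ℂ] TwoMode :=
  LinearMap.mk₂ ℂ tmul
    (fun f f' g => by
      apply Lp.ext
      filter_upwards [coeFn_tmul (f + f') g, coeFn_tmul f g, coeFn_tmul f' g,
        Lp.coeFn_add (tmul f g) (tmul f' g), ae_fst (Lp.coeFn_add f f')] with z h1 h2 h3 h4 h5
      simp only [h1, h4, h5, Pi.add_apply, h2, h3, add_mul])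
    (fun c f g => by
      apply Lp.ext
      filter_upwards [coeFn_tmul (c • f) g, coeFn_tmul f g,
        Lp.coeFn_smul c (tmul f g), ae_fst (Lp.coeFn_smul c f)] with z h1 h2 h4 h5
      simp only [h1, h4, h5, Pi.smul_apply, h2, smul_eq_mul, mul_assoc])
    (fun f g g' => by
      apply Lp.ext
      filter_upwards [coeFn_tmul f (g + g'), coeFn_tmul f g, coeFn_tmul f g',
        Lp.coeFn_add (tmul f g) (tmul f g'), ae_snd (Lp.coeFn_add g g')] with z h1 h2 h3 h4 h5
      simp only [h1, h4, h5, Pi.add_apply, h2, h3, mul_add])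
    (fun c f g => by
      apply Lp.ext
      filter_upwards [coeFn_tmul f (c • g), coeFn_tmul f g,
        Lp.coeFn_smul c (tmul f g), ae_snd (Lp.coeFn_smul c g)] with z h1 h2 h4 h5
      simp only [h1, h4, h5, Pi.smul_apply, h2, smul_eq_mul]
      ring)

theorem inner_tmul (f g f' g' : Mode) :
    inner ℂ (tmul f g) (tmul f' g') = inner ℂ f f' * inner ℂ g g' := by
  rw [L2.inner_def, L2.inner_def, L2.inner_def, ← integral_prod_mul, ← Measure.volume_eq_prod]
  apply integral_congr_ae
  filter_upwards [coeFn_tmul f g, coeFn_tmul f' g'] with z h1 h2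
  simp only [h1, h2, RCLike.inner_apply, map_mul]
  ring

/-- The canonical linear map from the algebraic tensor product `L²(ℝ) ⊗ L²(ℝ)` to `L²(ℝ²)`. -/
def tensorEmb : Mode ⊗[ℂ] Mode →ₗ[ℂ] TwoMode := TensorProduct.lift tmulBilin

@[simp] theorem tensorEmb_tmul (f g : Mode) : tensorEmb (f ⊗ₜ g) = tmul f g := rfl

theorem inner_tensorEmb (u v : Mode ⊗[ℂ] Mode) :
    inner ℂ (tensorEmb u) (tensorEmb v) = inner ℂ u v := by
  induction u using TensorProduct.induction_on with
  | zero => simp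
  | add a b ha hb => simp only [map_add, inner_add_left, ha, hb]
  | tmul f g =>
    induction v using TensorProduct.induction_on with
    | zero => simp
    | add a b ha hb => simp only [map_add, inner_add_right, ha, hb]
    | tmul f' g' => simp [inner_tmul]

theorem norm_tensorEmb (u : Mode ⊗[ℂ] Mode) : ‖tensorEmb u‖ = ‖u‖ :=
  (tensorEmb.isometryOfInner inner_tensorEmb).norm_map u

/-- A square integrable function on the plane orthogonal to all `f ⊗ g` vanishes. -/
theorem eq_zero_of_orthogonal (h : TwoMode) (hh : ∀ f g : Mode, inner ℂ (tmul f g) h = 0) :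
    h = 0 := by
  have hK : ∀ n : ℕ, ∀ᵐ z ∂(volume : Measure (ℝ × ℝ)),
      z ∈ Set.Icc (-(n : ℝ)) n ×ˢ Set.Icc (-(n : ℝ)) n → h z = 0 := by
    intro n
    set I : Set ℝ := Set.Icc (-(n : ℝ)) n with hI
    have hIm : MeasurableSet I := measurableSet_Icc
    have hKm : MeasurableSet (I ×ˢ I) := hIm.prod hIm
    set ν : Measure (ℝ × ℝ) := (volume : Measure (ℝ × ℝ)).restrict (I ×ˢ I) with hν
    have hfin : (volume : Measure (ℝ × ℝ)) (I ×ˢ I) ≠ ⊤ := by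
      rw [Measure.volume_eq_prod, Measure.prod_prod]
      exact ENNReal.mul_ne_top (by simp [hI]) (by simp [hI])
    have : IsFiniteMeasure ν := ⟨by
      rw [hν, Measure.restrict_apply_univ]; exact lt_top_iff_ne_top.2 hfin⟩
    have hint : Integrable h ν := ((Lp.memLp h).restrict _).integrable (by norm_num)
    have hrect : ∀ s t : Set ℝ, MeasurableSet s → MeasurableSet t →
        ∫ z in s ×ˢ t, h z ∂ν = 0 := by
      intro s t hs ht
      have hsf : (volume : Measure ℝ) (s ∩ I) ≠ ⊤ :=
        ne_top_of_le_ne_top (by simp [hI]) (measure_mono Set.inter_subset_right)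
      have htf : (volume : Measure ℝ) (t ∩ I) ≠ ⊤ :=
        ne_top_of_le_ne_top (by simp [hI]) (measure_mono Set.inter_subset_right)
      have key := hh (indicatorConstLp 2 (hs.inter hIm) hsf (1 : ℂ))
        (indicatorConstLp 2 (ht.inter hIm) htf (1 : ℂ))
      rw [L2.inner_def] at key
      rw [hν, Measure.restrict_restrict (hs.prod ht), Set.prod_inter_prod,
        ← integral_indicator ((hs.inter hIm).prod (ht.inter hIm)), ← key]
      apply integral_congr_ae
      filter_upwards [coeFn_tmul (indicatorConstLp 2 (hs.inter hIm) hsf (1 : ℂ))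
        (indicatorConstLp 2 (ht.inter hIm) htf (1 : ℂ)),
        ae_fst (indicatorConstLp_coeFn (p := 2) (hs := hs.inter hIm) (hμs := hsf) (c := (1 : ℂ))),
        ae_snd (indicatorConstLp_coeFn (p := 2) (hs := ht.inter hIm) (hμs := htf) (c := (1 : ℂ)))]
        with z h1 h2 h3
      rw [h1, h2, h3]
      by_cases hz1 : z.1 ∈ s ∩ I <;> by_cases hz2 : z.2 ∈ t ∩ I <;>
        simp [Set.indicator, Set.mem_prod, hz1, hz2]
    have hall : ∀ s : Set (ℝ × ℝ), MeasurableSet s → ∫ z in s, h z ∂ν = 0 := by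
      intro s hs
      induction s, hs using MeasurableSpace.induction_on_inter generateFrom_prod.symm
        isPiSystem_prod with
      | empty => simp
      | basic t ht =>
        obtain ⟨a, ha, b, hb, rfl⟩ := ht
        exact hrect a b ha hb
      | compl t ht iht =>
        have := integral_add_compl ht hint
        rw [iht, zero_add] at this
        rw [this]
        simpa using hrect Set.univ Set.univ .univ .univ
      | iUnion t hd hm iht =>
        rw [integral_iUnion hm hd hint.integrableOn]
        simp [iht]
    have := hint.ae_eq_zero_of_forall_setIntegral_eq_zero (fun s hs _ => hall s hs)
    exact (ae_restrict_iff' hKm).1 this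
  have hall := ae_all_iff.2 hK
  apply Lp.ext
  filter_upwards [hall, Lp.coeFn_zero ℂ 2 (volume : Measure (ℝ × ℝ))] with z hz h0
  obtain ⟨n, hn⟩ := exists_nat_ge (max |z.1| |z.2|)
  rw [h0]
  refine hz n ⟨?_, ?_⟩
  · exact abs_le.1 ((le_max_left _ _).trans hn)
  · exact abs_le.1 ((le_max_right _ _).trans hn)

theorem denseRange_tensorEmb : DenseRange tensorEmb := by
  have : (LinearMap.range tensorEmb).topologicalClosure = ⊤ := by
    rw [Submodule.topologicalClosure_eq_top_iff, Submodule.eq_bot_iff]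
    intro h hh
    refine eq_zero_of_orthogonal h fun f g => ?_
    exact (Submodule.mem_orthogonal _ _).1 hh _ ⟨f ⊗ₜ g, rfl⟩
  exact (Submodule.dense_iff_topologicalClosure_eq_top (s := LinearMap.range tensorEmb)).2 this

/-- The tensor product `U ⊗ V` of two unitaries, acting on the two-mode Hilbert space. -/
def tensorUnitary (U V : Mode ≃ₗᵢ[ℂ] Mode) : TwoMode ≃ₗᵢ[ℂ] TwoMode :=
  (TensorProduct.congrIsometry U V).toLinearEquiv.extendOfIsometry tensorEmb tensorEmb
    denseRange_tensorEmb denseRange_tensorEmb fun x => by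
      rw [norm_tensorEmb, norm_tensorEmb]
      exact (TensorProduct.congrIsometry U V).norm_map x

theorem tensorUnitary_tmul (U V : Mode ≃ₗᵢ[ℂ] Mode) (f g : Mode) :
    tensorUnitary U V (tmul f g) = tmul (U f) (V g) :=
  LinearEquiv.extendOfIsometry_eq (TensorProduct.congrIsometry U V).toLinearEquiv tensorEmb
    tensorEmb denseRange_tensorEmb denseRange_tensorEmb _ (f ⊗ₜ g)

/-! ### States -/

/-- The index set of a fixed orthonormal basis of a Hilbert space. -/
def basisSet (H : Type) [NormedAddCommGroup H] [InnerProductSpace ℂ H] [CompleteSpace H] : Set H :=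
  (exists_hilbertBasis ℂ H).choose

/-- A fixed orthonormal basis of a Hilbert space. -/
def basis (H : Type) [NormedAddCommGroup H] [InnerProductSpace ℂ H] [CompleteSpace H] :
    HilbertBasis (basisSet H) ℂ H :=
  (exists_hilbertBasis ℂ H).choose_spec.choose

/-- The trace of an operator. For a trace-class operator the sum converges absolutely and does
not depend on the orthonormal basis. -/
def trace {H : Type} [NormedAddCommGroup H] [InnerProductSpace ℂ H] [CompleteSpace H]
    (T : H →L[ℂ] H) : ℂ :=
  ∑' i, inner ℂ (basis H i) (T (basis H i))

/-- Density operators: positive operators of trace one. (For a positive operator the value of the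
sum, finite or not, does not depend on the orthonormal basis.) -/
structure IsDensityOperator {H : Type} [NormedAddCommGroup H] [InnerProductSpace ℂ H]
    [CompleteSpace H] (ρ : H →L[ℂ] H) : Prop where
  isPositive : ρ.IsPositive
  hasSum_one : HasSum (fun i => inner ℂ (basis H i) (ρ (basis H i))) 1

/-- A unitary, as a bounded operator. -/
def toOp {H : Type} [NormedAddCommGroup H] [InnerProductSpace ℂ H] (U : H ≃ₗᵢ[ℂ] H) : H →L[ℂ] H :=
  (U.toContinuousLinearEquiv : H →L[ℂ] H)

/-- The transformed operator `U ρ U†`; for a unitary, `U† = U⁻¹`. -/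
def conj {H : Type} [NormedAddCommGroup H] [InnerProductSpace ℂ H] (U : H ≃ₗᵢ[ℂ] H)
    (ρ : H →L[ℂ] H) : H →L[ℂ] H :=
  toOp U ∘L ρ ∘L toOp U.symm

/-! ### Displacements, parity and symplectic operations on one mode

Points of the phase space of one mode are vectors `ξ : Fin 2 → ℝ` with `ξ 0` the position and `ξ 1`
the momentum. Units are such that `[X, P] = i`. -/

theorem memLp_phase {g : ℝ → ℝ} (hg : Measurable g) (f : Mode) :
    MemLp (fun x => Complex.exp (Complex.I * g x) * f x) 2 (volume : Measure ℝ) := by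
  have hf := Lp.memLp f
  refine hf.of_le ?_ ?_
  · exact (by fun_prop : Measurable fun x => Complex.exp (Complex.I * g x)).aestronglyMeasurable.mul
      hf.1
  · refine ae_of_all _ fun x => ?_
    rw [norm_mul, mul_comm Complex.I, Complex.norm_exp_ofReal_mul_I, one_mul]

/-- Multiplication by the phase `exp (i g(x))`. -/
def phaseFun {g : ℝ → ℝ} (hg : Measurable g) (f : Mode) : Mode := (memLp_phase hg f).toLp _

theorem coeFn_phaseFun {g : ℝ → ℝ} (hg : Measurable g) (f : Mode) :
    phaseFun hg f =ᵐ[volume] fun x => Complex.exp (Complex.I * g x) * f x :=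
  (memLp_phase hg f).coeFn_toLp

theorem phaseFun_neg {g : ℝ → ℝ} (hg : Measurable g) (f : Mode) :
    phaseFun hg.neg (phaseFun hg f) = f := by
  apply Lp.ext
  filter_upwards [coeFn_phaseFun hg.neg (phaseFun hg f), coeFn_phaseFun hg f] with x h1 h2
  rw [h1, h2, ← mul_assoc, ← Complex.exp_add]
  simp

theorem phaseFun_neg' {g : ℝ → ℝ} (hg : Measurable g) (f : Mode) :
    phaseFun hg (phaseFun hg.neg f) = f := by
  apply Lp.ext
  filter_upwards [coeFn_phaseFun hg.neg f, coeFn_phaseFun hg (phaseFun hg.neg f)] with x h1 h2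
  rw [h2, h1, ← mul_assoc, ← Complex.exp_add]
  simp

/-- Multiplication by the phase `exp (i g(x))`, as a unitary. -/
def phase {g : ℝ → ℝ} (hg : Measurable g) : Mode ≃ₗᵢ[ℂ] Mode where
  toFun := phaseFun hg
  invFun := phaseFun hg.neg
  left_inv := phaseFun_neg hg
  right_inv := phaseFun_neg' hg
  map_add' f f' := by
    apply Lp.ext
    filter_upwards [coeFn_phaseFun hg (f + f'), coeFn_phaseFun hg f, coeFn_phaseFun hg f',
      Lp.coeFn_add f f', Lp.coeFn_add (phaseFun hg f) (phaseFun hg f')] with x h1 h2 h3 h4 h5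
    simp only [h1, h4, h5, Pi.add_apply, h2, h3, mul_add]
  map_smul' c f := by
    apply Lp.ext
    filter_upwards [coeFn_phaseFun hg (c • f), coeFn_phaseFun hg f,
      Lp.coeFn_smul c f, Lp.coeFn_smul c (phaseFun hg f)] with x h1 h2 h4 h5
    simp only [RingHom.id_apply, h1, h4, h5, Pi.smul_apply, h2, smul_eq_mul]
    ring
  norm_map' f := by
    change ‖phaseFun hg f‖ = ‖f‖
    rw [Lp.norm_def, Lp.norm_def]
    congr 1
    refine eLpNorm_congr_norm_ae ?_
    filter_upwards [coeFn_phaseFun hg f] with x h1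
    rw [h1, norm_mul, mul_comm Complex.I, Complex.norm_exp_ofReal_mul_I, one_mul]

theorem coeFn_phase {g : ℝ → ℝ} (hg : Measurable g) (f : Mode) :
    phase hg f =ᵐ[volume] fun x => Complex.exp (Complex.I * g x) * f x :=
  coeFn_phaseFun hg f

/-- The unitary `f ↦ f ∘ e` for a measure preserving bijection `e` of the line. -/
def compUnitary (e : ℝ ≃ᵐ ℝ) (he : MeasurePreserving e) : Mode ≃ₗᵢ[ℂ] Mode where
  __ := Lp.compMeasurePreservingₗᵢ ℂ e he
  invFun := Lp.compMeasurePreserving e.symm (he.symm e)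
  left_inv f := by
    change Lp.compMeasurePreserving e.symm (he.symm e) (Lp.compMeasurePreserving e he f) = f
    apply Lp.ext
    filter_upwards [Lp.coeFn_compMeasurePreserving (Lp.compMeasurePreserving e he f) (he.symm e),
      (he.symm e).quasiMeasurePreserving.ae (Lp.coeFn_compMeasurePreserving f he)] with x h1 h2
    rw [h1, Function.comp_apply, h2]
    simp
  right_inv f := by
    change Lp.compMeasurePreserving e he (Lp.compMeasurePreserving e.symm (he.symm e) f) = f
    apply Lp.ext
    filter_upwards [Lp.coeFn_compMeasurePreserving
        (Lp.compMeasurePreserving e.symm (he.symm e) f) he,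
      he.quasiMeasurePreserving.ae (Lp.coeFn_compMeasurePreserving f (he.symm e))] with x h1 h2
    rw [h1, Function.comp_apply, h2]
    simp

theorem coeFn_compUnitary (e : ℝ ≃ᵐ ℝ) (he : MeasurePreserving e) (f : Mode) :
    compUnitary e he f =ᵐ[volume] fun x => f (e x) :=
  Lp.coeFn_compMeasurePreserving f he

/-- The translation `f(x) ↦ f(x - a)`. -/
def translation (a : ℝ) : Mode ≃ₗᵢ[ℂ] Mode :=
  compUnitary (MeasurableEquiv.subRight a) (measurePreserving_sub_right volume a)

/-- The parity operator `f(x) ↦ f(-x)`. -/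
def parity : Mode ≃ₗᵢ[ℂ] Mode :=
  compUnitary (MeasurableEquiv.neg ℝ) (Measure.measurePreserving_neg volume)

/-- The displacement (Weyl) operator `D(a, b) = exp (i (b X - a P))`, which acts by
`(D(a, b) f)(x) = exp (i (b x - a b / 2)) f(x - a)` and displaces a state by `(a, b)` in phase
space. -/
def displacement (ξ : Fin 2 → ℝ) : Mode ≃ₗᵢ[ℂ] Mode :=
  (translation (ξ 0)).trans
    (phase (g := fun x => ξ 1 * x - ξ 0 * ξ 1 / 2) (by fun_prop))

theorem coeFn_displacement (ξ : Fin 2 → ℝ) (f : Mode) :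
    displacement ξ f =ᵐ[volume] fun x =>
      Complex.exp (Complex.I * ((ξ 1 * x - ξ 0 * ξ 1 / 2 : ℝ) : ℂ)) * f (x - ξ 0) := by
  filter_upwards [coeFn_phase (g := fun x => ξ 1 * x - ξ 0 * ξ 1 / 2) (by fun_prop)
    (translation (ξ 0) f), coeFn_compUnitary (MeasurableEquiv.subRight (ξ 0))
    (measurePreserving_sub_right volume (ξ 0)) f] with x h1 hx
  refine h1.trans ?_
  rw [translation, hx]
  rfl

/-- The symplectic form matrix of one mode. -/
def sympForm : Matrix (Fin 2) (Fin 2) ℝ := !![0, 1; -1, 0]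

/-- Real symplectic matrices of one mode, the group `Sp(2, ℝ)`. -/
def IsSymplectic (S : Matrix (Fin 2) (Fin 2) ℝ) : Prop := S * sympForm * Sᵀ = sympForm

/-- The unitary `U` implements the linear symplectic map `S` on the phase space of its mode:
`U D(ξ) U† = D(S ξ)` for every displacement `D(ξ)`. -/
def Implements (U : Mode ≃ₗᵢ[ℂ] Mode) (S : Matrix (Fin 2) (Fin 2) ℝ) : Prop :=
  ∀ (ξ : Fin 2 → ℝ) (f : Mode), U (displacement ξ f) = displacement (S *ᵥ ξ) (U f)

/-- The phase-space rotation by `θ`. -/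
def rotation (θ : ℝ) : Matrix (Fin 2) (Fin 2) ℝ :=
  !![Real.cos θ, -Real.sin θ; Real.sin θ, Real.cos θ]

/-! ### Wigner function and quadrature marginals -/

/-- The displaced parity operator `D(ξ) Π D(ξ)†`. -/
def displacedParity (ξ : Fin 2 → ℝ) : Mode ≃ₗᵢ[ℂ] Mode :=
  (displacement ξ).symm.trans (parity.trans (displacement ξ))

/-- The Wigner function of a two-mode operator `ρ` at the phase-space point `(ξ, η)`,
`W(ξ, η) = π⁻² Tr[ρ (D(ξ) Π D(ξ)† ⊗ D(η) Π D(η)†)]`. -/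
def wigner (ρ : TwoMode →L[ℂ] TwoMode) (ξ η : Fin 2 → ℝ) : ℝ :=
  (trace (ρ ∘L toOp (tensorUnitary (displacedParity ξ) (displacedParity η)))).re / Real.pi ^ 2

/-- The Wigner function in the rotated coordinates: its value at the phase-space point whose
rotated coordinates are `(xA, pA, xB, pB)`. -/
def rotatedWigner (ρ : TwoMode →L[ℂ] TwoMode) (θ φ xA pA xB pB : ℝ) : ℝ :=
  wigner ρ (rotation θ *ᵥ ![xA, pA]) (rotation φ *ᵥ ![xB, pB])

/-- The marginal Wigner distribution of the rotated positions, `∫∫ dpA dpB W(xA, pA, xB, pB)`.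
The Wigner function of a general state need not be absolutely integrable in the momenta, so the
double integral is read as the limit `ε → 0⁺` of `∫∫ exp (-ε (pA² + pB²)) W dpA dpB`. This is the
plain integral whenever that converges absolutely (see `marginal_eq_integral`). -/
def marginal (ρ : TwoMode →L[ℂ] TwoMode) (θ φ xA xB : ℝ) : ℝ :=
  limUnder (𝓝[>] (0 : ℝ)) fun ε =>
    ∫ p : ℝ × ℝ, Real.exp (-ε * (p.1 ^ 2 + p.2 ^ 2)) * rotatedWigner ρ θ φ xA p.1 xB p.2

theorem marginal_eq_integral (ρ : TwoMode →L[ℂ] TwoMode) (θ φ xA xB : ℝ)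
    (h : Integrable fun p : ℝ × ℝ => rotatedWigner ρ θ φ xA p.1 xB p.2) :
    marginal ρ θ φ xA xB = ∫ p : ℝ × ℝ, rotatedWigner ρ θ φ xA p.1 xB p.2 := by
  apply Tendsto.limUnder_eq
  refine tendsto_integral_filter_of_dominated_convergence
    (fun p => ‖rotatedWigner ρ θ φ xA p.1 xB p.2‖) ?_ ?_ h.norm ?_
  · exact Eventually.of_forall fun ε =>
      (by fun_prop : Measurable fun p : ℝ × ℝ =>
        Real.exp (-ε * (p.1 ^ 2 + p.2 ^ 2))).aestronglyMeasurable.mul h.1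
  · filter_upwards [self_mem_nhdsWithin] with ε hε
    refine ae_of_all _ fun p => ?_
    rw [norm_mul, Real.norm_eq_abs, Real.abs_exp]
    refine mul_le_of_le_one_left (norm_nonneg _) (Real.exp_le_one_iff.2 ?_)
    have : (0 : ℝ) < ε := hε
    nlinarith [sq_nonneg p.1, sq_nonneg p.2]
  · refine ae_of_all _ fun p => ?_
    have : Tendsto (fun ε : ℝ => Real.exp (-ε * (p.1 ^ 2 + p.2 ^ 2)) *
        rotatedWigner ρ θ φ xA p.1 xB p.2) (𝓝 0)
        (𝓝 (Real.exp (-0 * (p.1 ^ 2 + p.2 ^ 2)) * rotatedWigner ρ θ φ xA p.1 xB p.2)) :=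
      Continuous.tendsto (by fun_prop) 0
    simpa using this.mono_left nhdsWithin_le_nhds

/-! ### Quadrature measurements with finite uncertainty and bit correlations -/

/-- The wave function of the pure one-mode Gaussian state with first moments `d` and covariance
matrix `γ` (normalised so that the vacuum has covariance matrix `1`; purity means `det γ = 1`). -/
def gaussianWave (d : Fin 2 → ℝ) (γ : Matrix (Fin 2) (Fin 2) ℝ) (x : ℝ) : ℂ :=
  (((Real.pi * γ 0 0) ^ (-(1 / 4) : ℝ) : ℝ) : ℂ) *
    Complex.exp (-((1 - Complex.I * γ 0 1) / (2 * γ 0 0)) * ((x - d 0 : ℝ) : ℂ) ^ 2 +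
      Complex.I * ((d 1 * x : ℝ) : ℂ))

theorem memLp_gaussianWave (d : Fin 2 → ℝ) (γ : Matrix (Fin 2) (Fin 2) ℝ) (h : 0 < γ 0 0) :
    MemLp (gaussianWave d γ) 2 (volume : Measure ℝ) := by
  have hm : AEStronglyMeasurable (gaussianWave d γ) (volume : Measure ℝ) := by
    refine Measurable.aestronglyMeasurable ?_
    unfold gaussianWave
    fun_prop
  rw [memLp_two_iff_integrable_sq_norm hm]
  have hi := ((integrable_exp_neg_mul_sq (inv_pos.2 h)).comp_sub_right (d 0)).const_mul
    (((Real.pi * γ 0 0) ^ (-(1 / 4) : ℝ) : ℝ) ^ 2)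
  refine hi.congr (ae_of_all _ fun x => ?_)
  have hpos : (0 : ℝ) < (Real.pi * γ 0 0) ^ (-(1 / 4) : ℝ) := by positivity
  have hre : (-((1 - Complex.I * γ 0 1) / (2 * γ 0 0)) * ((x - d 0 : ℝ) : ℂ) ^ 2 +
      Complex.I * ((d 1 * x : ℝ) : ℂ)).re = -(x - d 0) ^ 2 / (2 * γ 0 0) := by
    have e : (-((1 - Complex.I * γ 0 1) / (2 * γ 0 0)) * ((x - d 0 : ℝ) : ℂ) ^ 2 +
      Complex.I * ((d 1 * x : ℝ) : ℂ)) = ((-(x - d 0) ^ 2 / (2 * γ 0 0) : ℝ) : ℂ) +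
      ((γ 0 1 * (x - d 0) ^ 2 / (2 * γ 0 0) + d 1 * x : ℝ) : ℂ) * Complex.I := by
      push_cast; ring
    rw [e, Complex.add_re, Complex.re_ofReal_mul, Complex.ofReal_re]; simp
  simp only [gaussianWave, norm_mul, Complex.norm_real, Real.norm_eq_abs, abs_of_pos hpos,
    Complex.norm_exp, hre, mul_pow]
  congr 1
  rw [← Real.exp_nat_mul]
  congr 1
  push_cast
  field_simp

open Classical in
/-- The pure Gaussian state with first moments `d` and covariance matrix `γ`, as a vector of
`L²(ℝ)`; the wave function is square integrable as soon as `γ 0 0 > 0`. -/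
def gaussianVector (d : Fin 2 → ℝ) (γ : Matrix (Fin 2) (Fin 2) ℝ) : Mode :=
  if h : MemLp (gaussianWave d γ) 2 (volume : Measure ℝ) then h.toLp _ else 0

/-- The state `R(θ) σ(x) R(θ)†`. Here `σ(x)` is the squeezed state with first moments `(x, 0)` and
covariance matrix `diag(σ², 1/σ²)`; rotating it by `θ` gives the Gaussian state with the rotated
first moments and covariance matrix. -/
def rotatedProbe (σ θ x : ℝ) : Mode :=
  gaussianVector (rotation θ *ᵥ ![x, 0])
    (rotation θ * Matrix.diagonal ![σ ^ 2, 1 / σ ^ 2] * (rotation θ)ᵀ)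

/-- The joint probability `Tr[ρ (R(θ) ⊗ R(φ)) (σ(xA) ⊗ σ(xB)) (R(θ)† ⊗ R(φ)†)]` of the outcomes
`xA`, `xB` in a measurement of the rotated quadratures with uncertainty `σ`. -/
def prob (ρ : TwoMode →L[ℂ] TwoMode) (σ θ φ xA xB : ℝ) : ℝ :=
  (inner ℂ (tmul (rotatedProbe σ θ xA) (rotatedProbe σ φ xB))
    (ρ (tmul (rotatedProbe σ θ xA) (rotatedProbe σ φ xB)))).re

/-- The sum of the four probabilities of the outcomes `(±|xA|, ±|xB|)`. -/
def probTotal (ρ : TwoMode →L[ℂ] TwoMode) (σ θ φ xA xB : ℝ) : ℝ :=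
  prob ρ σ θ φ |xA| |xB| + prob ρ σ θ φ |xA| (-|xB|) +
    prob ρ σ θ φ (-|xA|) |xB| + prob ρ σ θ φ (-|xA|) (-|xB|)

/-- The conditional probability that the two bits coincide. -/
def probEq (ρ : TwoMode →L[ℂ] TwoMode) (σ θ φ xA xB : ℝ) : ℝ :=
  (prob ρ σ θ φ |xA| |xB| + prob ρ σ θ φ (-|xA|) (-|xB|)) / probTotal ρ σ θ φ xA xB

/-- The conditional probability that the two bits differ. -/
def probNe (ρ : TwoMode →L[ℂ] TwoMode) (σ θ φ xA xB : ℝ) : ℝ :=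
  (prob ρ σ θ φ |xA| (-|xB|) + prob ρ σ θ φ (-|xA|) |xB|) / probTotal ρ σ θ φ xA xB

/-- The strength of the bit correlations at uncertainty `σ`. -/
def strength (ρ : TwoMode →L[ℂ] TwoMode) (σ θ φ xA xB : ℝ) : ℝ :=
  |probEq ρ σ θ φ xA xB - probNe ρ σ θ φ xA xB|

/-- The strength of the bit correlations in the limit of zero uncertainty. (For a density operator
the limit exists for almost all `(xA, xB)` at which one of the four points `(±xA, ±xB)` has
nonzero probability density; elsewhere the marginal distribution vanishes almost everywhere.) -/
def strengthLim (ρ : TwoMode →L[ℂ] TwoMode) (θ φ xA xB : ℝ) : ℝ :=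
  limUnder (𝓝[>] (0 : ℝ)) fun σ => strength ρ σ θ φ xA xB

/-- The bit correlations averaged over the outcomes, for fixed quadratures. -/
def averageStrength (ρ : TwoMode →L[ℂ] TwoMode) (θ φ : ℝ) : ℝ :=
  ∫ x : ℝ × ℝ, marginal ρ θ φ x.1 x.2 * strengthLim ρ θ φ x.1 x.2

/-- The bit quadrature correlations `Q(ρ)`: the supremum over all local quadratures. -/
def bitCorr (ρ : TwoMode →L[ℂ] TwoMode) : ℝ :=
  ⨆ q : ℝ × ℝ, averageStrength ρ q.1 q.2

end BitCorr

end

open MeasureTheory Filter Topology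
open scoped Matrix TensorProduct

noncomputable section

namespace BitCorr

/-! The rotations in the definition of `averageStrength` are special symplectic frames. Allow
arbitrary frames `M`, `N` of determinant one and call the corresponding average `frameAverage ρ M
N`. Two facts then give the theorem.

Covariance (`frameAverage_conj`): replacing `ρ` by its transform under `U ⊗ V` and the frames by `S
* M`, `T * N` changes nothing. For the Wigner function this needs unitaries implementing symplectic
matrices to commute with parity; for the probabilities it needs them to map pure Gaussian states to
pure Gaussian states up to a phase. Both follow from one identity: the projection on a centred
Gaussian state is a Gaussian average of displacement operators
(`integral_exp_covForm_inner_displacement`), so conjugating displacements determines what happens to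
the state.

Triangular invariance (`frameAverage_mul_lower`): by the Iwasawa decomposition every frame is a
rotation times a lower triangular matrix, and the triangular factor does not matter. It only
rescales the measured position and adds to the momentum a multiple of the position. To see this,
undo the rotation by a unitary, write the state as `∑ |v i⟩⟨v i|`, and collect the values `v i z`
into a vector `b z` in `ℓ²`. In the frames `lower l c`, `lower l' c'` the marginal is `l * l' * ‖b
(l x, l' y)‖²`, and as `σ → 0` the probabilities become proportional to `‖b‖²` at the four dilated
points; the shear acts on `b` as a unimodular chirp and disappears in norms. A dilation of the plane
then removes `l` and `l'` (`frameAverage_lower`).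

The limits `ε → 0` and `σ → 0` are taken at almost every point, where the Gaussian means of `‖b (q +
y) - b q‖²` tend to zero (`ae_isGaussPoint`). Consequently both states have the same set of average
strengths over all pairs of angles, hence the same supremum. -/

/-! ### The Weyl relations -/

/-- The symplectic form on the phase space of one mode. -/
def symp (ξ η : Fin 2 → ℝ) : ℝ := ξ 0 * η 1 - ξ 1 * η 0

theorem symp_mulVec (M : Matrix (Fin 2) (Fin 2) ℝ) (ξ η : Fin 2 → ℝ) :
    symp (M *ᵥ ξ) (M *ᵥ η) = M.det * symp ξ η := by
  simp [symp, Matrix.mulVec, dotProduct, Fin.sum_univ_two, Matrix.det_fin_two]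
  ring

/-- In dimension two, `S * sympForm * Sᵀ` is `S.det` times `sympForm`. -/
theorem isSymplectic_iff_det (S : Matrix (Fin 2) (Fin 2) ℝ) : IsSymplectic S ↔ S.det = 1 := by
  rw [IsSymplectic, ← Matrix.ext_iff]
  simp only [Fin.forall_fin_two, sympForm, Matrix.mul_apply, Fin.sum_univ_two,
    Matrix.transpose_apply, Matrix.det_fin_two]
  simp
  grind

theorem displacement_displacement (ξ η : Fin 2 → ℝ) (f : Mode) :
    displacement ξ (displacement η f) =
      Complex.exp (Complex.I * ((-symp ξ η / 2 : ℝ) : ℂ)) • displacement (ξ + η) f := by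
  apply Lp.ext
  filter_upwards [coeFn_displacement ξ (displacement η f),
    (measurePreserving_sub_right volume (ξ 0)).quasiMeasurePreserving.ae (coeFn_displacement η f),
    Lp.coeFn_smul (Complex.exp (Complex.I * ((-symp ξ η / 2 : ℝ) : ℂ))) (displacement (ξ + η) f),
    coeFn_displacement (ξ + η) f] with x h1 h2 h3 h4
  rw [h1, h2, h3, Pi.smul_apply, h4, smul_eq_mul, ← mul_assoc, ← mul_assoc, ← Complex.exp_add,
    ← Complex.exp_add]
  have e : x - ξ 0 - η 0 = x - (ξ + η) 0 := by simp [sub_sub]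
  rw [e]
  congr 2
  simp only [symp, Pi.add_apply]
  push_cast
  ring

theorem displacement_zero (f : Mode) : displacement 0 f = f := by
  apply Lp.ext
  filter_upwards [coeFn_displacement 0 f] with x h1
  rw [h1]
  simp

theorem displacement_symm (ξ : Fin 2 → ℝ) (f : Mode) :
    (displacement ξ).symm f = displacement (-ξ) f := by
  rw [LinearIsometryEquiv.symm_apply_eq, displacement_displacement]
  have h : symp ξ (-ξ) = 0 := by simp [symp]; ring
  simp [displacement_zero, h]

theorem parity_displacement (ξ : Fin 2 → ℝ) (f : Mode) :
    parity (displacement ξ f) = displacement (-ξ) (parity f) := by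
  have hn := (Measure.measurePreserving_neg (volume : Measure ℝ)).quasiMeasurePreserving
  apply Lp.ext
  filter_upwards [coeFn_compUnitary (MeasurableEquiv.neg ℝ) (Measure.measurePreserving_neg volume)
      (displacement ξ f), hn.ae (coeFn_displacement ξ f), coeFn_displacement (-ξ) (parity f),
    (measurePreserving_sub_right volume ((-ξ) 0)).quasiMeasurePreserving.ae
      (coeFn_compUnitary (MeasurableEquiv.neg ℝ) (Measure.measurePreserving_neg volume) f)]
    with x h1 h2 h3 h4
  refine h1.trans (h2.trans ?_)
  rw [h3]
  refine Eq.trans ?_ (congrArg _ h4.symm)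
  simp only [MeasurableEquiv.neg_apply, Pi.neg_apply]
  congr 2
  · push_cast; ring_nf
  · ring

theorem inner_displacement (f h : Mode) (ξ : Fin 2 → ℝ) :
    inner ℂ f (displacement ξ h) = ∫ x : ℝ, (starRingEnd ℂ) (f x) *
      (Complex.exp (Complex.I * ((ξ 1 * x - ξ 0 * ξ 1 / 2 : ℝ) : ℂ)) * h (x - ξ 0)) := by
  rw [L2.inner_def]
  apply integral_congr_ae
  filter_upwards [coeFn_displacement ξ h] with x h1
  rw [h1, RCLike.inner_apply, mul_comm]

/-! ### Pure Gaussian states -/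

/-- Covariance matrices of pure Gaussian states of one mode. -/
structure IsPureCov (γ : Matrix (Fin 2) (Fin 2) ℝ) : Prop where
  pos : 0 < γ 0 0
  symm : γ 1 0 = γ 0 1
  det : γ.det = 1

theorem IsPureCov.conj {γ : Matrix (Fin 2) (Fin 2) ℝ} (h : IsPureCov γ)
    {S : Matrix (Fin 2) (Fin 2) ℝ} (hS : S.det = 1) : IsPureCov (S * γ * Sᵀ) := by
  obtain ⟨h1, h2, h3⟩ := h
  have hd := h3
  rw [Matrix.det_fin_two] at hd hS
  rw [h2] at hd
  refine ⟨?_, ?_, ?_⟩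
  · simp only [Matrix.mul_apply, Fin.sum_univ_two, Matrix.transpose_apply, h2]
    -- Completing the square with `det γ = 1`. The right side could vanish only if the first row of
    -- `S` did, which `det S = 1` forbids.
    have e : γ 0 0 * ((S 0 0 * γ 0 0 + S 0 1 * γ 0 1) * S 0 0 +
        (S 0 0 * γ 0 1 + S 0 1 * γ 1 1) * S 0 1) =
        (S 0 0 * γ 0 0 + S 0 1 * γ 0 1) ^ 2 + S 0 1 ^ 2 := by
      linear_combination S 0 1 ^ 2 * hd
    refine pos_of_mul_pos_right (b := _) (a := γ 0 0) ?_ h1.le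
    rw [e]
    rcases eq_or_ne (S 0 1) 0 with h | h
    · have : S 0 0 ≠ 0 := by rintro h'; simp [h, h'] at hS
      rw [h]
      have := h1.ne'
      simp only [zero_mul, add_zero, ne_eq, OfNat.ofNat_ne_zero, not_false_eq_true,
        zero_pow]
      positivity
    · positivity
  · simp only [Matrix.mul_apply, Fin.sum_univ_two, Matrix.transpose_apply, h2]
    ring
  · rw [Matrix.det_mul, Matrix.det_mul, Matrix.det_transpose, h3, Matrix.det_fin_two, hS]
    norm_num

theorem coeFn_gaussianVector (d : Fin 2 → ℝ) {γ : Matrix (Fin 2) (Fin 2) ℝ} (h : 0 < γ 0 0) :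
    gaussianVector d γ =ᵐ[volume] gaussianWave d γ := by
  rw [gaussianVector, dif_pos (memLp_gaussianWave d γ h)]
  exact MemLp.coeFn_toLp _

/-- `gaussianWave` carries the bare phase `d 1 * x`, the Weyl operator the symmetric one `d 1 * x -
d 0 * d 1 / 2`; the scalar makes up the difference. -/
theorem gaussianVector_eq_displacement (d : Fin 2 → ℝ) {γ : Matrix (Fin 2) (Fin 2) ℝ}
    (h : 0 < γ 0 0) : gaussianVector d γ =
      Complex.exp (Complex.I * ((d 0 * d 1 / 2 : ℝ) : ℂ)) • displacement d (gaussianVector 0 γ) := by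
  apply Lp.ext
  filter_upwards [coeFn_gaussianVector d h, coeFn_displacement d (gaussianVector 0 γ),
    (measurePreserving_sub_right volume (d 0)).quasiMeasurePreserving.ae
      (coeFn_gaussianVector 0 h), Lp.coeFn_smul (Complex.exp (Complex.I * ((d 0 * d 1 / 2 : ℝ) : ℂ)))
      (displacement d (gaussianVector 0 γ))] with x h1 h2 h3 h4
  rw [h4, Pi.smul_apply, h2, h3, h1, smul_eq_mul, gaussianWave, gaussianWave, ← mul_assoc,
    ← Complex.exp_add, mul_left_comm, ← Complex.exp_add]
  congr 2
  simp only [Pi.zero_apply]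
  push_cast
  ring

theorem norm_exp_I_mul (t : ℝ) : ‖Complex.exp (Complex.I * t)‖ = 1 := by
  rw [mul_comm, Complex.norm_exp_ofReal_mul_I]

theorem norm_gaussianVector (d : Fin 2 → ℝ) {γ : Matrix (Fin 2) (Fin 2) ℝ} (h : 0 < γ 0 0) :
    ‖gaussianVector d γ‖ = 1 := by
  rw [gaussianVector_eq_displacement d h, norm_smul, norm_exp_I_mul, one_mul,
    LinearIsometryEquiv.norm_map]
  rw [← sq_eq_sq₀ (norm_nonneg _) zero_le_one, one_pow, ← @inner_self_eq_norm_sq ℂ, L2.inner_def]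
  have : ∀ᵐ x : ℝ, inner ℂ (gaussianVector 0 γ x) (gaussianVector 0 γ x) =
      (((Real.pi * γ 0 0) ^ (-(1 / 2) : ℝ) * Real.exp (-(γ 0 0)⁻¹ * x ^ 2) : ℝ) : ℂ) := by
    filter_upwards [coeFn_gaussianVector 0 h] with x hx
    rw [hx, RCLike.inner_apply, RCLike.mul_conj]
    norm_cast
    have hpos : (0 : ℝ) < (Real.pi * γ 0 0) ^ (-(1 / 4) : ℝ) := by positivity
    rw [gaussianWave, norm_mul, Complex.norm_real, Real.norm_eq_abs, abs_of_pos hpos,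
      Complex.norm_exp, mul_pow, ← Real.rpow_natCast, ← Real.rpow_mul (by positivity),
      ← Real.exp_nat_mul]
    have e : (-((1 - Complex.I * γ 0 1) / (2 * γ 0 0)) * ((x - (0 : Fin 2 → ℝ) 0 : ℝ) : ℂ) ^ 2 +
      Complex.I * (((0 : Fin 2 → ℝ) 1 * x : ℝ) : ℂ)) = ((-x ^ 2 / (2 * γ 0 0) : ℝ) : ℂ) +
      ((γ 0 1 * x ^ 2 / (2 * γ 0 0) : ℝ) : ℂ) * Complex.I := by
      simp; ring
    rw [e, Complex.add_re, Complex.re_ofReal_mul, Complex.ofReal_re]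
    simp only [Complex.I_re, mul_zero, add_zero]
    congr 2
    · norm_num
    · push_cast; field_simp
  rw [integral_congr_ae this, integral_complex_ofReal, integral_const_mul, integral_gaussian]
  simp only [RCLike.re_to_complex, Complex.ofReal_re]
  rw [div_inv_eq_mul, Real.sqrt_eq_rpow, ← Real.rpow_add (by positivity)]
  norm_num

/-! ### Gaussian states as Gaussian averages of displacements -/

/-- The quadratic form of `Ωᵀ γ Ω`. -/
def covForm (γ : Matrix (Fin 2) (Fin 2) ℝ) (ξ : Fin 2 → ℝ) : ℝ :=
  γ 1 1 * ξ 0 ^ 2 - 2 * γ 0 1 * (ξ 0 * ξ 1) + γ 0 0 * ξ 1 ^ 2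

theorem IsPureCov.det' {γ : Matrix (Fin 2) (Fin 2) ℝ} (h : IsPureCov γ) :
    γ 0 0 * γ 1 1 - γ 0 1 ^ 2 = 1 := by
  have := h.det
  rw [Matrix.det_fin_two, h.symm] at this
  rw [← this]; ring

theorem covForm_mulVec {γ : Matrix (Fin 2) (Fin 2) ℝ} (h : γ 1 0 = γ 0 1)
    {S : Matrix (Fin 2) (Fin 2) ℝ} (hS : S.det = 1) (ξ : Fin 2 → ℝ) :
    covForm (S * γ * Sᵀ) (S *ᵥ ξ) = covForm γ ξ := by
  have hd := hS
  rw [Matrix.det_fin_two] at hd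
  simp only [covForm, Matrix.mul_apply, Fin.sum_univ_two, Matrix.transpose_apply, Matrix.mulVec,
    dotProduct, h]
  have : (S 0 0 * S 1 1 - S 0 1 * S 1 0) ^ 2 = 1 := by rw [hd]; norm_num
  linear_combination (γ 1 1 * ξ 0 ^ 2 - 2 * γ 0 1 * (ξ 0 * ξ 1) + γ 0 0 * ξ 1 ^ 2) * this

theorem integrable_exp_covForm {γ : Matrix (Fin 2) (Fin 2) ℝ} (h : IsPureCov γ) :
    Integrable fun p : ℝ × ℝ => Real.exp (-covForm γ ![p.1, p.2] / 4) := by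
  have hγ := h.det'
  have h0 := h.pos
  have h1 : 0 < γ 1 1 := by
    have : 0 < γ 0 0 * γ 1 1 := by nlinarith [sq_nonneg (γ 0 1)]
    exact pos_of_mul_pos_right this h0.le
  -- The form `covForm γ` has determinant one and trace `γ 0 0 + γ 1 1`, so its smaller eigenvalue,
  -- the inverse of the larger one, is at least `m`.
  set m : ℝ := (γ 0 0 + γ 1 1)⁻¹ with hm
  have hm0 : 0 < m := by positivity
  have hb : ∀ a b : ℝ, m * (a ^ 2 + b ^ 2) ≤ covForm γ ![a, b] := by
    intro a b
    rw [hm, inv_mul_le_iff₀ (by positivity)]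
    simp only [covForm, Matrix.cons_val_zero, Matrix.cons_val_one]
    nlinarith [sq_nonneg (γ 1 1 * a - γ 0 1 * b), sq_nonneg (γ 0 0 * b - γ 0 1 * a)]
  have hi := (integrable_exp_neg_mul_sq (b := m / 4) (by positivity)).mul_prod
    (integrable_exp_neg_mul_sq (b := m / 4) (by positivity))
  refine hi.mono' ?_ (ae_of_all _ fun p => ?_)
  · refine (Measurable.aestronglyMeasurable ?_)
    simp only [covForm, Matrix.cons_val_zero, Matrix.cons_val_one]
    fun_prop
  · rw [Real.norm_eq_abs, Real.abs_exp, ← Real.exp_add, Real.exp_le_exp]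
    have := hb p.1 p.2
    linarith

/-- Cauchy–Schwarz. The bound is uniform in the shift `a`, which is what Fubini needs below. -/
theorem integral_norm_mul_le (f h : Mode) (a : ℝ) :
    (Integrable fun x : ℝ => ‖f x‖ * ‖h (x - a)‖) ∧
      ∫ x : ℝ, ‖f x‖ * ‖h (x - a)‖ ≤ ‖f‖ * ‖h‖ := by
  have hf : MemLp (fun x : ℝ => ‖f x‖) 2 volume := (Lp.memLp f).norm
  have hh : MemLp (fun x : ℝ => ‖h (x - a)‖) 2 volume :=
    ((Lp.memLp h).comp_measurePreserving (measurePreserving_sub_right volume a)).norm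
  refine ⟨hf.integrable_mul hh, ?_⟩
  refine (integral_mul_le_Lp_mul_Lq_of_nonneg (p := 2) (q := 2)
    Real.HolderConjugate.two_two (ae_of_all _ fun _ => norm_nonneg _)
    (ae_of_all _ fun _ => norm_nonneg _) (by simpa using hf) (by simpa using hh)).trans ?_
  have e1 : (∫ x : ℝ, ‖f x‖ ^ (2 : ℝ)) ^ (1 / 2 : ℝ) = ‖f‖ := by
    rw [← Real.sqrt_eq_rpow, Real.sqrt_eq_iff_eq_sq
      (integral_nonneg fun _ => by positivity) (norm_nonneg _), ← @inner_self_eq_norm_sq ℂ,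
      L2.inner_def, ← integral_re (L2.integrable_inner f f)]
    congr 1
    ext x
    rw [Real.rpow_two, ← @inner_self_eq_norm_sq ℂ]
  have e2 : (∫ x : ℝ, ‖h (x - a)‖ ^ (2 : ℝ)) ^ (1 / 2 : ℝ) = ‖h‖ := by
    rw [integral_sub_right_eq_self (fun x => ‖h x‖ ^ (2 : ℝ)),
      ← Real.sqrt_eq_rpow, Real.sqrt_eq_iff_eq_sq
      (integral_nonneg fun _ => by positivity) (norm_nonneg _), ← @inner_self_eq_norm_sq ℂ,
      L2.inner_def, ← integral_re (L2.integrable_inner h h)]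
    congr 1
    ext x
    rw [Real.rpow_two, ← @inner_self_eq_norm_sq ℂ]
  rw [e1, e2]

/-- Completing the square in `b` leaves an exponent in `x` and `y` whose mixed terms cancel exactly
because `det γ = 1`. Purity is thus what makes the kernel of rank one. -/
theorem integral_gaussian_momentum {γ : Matrix (Fin 2) (Fin 2) ℝ} (h : IsPureCov γ) (x y : ℝ) :
    ∫ b : ℝ, Complex.exp ((-covForm γ ![x - y, b] / 4 : ℝ) +
      Complex.I * ((b * x - (x - y) * b / 2 : ℝ) : ℂ)) =
    2 * Real.pi * (gaussianWave 0 γ x * (starRingEnd ℂ) (gaussianWave 0 γ y)) := by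
  have h0 := h.pos
  have hd := h.det'
  have e : ∀ b : ℝ, Complex.exp ((-covForm γ ![x - y, b] / 4 : ℝ) +
      Complex.I * ((b * x - (x - y) * b / 2 : ℝ) : ℂ)) =
      Complex.exp ((-(γ 0 0) / 4 : ℂ) * (b : ℂ) ^ 2 +
        ((γ 0 1 * (x - y) / 2 : ℂ) + Complex.I * (x + y) / 2) * b +
        (-(γ 1 1) * (x - y) ^ 2 / 4 : ℂ)) := by
    intro b
    congr 1
    simp only [covForm, Matrix.cons_val_zero, Matrix.cons_val_one]
    push_cast
    ring
  simp_rw [e]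
  have hg0 : ((γ 0 0 : ℝ) : ℂ) ≠ 0 := by exact_mod_cast h0.ne'
  rw [integral_cexp_quadratic (by
    rw [Complex.div_ofNat_re, Complex.neg_re, Complex.ofReal_re]; linarith)]
  simp only [gaussianWave, map_mul, Complex.conj_ofReal, ← Complex.exp_conj]
  have e1 : ((Real.pi : ℂ) / -(-(γ 0 0) / 4 : ℂ)) ^ (1 / 2 : ℂ) =
      2 * Real.pi * ((((Real.pi * γ 0 0) ^ (-(1 / 4) : ℝ) : ℝ) : ℂ) *
        (((Real.pi * γ 0 0) ^ (-(1 / 4) : ℝ) : ℝ) : ℂ)) := by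
    have : ((Real.pi : ℂ) / -(-(γ 0 0) / 4 : ℂ)) = ((Real.pi / (γ 0 0 / 4) : ℝ) : ℂ) := by
      push_cast; ring
    rw [this, show (1 / 2 : ℂ) = ((1 / 2 : ℝ) : ℂ) by push_cast; rfl,
      ← Complex.ofReal_cpow (by positivity)]
    norm_cast
    rw [← Real.rpow_add (by positivity), ← Real.sqrt_eq_rpow, Real.sqrt_eq_iff_eq_sq
      (by positivity) (by positivity), mul_pow, ← Real.rpow_natCast ((Real.pi * γ 0 0) ^ (_ : ℝ)),
      ← Real.rpow_mul (by positivity)]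
    norm_num
    rw [Real.rpow_neg_one]
    field_simp
    norm_num
  rw [e1]
  have e2 : Complex.exp ((-(γ 1 1) * (x - y) ^ 2 / 4 : ℂ) -
      ((γ 0 1 * (x - y) / 2 : ℂ) + Complex.I * (x + y) / 2) ^ 2 / (4 * (-(γ 0 0) / 4 : ℂ))) =
      Complex.exp (-((1 - Complex.I * γ 0 1) / (2 * γ 0 0)) *
          ((x - (0 : Fin 2 → ℝ) 0 : ℝ) : ℂ) ^ 2 +
          Complex.I * (((0 : Fin 2 → ℝ) 1 * x : ℝ) : ℂ)) *
        Complex.exp ((starRingEnd ℂ) (-((1 - Complex.I * γ 0 1) / (2 * γ 0 0)) *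
          ((y - (0 : Fin 2 → ℝ) 0 : ℝ) : ℂ) ^ 2 +
          Complex.I * (((0 : Fin 2 → ℝ) 1 * y : ℝ) : ℂ))) := by
    rw [← Complex.exp_add]
    congr 1
    have hdC : ((γ 0 0 : ℝ) : ℂ) * γ 1 1 - (γ 0 1 : ℂ) ^ 2 = 1 := by exact_mod_cast hd
    simp only [map_mul, map_neg, map_div₀, map_sub, map_one, map_pow, Complex.conj_ofReal,
      Complex.conj_I, Pi.zero_apply, sub_zero, zero_mul, Complex.ofReal_zero, mul_zero, add_zero,
      map_ofNat]
    field_simp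
    linear_combination (-4 * ((x : ℂ) - y) ^ 2) * hdC + 4 * ((x : ℂ) + y) ^ 2 * Complex.I_sq
  rw [e2]
  ring

/-- The Gaussian average of the displacements is the projection on a Gaussian state. -/
theorem integral_exp_covForm_inner_displacement {γ : Matrix (Fin 2) (Fin 2) ℝ} (h : IsPureCov γ)
    (f k : Mode) :
    ∫ ξ : Fin 2 → ℝ, (Real.exp (-covForm γ ξ / 4) : ℂ) * inner ℂ f (displacement ξ k) =
      2 * Real.pi * (inner ℂ f (gaussianVector 0 γ) * inner ℂ (gaussianVector 0 γ) k) := by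
  have hf := Lp.stronglyMeasurable f
  have hk := Lp.stronglyMeasurable k
  set G : (ℝ × ℝ) → ℝ → ℂ := fun p x => (Real.exp (-covForm γ ![p.1, p.2] / 4) : ℂ) *
    ((starRingEnd ℂ) (f x) * (Complex.exp (Complex.I * ((p.2 * x - p.1 * p.2 / 2 : ℝ) : ℂ)) *
      k (x - p.1))) with hG
  have hGn : ∀ p x, ‖G p x‖ = Real.exp (-covForm γ ![p.1, p.2] / 4) *
      (‖f x‖ * ‖k (x - p.1)‖) := by
    intro p x
    simp only [hG, norm_mul, RCLike.norm_conj, norm_exp_I_mul, Complex.norm_real, Real.norm_eq_abs,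
      Real.abs_exp, one_mul]
  have hGm : StronglyMeasurable (Function.uncurry G) := by
    refine StronglyMeasurable.mul ?_ (StronglyMeasurable.mul ?_ (StronglyMeasurable.mul ?_ ?_))
    · refine Measurable.stronglyMeasurable ?_
      simp only [covForm, Matrix.cons_val_zero, Matrix.cons_val_one]
      fun_prop
    · exact (Complex.continuous_conj.comp_stronglyMeasurable hf).comp_measurable measurable_snd
    · exact Measurable.stronglyMeasurable (by fun_prop)
    · exact hk.comp_measurable (by fun_prop)
  have hGi : Integrable (Function.uncurry G) := by
    rw [Measure.volume_eq_prod, integrable_prod_iff hGm.aestronglyMeasurable]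
    refine ⟨ae_of_all _ fun p => ?_, ?_⟩
    · refine Integrable.mono' ((integral_norm_mul_le f k p.1).1.const_mul
        (Real.exp (-covForm γ ![p.1, p.2] / 4))) ?_ (ae_of_all _ fun x => (hGn p x).le)
      exact (hGm.comp_measurable measurable_prodMk_left).aestronglyMeasurable
    · refine Integrable.mono' ((integrable_exp_covForm h).mul_const (‖f‖ * ‖k‖))
        hGm.aestronglyMeasurable.norm.integral_prod_right' (ae_of_all _ fun p => ?_)
      rw [Real.norm_of_nonneg (integral_nonneg fun _ => norm_nonneg _)]
      simp only [Function.uncurry_apply_pair, hGn]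
      rw [integral_const_mul]
      exact mul_le_mul_of_nonneg_left (integral_norm_mul_le f k p.1).2 (Real.exp_pos _).le
  -- Only the `b`-integral can be evaluated in closed form, so it has to become the innermost one;
  -- this needs integrability with the coordinates grouped as `((a, x), b)`.
  have hGi' : Integrable fun q : (ℝ × ℝ) × ℝ => G (q.1.1, q.2) q.1.2 := by
    have hmp : MeasurePreserving
        (fun q : (ℝ × ℝ) × ℝ => ((q.1.1, q.2), q.1.2)) volume volume := by
      have e1 := (volume_preserving_prodAssoc (α₁ := ℝ) (β₁ := ℝ) (γ₁ := ℝ)).symm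
        MeasurableEquiv.prodAssoc
      have e3 := volume_preserving_prodAssoc (α₁ := ℝ) (β₁ := ℝ) (γ₁ := ℝ)
      have e2 : MeasurePreserving (Prod.map (id : ℝ → ℝ) (Prod.swap : ℝ × ℝ → ℝ × ℝ))
          volume volume := (MeasurePreserving.id volume).prod Measure.measurePreserving_swap
      exact e1.comp (e2.comp e3)
    exact hmp.integrable_comp_of_integrable hGi
  have step1 : ∫ ξ : Fin 2 → ℝ, (Real.exp (-covForm γ ξ / 4) : ℂ) * inner ℂ f (displacement ξ k) =
      ∫ p : ℝ × ℝ, ∫ x : ℝ, G p x := by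
    rw [← (volume_preserving_finTwoArrow ℝ).integral_comp'
      (g := fun p : ℝ × ℝ => ∫ x : ℝ, G p x)]
    congr 1
    ext ξ
    rw [inner_displacement, ← integral_const_mul]
    congr 1
  have step2 : ∫ p : ℝ × ℝ, ∫ x : ℝ, G p x = ∫ a : ℝ, ∫ x : ℝ, ∫ b : ℝ, G (a, b) x := by
    rw [Measure.volume_eq_prod, integral_prod (fun p : ℝ × ℝ => ∫ x : ℝ, G p x)
      hGi.integral_prod_left]
    apply integral_congr_ae
    have hs : ∀ᵐ a : ℝ, Integrable (fun q : ℝ × ℝ => G (a, q.1) q.2) := by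
      have hmp := (volume_preserving_prodAssoc (α₁ := ℝ) (β₁ := ℝ) (γ₁ := ℝ)).symm
        MeasurableEquiv.prodAssoc
      have := hmp.integrable_comp_of_integrable hGi
      rw [Measure.volume_eq_prod ℝ (ℝ × ℝ)] at this
      exact this.prod_right_ae
    filter_upwards [hs] with a ha
    exact integral_integral_swap ha
  have hK : ∀ a x : ℝ, ∫ b : ℝ, G (a, b) x = (starRingEnd ℂ) (f x) * k (x - a) *
      (2 * Real.pi * (gaussianWave 0 γ x * (starRingEnd ℂ) (gaussianWave 0 γ (x - a)))) := by
    intro a x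
    rw [← integral_gaussian_momentum h, ← integral_const_mul]
    congr 1
    ext b
    simp only [hG]
    rw [Complex.exp_add, Complex.ofReal_exp, sub_sub_cancel]
    ring
  have step3 : ∫ a : ℝ, ∫ x : ℝ, ∫ b : ℝ, G (a, b) x = ∫ x : ℝ, ∫ a : ℝ, ∫ b : ℝ, G (a, b) x := by
    apply integral_integral_swap
    have := hGi'.integral_prod_left
    exact this
  rw [step1, step2, step3]
  simp_rw [hK]
  have step4 : ∀ x : ℝ, ∫ a : ℝ, (starRingEnd ℂ) (f x) * k (x - a) *
      (2 * Real.pi * (gaussianWave 0 γ x * (starRingEnd ℂ) (gaussianWave 0 γ (x - a)))) =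
      2 * Real.pi * inner ℂ (gaussianVector 0 γ) k *
        ((starRingEnd ℂ) (f x) * gaussianWave 0 γ x) := by
    -- Substituting `y = x - a` separates the variables, and the two remaining integrals are the two
    -- inner products.
    intro x
    rw [integral_sub_left_eq_self (fun y => (starRingEnd ℂ) (f x) * k y *
      (2 * Real.pi * (gaussianWave 0 γ x * (starRingEnd ℂ) (gaussianWave 0 γ y)))) volume x]
    have : ∀ᵐ y : ℝ, (starRingEnd ℂ) (f x) * k y *
      (2 * Real.pi * (gaussianWave 0 γ x * (starRingEnd ℂ) (gaussianWave 0 γ y))) =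
        ((starRingEnd ℂ) (f x) * (2 * Real.pi * gaussianWave 0 γ x)) *
          inner ℂ (gaussianVector 0 γ y) (k y) := by
      filter_upwards [coeFn_gaussianVector 0 h.pos] with y hy
      rw [hy, RCLike.inner_apply]
      ring
    rw [integral_congr_ae this, integral_const_mul, ← L2.inner_def]
    ring
  simp_rw [step4]
  rw [integral_const_mul]
  have : ∫ x : ℝ, (starRingEnd ℂ) (f x) * gaussianWave 0 γ x =
      inner ℂ f (gaussianVector 0 γ) := by
    rw [L2.inner_def]
    apply integral_congr_ae
    filter_upwards [coeFn_gaussianVector 0 h.pos] with y hy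
    rw [hy, RCLike.inner_apply, mul_comm]
  rw [this]
  ring

/-! ### Symplectic unitaries and Gaussian states -/

theorem integral_comp_mulVec {S : Matrix (Fin 2) (Fin 2) ℝ} (hS : S.det = 1)
    (F : (Fin 2 → ℝ) → ℂ) : ∫ ξ, F (S *ᵥ ξ) = ∫ ξ, F ξ := by
  have h := Real.map_matrix_volume_pi_eq_smul_volume_pi (M := S) (by rw [hS]; norm_num)
  rw [hS] at h
  simp only [inv_one, abs_one, ENNReal.ofReal_one, one_smul] at h
  have hS' : IsUnit S.det := by rw [hS]; exact isUnit_one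
  let e : (Fin 2 → ℝ) ≃ᵐ (Fin 2 → ℝ) :=
    ((Matrix.toLinearEquiv' S (Matrix.invertibleOfIsUnitDet S hS')).toContinuousLinearEquiv
      ).toHomeomorph.toMeasurableEquiv
  have he : (e : (Fin 2 → ℝ) → (Fin 2 → ℝ)) = Matrix.toLin' S := rfl
  have hm : MeasurePreserving e volume volume := ⟨e.measurable, by rw [he]; exact h⟩
  exact hm.integral_comp' F

theorem mulVec_inv_mulVec {S : Matrix (Fin 2) (Fin 2) ℝ} (hS : S.det = 1) (ξ : Fin 2 → ℝ) :
    S *ᵥ (S⁻¹ *ᵥ ξ) = ξ := by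
  rw [Matrix.mulVec_mulVec, Matrix.mul_nonsing_inv _ (by rw [hS]; exact isUnit_one),
    Matrix.one_mulVec]

theorem inv_mulVec_mulVec {S : Matrix (Fin 2) (Fin 2) ℝ} (hS : S.det = 1) (ξ : Fin 2 → ℝ) :
    S⁻¹ *ᵥ (S *ᵥ ξ) = ξ := by
  rw [Matrix.mulVec_mulVec, Matrix.nonsing_inv_mul _ (by rw [hS]; exact isUnit_one),
    Matrix.one_mulVec]

theorem det_inv_eq_one {S : Matrix (Fin 2) (Fin 2) ℝ} (hS : S.det = 1) : S⁻¹.det = 1 := by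
  rw [Matrix.det_nonsing_inv, hS, Ring.inverse_one]

theorem Implements.symm {U : Mode ≃ₗᵢ[ℂ] Mode} {S : Matrix (Fin 2) (Fin 2) ℝ}
    (h : Implements U S) (hS : S.det = 1) : Implements U.symm S⁻¹ := by
  intro ξ f
  rw [LinearIsometryEquiv.symm_apply_eq, h, mulVec_inv_mulVec hS,
    LinearIsometryEquiv.apply_symm_apply]

/-- Conjugation by `U` turns the Gaussian average of the `D(ξ)` into that of the `D(S ξ)`. Since `S`
preserves area and transports `covForm γ` to the form of `S * γ * Sᵀ`, the projections on `U g` and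
on `g'` coincide, and unit vectors with the same projection differ by a phase. -/
theorem Implements.map_gaussianVector_zero {U : Mode ≃ₗᵢ[ℂ] Mode}
    {S : Matrix (Fin 2) (Fin 2) ℝ} (h : Implements U S) (hS : S.det = 1)
    {γ : Matrix (Fin 2) (Fin 2) ℝ} (hγ : IsPureCov γ) :
    ∃ c : ℂ, ‖c‖ = 1 ∧ U (gaussianVector 0 γ) = c • gaussianVector 0 (S * γ * Sᵀ) := by
  have hγ' := hγ.conj hS
  set g := gaussianVector 0 γ
  set g' := gaussianVector 0 (S * γ * Sᵀ)
  have key : ∀ f k : Mode, inner ℂ f (U g) * inner ℂ (U g) k = inner ℂ f g' * inner ℂ g' k := by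
    intro f k
    have h1 := integral_exp_covForm_inner_displacement hγ (U.symm f) (U.symm k)
    have h2 := integral_exp_covForm_inner_displacement hγ' f k
    rw [← integral_comp_mulVec hS] at h2
    have h3 : ∀ ξ, inner ℂ (U.symm f) (displacement ξ (U.symm k)) =
        inner ℂ f (displacement (S *ᵥ ξ) k) := by
      intro ξ
      rw [← LinearIsometryEquiv.inner_map_map U, h, LinearIsometryEquiv.apply_symm_apply,
        LinearIsometryEquiv.apply_symm_apply]
    simp_rw [h3] at h1
    simp_rw [covForm_mulVec hγ.symm hS] at h2
    rw [h1] at h2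
    have h4 := mul_left_cancel₀ (by simp [Real.pi_ne_zero]) h2
    rw [← LinearIsometryEquiv.inner_map_map U (U.symm f),
      ← LinearIsometryEquiv.inner_map_map U _ (U.symm k)] at h4
    simpa using h4
  have hn : ‖U g‖ = 1 := by rw [LinearIsometryEquiv.norm_map, norm_gaussianVector 0 hγ.pos]
  have hn' : ‖g'‖ = 1 := norm_gaussianVector 0 hγ'.pos
  have e : U g = inner ℂ g' (U g) • g' := by
    -- With `k = U g` the identity of projections says that `U g` equals its own component along
    -- `g'`.
    refine ext_inner_left ℂ fun f => ?_
    have := key f (U g)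
    rw [inner_self_eq_norm_sq_to_K, hn] at this
    rw [inner_smul_right, mul_comm (inner ℂ g' (U g)), ← this]
    simp
  refine ⟨_, ?_, e⟩
  have := congrArg norm e
  rw [norm_smul, hn, hn', mul_one] at this
  exact this.symm

theorem Implements.map_gaussianVector {U : Mode ≃ₗᵢ[ℂ] Mode}
    {S : Matrix (Fin 2) (Fin 2) ℝ} (h : Implements U S) (hS : S.det = 1)
    (d : Fin 2 → ℝ) {γ : Matrix (Fin 2) (Fin 2) ℝ} (hγ : IsPureCov γ) :
    ∃ c : ℂ, ‖c‖ = 1 ∧ U (gaussianVector d γ) = c • gaussianVector (S *ᵥ d) (S * γ * Sᵀ) := by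
  obtain ⟨c, hc, e⟩ := h.map_gaussianVector_zero hS hγ
  rw [gaussianVector_eq_displacement d hγ.pos,
    gaussianVector_eq_displacement (S *ᵥ d) (hγ.conj hS).pos]
  set t := d 0 * d 1 / 2
  set t' := (S *ᵥ d) 0 * (S *ᵥ d) 1 / 2
  refine ⟨Complex.exp (Complex.I * t) * c * (Complex.exp (Complex.I * t'))⁻¹, ?_, ?_⟩
  · rw [norm_mul, norm_mul, norm_inv, norm_exp_I_mul, norm_exp_I_mul, hc]; norm_num
  · rw [map_smul, h, e, map_smul, smul_smul, smul_smul, mul_assoc (_ * c), inv_mul_cancel₀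
      (Complex.exp_ne_zero _), mul_one]

/-! ### Coherent states -/

/-- The vacuum. -/
def vacuum : Mode := gaussianVector 0 1

theorem isPureCov_one : IsPureCov 1 := ⟨by simp, by simp, by simp⟩

theorem coeFn_vacuum : vacuum =ᵐ[volume] fun x => ((Real.pi ^ (-(1 / 4) : ℝ) *
    Real.exp (-x ^ 2 / 2) : ℝ) : ℂ) := by
  filter_upwards [coeFn_gaussianVector 0 isPureCov_one.pos] with x hx
  rw [vacuum, hx, gaussianWave]
  push_cast
  congr 2
  · simp
  · simp; ring

/-- An integrable function on the line with vanishing Fourier transform vanishes. -/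
theorem ae_eq_zero_of_fourier_eq_zero {u : ℝ → ℂ} (hu : Integrable u)
    (h : ∀ b : ℝ, ∫ x : ℝ, Complex.exp (Complex.I * ((b * x : ℝ) : ℂ)) * u x = 0) :
    u =ᵐ[volume] 0 := by
  have hF : ∀ w : ℝ, FourierTransform.fourier u w = 0 := by
    intro w
    rw [Real.fourier_eq', ← h (-2 * Real.pi * w)]
    congr 1
    ext x
    rw [smul_eq_mul]
    congr 2
    simp
    ring
  apply ae_eq_zero_of_integral_contDiff_smul_eq_zero hu.locallyIntegrable
  intro g hg hgc
  let gs : SchwartzMap ℝ ℂ := (hgc.comp_left (g := ((↑) : ℝ → ℂ)) rfl).toSchwartzMap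
    (Complex.ofRealCLM.contDiff.comp hg)
  -- The test function is the Fourier transform of the Schwartz function `φ`, so its pairing with
  -- `u` equals the pairing of `φ` with the transform of `u`, which is zero.
  let φ : SchwartzMap ℝ ℂ := FourierTransformInv.fourierInv gs
  have hφ : FourierTransform.fourier (φ : ℝ → ℂ) = gs := by
    rw [← SchwartzMap.fourier_coe]
    simp [φ]
  have key := VectorFourier.integral_fourierIntegral_smul_eq_flip (L := innerₗ ℝ)
    (f := (φ : ℝ → ℂ)) (g := u) (μ := volume) (ν := volume) Real.continuous_fourierChar
    continuous_inner φ.integrable hu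
  have hz : ∀ w, VectorFourier.fourierIntegral Real.fourierChar volume (innerₗ ℝ).flip u w = 0 := by
    intro w
    rw [← hF w]
    simp only [VectorFourier.fourierIntegral, Real.fourier_eq, LinearMap.flip_apply, innerₗ_apply_apply,
      real_inner_comm]
  simp_rw [hz, smul_zero, integral_zero] at key
  rw [← key]
  congr 1
  ext x
  have h1 : VectorFourier.fourierIntegral Real.fourierChar volume (innerₗ ℝ) (φ : ℝ → ℂ) x =
      gs x := by
    rw [← hφ]
    rfl
  rw [h1]
  exact (Complex.coe_smul (g x) (u x)).symm

/-- Momentum displacements alone suffice: orthogonality to them says that the product of `f` with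
the vacuum has vanishing Fourier transform, and the vacuum wave function has no zeros. -/
theorem eq_zero_of_orthogonal_coherent (f : Mode)
    (h : ∀ ξ, inner ℂ (displacement ξ vacuum) f = 0) : f = 0 := by
  have hu : Integrable fun x : ℝ => inner ℂ (vacuum x) (f x) := L2.integrable_inner vacuum f
  have hz := ae_eq_zero_of_fourier_eq_zero hu fun b => by
    rw [← h ![0, -b], L2.inner_def]
    apply integral_congr_ae
    filter_upwards [coeFn_displacement ![0, -b] vacuum] with x hx
    rw [hx]
    simp only [RCLike.inner_apply, map_mul, ← Complex.exp_conj, Complex.conj_I, Complex.conj_ofReal,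
      Matrix.cons_val_zero, Matrix.cons_val_one, sub_zero]
    rw [mul_left_comm]
    congr 2
    push_cast
    ring_nf
  apply Lp.ext
  filter_upwards [hz, coeFn_vacuum, Lp.coeFn_zero ℂ 2 (volume : Measure ℝ)] with x h1 h2 h3
  rw [h3]
  rw [h2, RCLike.inner_apply] at h1
  refine (mul_eq_zero.1 h1).resolve_right ?_
  rw [Complex.conj_ofReal]
  norm_cast
  positivity

theorem dense_span_coherent :
    Dense (Submodule.span ℂ (Set.range fun ξ => displacement ξ vacuum) : Set Mode) := by
  rw [Submodule.dense_iff_topologicalClosure_eq_top, Submodule.topologicalClosure_eq_top_iff,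
    Submodule.eq_bot_iff]
  intro f hf
  exact eq_zero_of_orthogonal_coherent f fun ξ =>
    (Submodule.mem_orthogonal _ _).1 hf _ (Submodule.subset_span ⟨ξ, rfl⟩)

theorem parity_gaussianVector_zero {γ : Matrix (Fin 2) (Fin 2) ℝ} (h : 0 < γ 0 0) :
    parity (gaussianVector 0 γ) = gaussianVector 0 γ := by
  apply Lp.ext
  filter_upwards [coeFn_compUnitary (MeasurableEquiv.neg ℝ) (Measure.measurePreserving_neg volume)
      (gaussianVector 0 γ), (Measure.measurePreserving_neg
      (volume : Measure ℝ)).quasiMeasurePreserving.ae (coeFn_gaussianVector 0 h),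
      coeFn_gaussianVector 0 h] with x h1 h2 h3
  refine h1.trans (h2.trans ?_)
  rw [h3]
  simp [gaussianWave]

/-- It is enough to test coherent states. Parity reverses displacements and fixes every centred
Gaussian state, in particular the vacuum and its image under `U`. -/
theorem Implements.map_parity {U : Mode ≃ₗᵢ[ℂ] Mode} {S : Matrix (Fin 2) (Fin 2) ℝ}
    (h : Implements U S) (hS : S.det = 1) (f : Mode) : U (parity f) = parity (U f) := by
  have e : toOp U ∘L toOp parity = toOp parity ∘L toOp U := by
    refine ContinuousLinearMap.ext_on dense_span_coherent ?_
    rintro _ ⟨ξ, rfl⟩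
    obtain ⟨c, -, hc⟩ := h.map_gaussianVector_zero hS isPureCov_one
    change U (parity (displacement ξ vacuum)) = parity (U (displacement ξ vacuum))
    rw [parity_displacement, h, h, parity_displacement, vacuum,
      parity_gaussianVector_zero isPureCov_one.pos, hc, map_smul parity,
      parity_gaussianVector_zero (isPureCov_one.conj hS).pos, Matrix.mulVec_neg]
  exact DFunLike.congr_fun e f

theorem inner_vacuum_displacement (ξ : Fin 2 → ℝ) :
    inner ℂ vacuum (displacement ξ vacuum) = Real.exp (-(ξ 0 ^ 2 + ξ 1 ^ 2) / 4) := by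
  rw [inner_displacement]
  have : ∀ᵐ x : ℝ, (starRingEnd ℂ) (vacuum x) *
      (Complex.exp (Complex.I * ((ξ 1 * x - ξ 0 * ξ 1 / 2 : ℝ) : ℂ)) * vacuum (x - ξ 0)) =
      ((Real.pi ^ (-(1 / 2) : ℝ) : ℝ) : ℂ) * Complex.exp ((-1 : ℂ) * (x : ℂ) ^ 2 +
        (ξ 0 + Complex.I * ξ 1 : ℂ) * x + (-(ξ 0) ^ 2 / 2 - Complex.I * ξ 0 * ξ 1 / 2 : ℂ)) := by
    filter_upwards [coeFn_vacuum, (measurePreserving_sub_right volume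
      (ξ 0)).quasiMeasurePreserving.ae coeFn_vacuum] with x h1 h2
    rw [h1, h2, Complex.conj_ofReal]
    have e : (Real.pi ^ (-(1 / 2) : ℝ) : ℝ) = Real.pi ^ (-(1 / 4) : ℝ) * Real.pi ^ (-(1 / 4) : ℝ) := by
      rw [← Real.rpow_add Real.pi_pos]; norm_num
    rw [e]
    push_cast
    have e2 : Complex.exp ((-1 : ℂ) * (x : ℂ) ^ 2 +
        (ξ 0 + Complex.I * ξ 1 : ℂ) * x + (-(ξ 0) ^ 2 / 2 - Complex.I * ξ 0 * ξ 1 / 2 : ℂ)) =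
        Complex.exp (-(x : ℂ) ^ 2 / 2) * (Complex.exp (Complex.I * (ξ 1 * x - ξ 0 * ξ 1 / 2)) *
          Complex.exp (-((x : ℂ) - ξ 0) ^ 2 / 2)) := by
      rw [← Complex.exp_add, ← Complex.exp_add]
      congr 1
      ring
    rw [e2]
    ring
  rw [integral_congr_ae this, integral_const_mul, integral_cexp_quadratic (by simp), neg_neg,
    div_one, show (1 / 2 : ℂ) = ((1 / 2 : ℝ) : ℂ) by push_cast; rfl,
    ← Complex.ofReal_cpow Real.pi_pos.le, ← mul_assoc, ← Complex.ofReal_mul,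
    ← Real.rpow_add Real.pi_pos]
  norm_num
  congr 1
  linear_combination ((ξ 1 : ℂ) ^ 2 / 4) * Complex.I_sq

/-- The overlap involves only the symplectic form and the Euclidean distance, both of which are
invariant under rotations. -/
theorem inner_coherent (ξ η : Fin 2 → ℝ) :
    inner ℂ (displacement ξ vacuum) (displacement η vacuum) =
      Complex.exp (Complex.I * ((symp ξ η / 2 : ℝ) : ℂ)) *
        Real.exp (-((η - ξ) 0 ^ 2 + (η - ξ) 1 ^ 2) / 4) := by
  have e : (displacement ξ).symm (displacement η vacuum) =
      Complex.exp (Complex.I * ((symp ξ η / 2 : ℝ) : ℂ)) • displacement (η - ξ) vacuum := by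
    rw [displacement_symm, displacement_displacement, neg_add_eq_sub]
    congr 3
    simp [symp]
    ring
  rw [← LinearIsometryEquiv.inner_map_map (displacement ξ).symm, e,
    LinearIsometryEquiv.symm_apply_apply, inner_smul_right, inner_vacuum_displacement]

theorem det_rotation (θ : ℝ) : (rotation θ).det = 1 := by
  simp [rotation, Matrix.det_fin_two_of, ← sq]

theorem normSq_rotation_mulVec (θ : ℝ) (ξ : Fin 2 → ℝ) :
    (rotation θ *ᵥ ξ) 0 ^ 2 + (rotation θ *ᵥ ξ) 1 ^ 2 = ξ 0 ^ 2 + ξ 1 ^ 2 := by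
  simp [rotation, Matrix.mulVec, dotProduct, Fin.sum_univ_two]
  linear_combination (ξ 0 ^ 2 + ξ 1 ^ 2) * Real.sin_sq_add_cos_sq θ

/-- Phase-space rotations are implemented by unitaries. -/
theorem exists_implements_rotation (θ : ℝ) : ∃ V : Mode ≃ₗᵢ[ℂ] Mode, Implements V (rotation θ) := by
  set coh : (Fin 2 → ℝ) → Mode := fun ξ => displacement ξ vacuum with hcoh
  -- Formal combinations of coherent states serve as the domain, so no linear independence is
  -- needed: relabelling `ξ` as `rotation θ *ᵥ ξ` preserves the Gram matrix and therefore descends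
  -- to an isometry of the closed span, which is everything.
  set φ : ((Fin 2 → ℝ) →₀ ℂ) →ₗ[ℂ] Mode := Finsupp.linearCombination ℂ coh with hφ
  have hdense : DenseRange φ := by
    have := dense_span_coherent
    rw [← Finsupp.range_linearCombination] at this
    exact this
  let e : (Fin 2 → ℝ) ≃ (Fin 2 → ℝ) :=
    ⟨fun ξ => rotation θ *ᵥ ξ, fun ξ => (rotation θ)⁻¹ *ᵥ ξ,
      inv_mulVec_mulVec (det_rotation θ), mulVec_inv_mulVec (det_rotation θ)⟩
  let T : ((Fin 2 → ℝ) →₀ ℂ) ≃ₗ[ℂ] ((Fin 2 → ℝ) →₀ ℂ) := Finsupp.domLCongr e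
  have hcohT : ∀ ξ η, inner ℂ (coh (e ξ)) (coh (e η)) = inner ℂ (coh ξ) (coh η) := by
    intro ξ η
    simp only [hcoh, e, Equiv.coe_fn_mk]
    rw [inner_coherent, inner_coherent, symp_mulVec, det_rotation, one_mul, ← Matrix.mulVec_sub,
      normSq_rotation_mulVec]
  have hinner : ∀ a b, inner ℂ (φ (T a)) (φ (T b)) = inner ℂ (φ a) (φ b) := by
    intro a b
    induction a using Finsupp.induction_linear with
    | zero => simp
    | add a a' h h' => simp only [map_add, inner_add_left, h, h']
    | single ξ c =>
      induction b using Finsupp.induction_linear with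
      | zero => simp
      | add b b' h h' => simp only [map_add, inner_add_right, h, h']
      | single η c' =>
        simp only [hφ, T, Finsupp.domLCongr_single, Finsupp.linearCombination_single,
          inner_smul_left, inner_smul_right, hcohT]
  have hnorm : ∀ a, ‖φ (T a)‖ = ‖φ a‖ := by
    intro a
    rw [@norm_eq_sqrt_re_inner ℂ, @norm_eq_sqrt_re_inner ℂ, hinner]
  let V := T.extendOfIsometry φ φ hdense hdense hnorm
  have hV : ∀ ξ, V (coh ξ) = coh (rotation θ *ᵥ ξ) := by
    intro ξ
    have := LinearEquiv.extendOfIsometry_eq T φ φ hdense hdense hnorm (Finsupp.single ξ 1)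
    simp only [T, Finsupp.domLCongr_single, hφ, Finsupp.linearCombination_single, one_smul] at this
    exact this
  refine ⟨V, fun ξ f => ?_⟩
  -- On coherent states the intertwining relation is the Weyl relation on both sides; the two phases
  -- agree because rotations preserve `symp`.
  have key : toOp V ∘L toOp (displacement ξ) =
      toOp (displacement (rotation θ *ᵥ ξ)) ∘L toOp V := by
    refine ContinuousLinearMap.ext_on dense_span_coherent ?_
    rintro _ ⟨η, rfl⟩
    change V (displacement ξ (displacement η vacuum)) =
      displacement (rotation θ *ᵥ ξ) (V (coh η))
    rw [hV, displacement_displacement, map_smul]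
    change _ • V (coh (ξ + η)) = displacement (rotation θ *ᵥ ξ) (displacement _ vacuum)
    rw [hV, displacement_displacement, symp_mulVec, det_rotation, one_mul, Matrix.mulVec_add]
  exact DFunLike.congr_fun key f

/-! ### The trace -/

section Trace

variable {ι H : Type} [NormedAddCommGroup H] [InnerProductSpace ℂ H] [CompleteSpace H]

omit [CompleteSpace H] in
theorem hasSum_norm_inner_sq (e : HilbertBasis ι ℂ H) (x : H) :
    HasSum (fun i => ‖inner ℂ (e i) x‖ ^ 2) (‖x‖ ^ 2) := by
  have h := e.hasSum_inner_mul_inner x x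
  rw [inner_self_eq_norm_sq_to_K] at h
  have h2 : ∀ i, inner ℂ x (e i) * inner ℂ (e i) x = ((‖inner ℂ (e i) x‖ ^ 2 : ℝ) : ℂ) := by
    intro i
    rw [← inner_conj_symm x (e i), RCLike.conj_mul]
    push_cast
    rfl
  simp_rw [h2] at h
  exact Complex.hasSum_ofReal.1 (by simpa using h)

omit [CompleteSpace H] in
theorem summable_prod_norm_inner_sq (e : HilbertBasis ι ℂ H) {T : H →L[ℂ] H}
    (hT : Summable fun i => ‖T (e i)‖ ^ 2) :
    Summable fun p : ι × ι => ‖inner ℂ (e p.2) (T (e p.1))‖ ^ 2 := by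
  rw [summable_prod_of_nonneg (fun p => by positivity)]
  refine ⟨fun i => (hasSum_norm_inner_sq e (T (e i))).summable, ?_⟩
  refine hT.congr fun i => ?_
  exact (hasSum_norm_inner_sq e (T (e i))).tsum_eq.symm

/-- The two sums add up the same squared matrix elements, by columns and by rows. -/
theorem summable_norm_adjoint_sq (e : HilbertBasis ι ℂ H) {T : H →L[ℂ] H}
    (hT : Summable fun i => ‖T (e i)‖ ^ 2) : Summable fun i => ‖T.adjoint (e i)‖ ^ 2 := by
  have h1 := (summable_prod_norm_inner_sq e hT).prod_symm
  rw [summable_prod_of_nonneg (fun p => by positivity)] at h1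
  refine h1.2.congr fun i => ?_
  rw [← (hasSum_norm_inner_sq e (T.adjoint (e i))).tsum_eq]
  congr 1
  ext j
  rw [ContinuousLinearMap.adjoint_inner_right, Prod.swap, norm_inner_symm]

omit [CompleteSpace H] in
theorem summable_norm_comp_sq (e : HilbertBasis ι ℂ H) {T : H →L[ℂ] H} (A : H →L[ℂ] H)
    (hT : Summable fun i => ‖T (e i)‖ ^ 2) : Summable fun i => ‖(A ∘L T) (e i)‖ ^ 2 := by
  refine Summable.of_nonneg_of_le (fun i => by positivity) (fun i => ?_) (hT.mul_left (‖A‖ ^ 2))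
  rw [← mul_pow]
  exact pow_le_pow_left₀ (norm_nonneg _) (A.le_opNorm _) 2

/-- Cyclicity of the trace for Hilbert–Schmidt `T`. Both sides are iterated sums of the double
family `F`, which converges absolutely as a product of two square summable families, the matrix
elements of `T` and of `A.adjoint ∘L T`. -/
theorem hasSum_inner_hilbertSchmidt (e : HilbertBasis ι ℂ H) {T : H →L[ℂ] H}
    (hT : Summable fun i => ‖T (e i)‖ ^ 2) (A : H →L[ℂ] H) :
    HasSum (fun i => inner ℂ (T (e i)) (A (T (e i))))
      (∑' i, inner ℂ (e i) (T (T.adjoint (A (e i))))) := by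
  set F : ι × ι → ℂ := fun p => inner ℂ (e p.1) (T (e p.2)) *
    inner ℂ (e p.2) (T.adjoint (A (e p.1))) with hF
  have h1 := (summable_prod_norm_inner_sq e hT).prod_symm
  have h2 := (summable_prod_norm_inner_sq e (summable_norm_comp_sq e A.adjoint hT)).prod_symm
  have hFs : Summable F := by
    refine Summable.of_norm_bounded (h1.add h2) fun p => ?_
    have : ‖inner ℂ (e p.2) (T.adjoint (A (e p.1)))‖ =
        ‖inner ℂ (e p.1) ((A.adjoint ∘L T) (e p.2))‖ := by
      rw [ContinuousLinearMap.adjoint_inner_right, ContinuousLinearMap.comp_apply,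
        ContinuousLinearMap.adjoint_inner_right, norm_inner_symm]
    simp only [hF, norm_mul, this, Prod.fst_swap, Prod.snd_swap]
    nlinarith [sq_nonneg (‖inner ℂ (e p.1) (T (e p.2))‖ -
      ‖inner ℂ (e p.1) ((A.adjoint ∘L T) (e p.2))‖),
      sq_nonneg ‖inner ℂ (e p.1) (T (e p.2))‖,
      sq_nonneg ‖inner ℂ (e p.1) ((A.adjoint ∘L T) (e p.2))‖]
  have s1 : HasSum (fun i => inner ℂ (e i) (T (T.adjoint (A (e i))))) (∑' p, F p) := by
    refine hFs.hasSum.prod_fiberwise fun i => ?_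
    have := e.hasSum_inner_mul_inner (T.adjoint (e i)) (T.adjoint (A (e i)))
    simpa only [ContinuousLinearMap.adjoint_inner_left] using this
  have s2 : HasSum (fun j => inner ℂ (T (e j)) (A (T (e j)))) (∑' p, F p) := by
    have hs := hFs.prod_symm.hasSum
    have e1 : ∑' p : ι × ι, F p.swap = ∑' p, F p := (Equiv.prodComm ι ι).tsum_eq F
    rw [e1] at hs
    refine hs.prod_fiberwise fun j => ?_
    have := e.hasSum_inner_mul_inner (A.adjoint (T (e j))) (T (e j))
    rw [ContinuousLinearMap.adjoint_inner_left] at this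
    convert! this using 2 with i
    simp only [hF, Prod.swap]
    rw [ContinuousLinearMap.adjoint_inner_right, ContinuousLinearMap.adjoint_inner_left, mul_comm]
  rw [s1.tsum_eq]
  exact s2

theorem adjoint_toOp (U : H ≃ₗᵢ[ℂ] H) : (toOp U).adjoint = toOp U.symm := by
  ext x
  refine ext_inner_left ℂ fun y => ?_
  rw [ContinuousLinearMap.adjoint_inner_right]
  change inner ℂ (U y) x = inner ℂ y (U.symm x)
  rw [← LinearIsometryEquiv.inner_map_map U y, LinearIsometryEquiv.apply_symm_apply]

/-- Positivity gives `ρ = T T†`, and trace one makes `T` Hilbert–Schmidt. The vectors `v i = T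
(basis H i)` then satisfy `ρ = ∑ |v i⟩⟨v i|`, without any appeal to eigenvectors. -/
theorem exists_family {ρ : H →L[ℂ] H} (hρ : IsDensityOperator ρ) :
    ∃ v : basisSet H → H, (Summable fun i => ‖v i‖ ^ 2) ∧
      (∀ (U : H ≃ₗᵢ[ℂ] H) (A : H →L[ℂ] H),
        HasSum (fun i => inner ℂ (U (v i)) (A (U (v i)))) (trace (conj U ρ ∘L A))) ∧
      ∀ g : H, HasSum (fun i => ‖inner ℂ (v i) g‖ ^ 2) (inner ℂ g (ρ g)).re := by
  obtain ⟨b, hb⟩ := CStarAlgebra.nonneg_iff_eq_star_mul_self.1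
    ((ContinuousLinearMap.nonneg_iff_isPositive ρ).2 hρ.isPositive)
  set T : H →L[ℂ] H := b.adjoint with hT
  have hTb : T.adjoint = b := ContinuousLinearMap.adjoint_adjoint b
  have hρT : ∀ x, ρ x = T (T.adjoint x) := by
    intro x
    rw [hb, hTb]
    rfl
  have hs' : Summable fun i => ‖T.adjoint (basis H i)‖ ^ 2 := by
    have h := hρ.hasSum_one.summable
    have h2 : ∀ i, inner ℂ (basis H i) (ρ (basis H i)) =
        ((‖T.adjoint (basis H i)‖ ^ 2 : ℝ) : ℂ) := by
      intro i
      rw [hρT, ← ContinuousLinearMap.adjoint_inner_left, inner_self_eq_norm_sq_to_K]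
      push_cast
      rfl
    simp_rw [h2] at h
    exact_mod_cast h
  have hs : Summable fun i => ‖T (basis H i)‖ ^ 2 := by
    simpa using summable_norm_adjoint_sq (basis H) hs'
  refine ⟨fun i => T (basis H i), hs, fun U A => ?_, fun g => ?_⟩
  · have hs2 : Summable fun i => ‖(toOp U ∘L T) (basis H i)‖ ^ 2 := by
      refine hs.congr fun i => ?_
      exact congrArg (· ^ 2) (U.norm_map _).symm
    have := hasSum_inner_hilbertSchmidt (basis H) hs2 A
    convert! this using 1
    rw [trace]
    congr 1
    ext i
    rw [ContinuousLinearMap.adjoint_comp, adjoint_toOp]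
    simp only [conj, ContinuousLinearMap.comp_apply, hρT]
  · have := hasSum_norm_inner_sq (basis H) (T.adjoint g)
    rw [hρT, ← ContinuousLinearMap.adjoint_inner_left, inner_self_eq_norm_sq_to_K]
    convert! this using 1
    · ext i
      rw [ContinuousLinearMap.adjoint_inner_right]
    · norm_cast

end Trace

/-! ### Covariance under local symplectic unitaries -/

theorem ext_tmul {A B : TwoMode →L[ℂ] TwoMode} (h : ∀ f g, A (tmul f g) = B (tmul f g)) :
    A = B := by
  have : A.toLinearMap ∘ₗ tensorEmb = B.toLinearMap ∘ₗ tensorEmb :=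
    TensorProduct.ext' fun f g => by simpa using h f g
  ext1 x
  exact congrFun (denseRange_tensorEmb.equalizer A.continuous B.continuous
    (funext fun u => LinearMap.congr_fun this u)) x

theorem tensorUnitary_trans (U V U' V' : Mode ≃ₗᵢ[ℂ] Mode) (x : TwoMode) :
    tensorUnitary U' V' (tensorUnitary U V x) = tensorUnitary (U.trans U') (V.trans V') x := by
  have : toOp (tensorUnitary U' V') ∘L toOp (tensorUnitary U V) =
      toOp (tensorUnitary (U.trans U') (V.trans V')) := by
    refine ext_tmul fun f g => ?_
    change tensorUnitary U' V' (tensorUnitary U V (tmul f g)) = tensorUnitary _ _ (tmul f g)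
    simp only [tensorUnitary_tmul, LinearIsometryEquiv.coe_trans, Function.comp_apply]
  exact DFunLike.congr_fun this x

theorem Implements.map_displacedParity {U : Mode ≃ₗᵢ[ℂ] Mode} {S : Matrix (Fin 2) (Fin 2) ℝ}
    (h : Implements U S) (hS : S.det = 1) (ξ : Fin 2 → ℝ) (f : Mode) :
    U (displacedParity ξ f) = displacedParity (S *ᵥ ξ) (U f) := by
  change U (displacement ξ (parity ((displacement ξ).symm f))) =
    displacement (S *ᵥ ξ) (parity ((displacement (S *ᵥ ξ)).symm (U f)))
  rw [h, h.map_parity hS, displacement_symm, displacement_symm, h, Matrix.mulVec_neg]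

theorem toOp_apply {H : Type} [NormedAddCommGroup H] [InnerProductSpace ℂ H] (U : H ≃ₗᵢ[ℂ] H)
    (x : H) : toOp U x = U x := rfl

theorem tensorUnitary_displacedParity {U V : Mode ≃ₗᵢ[ℂ] Mode} {S T : Matrix (Fin 2) (Fin 2) ℝ}
    (hU : Implements U S) (hV : Implements V T) (hS : S.det = 1) (hT : T.det = 1)
    (ξ η : Fin 2 → ℝ) (x : TwoMode) :
    tensorUnitary (displacedParity (S *ᵥ ξ)) (displacedParity (T *ᵥ η)) (tensorUnitary U V x) =
      tensorUnitary U V (tensorUnitary (displacedParity ξ) (displacedParity η) x) := by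
  rw [tensorUnitary_trans, tensorUnitary_trans]
  have h1 : U.trans (displacedParity (S *ᵥ ξ)) = (displacedParity ξ).trans U := by
    ext1 f
    exact (hU.map_displacedParity hS ξ f).symm
  have h2 : V.trans (displacedParity (T *ᵥ η)) = (displacedParity η).trans V := by
    ext1 f
    exact (hV.map_displacedParity hT η f).symm
  rw [h1, h2]

/-- `trace` refers to a fixed basis, which the unitary does not preserve. Expanding both traces over
the family `v` avoids a change of basis: the sums agree term by term. -/
theorem wigner_conj {ρ : TwoMode →L[ℂ] TwoMode} (hρ : IsDensityOperator ρ)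
    {U V : Mode ≃ₗᵢ[ℂ] Mode} {S T : Matrix (Fin 2) (Fin 2) ℝ} (hU : Implements U S)
    (hV : Implements V T) (hS : S.det = 1) (hT : T.det = 1) (ξ η : Fin 2 → ℝ) :
    wigner (conj (tensorUnitary U V) ρ) (S *ᵥ ξ) (T *ᵥ η) = wigner ρ ξ η := by
  obtain ⟨v, -, h, -⟩ := exists_family hρ
  have h1 := h (tensorUnitary U V)
    (toOp (tensorUnitary (displacedParity (S *ᵥ ξ)) (displacedParity (T *ᵥ η))))
  have h2 := h (LinearIsometryEquiv.refl ℂ _)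
    (toOp (tensorUnitary (displacedParity ξ) (displacedParity η)))
  have e : conj (LinearIsometryEquiv.refl ℂ TwoMode) ρ = ρ := rfl
  rw [e] at h2
  have hi : ∀ x, inner ℂ (tensorUnitary U V x) (toOp (tensorUnitary (displacedParity (S *ᵥ ξ))
      (displacedParity (T *ᵥ η))) (tensorUnitary U V x)) =
      inner ℂ x (toOp (tensorUnitary (displacedParity ξ) (displacedParity η)) x) := by
    intro x
    rw [toOp_apply, toOp_apply, tensorUnitary_displacedParity hU hV hS hT,
      LinearIsometryEquiv.inner_map_map]
  simp_rw [hi] at h1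
  have := h1.unique h2
  rw [wigner, wigner, this]

theorem inner_conj_apply (U : TwoMode ≃ₗᵢ[ℂ] TwoMode) (ρ : TwoMode →L[ℂ] TwoMode) (g : TwoMode) :
    inner ℂ (U g) (conj U ρ (U g)) = inner ℂ g (ρ g) := by
  change inner ℂ (U g) (U (ρ (U.symm (U g)))) = _
  rw [LinearIsometryEquiv.inner_map_map, LinearIsometryEquiv.symm_apply_apply]

/-- The Gaussian probe with respect to the symplectic frame `M`. -/
def frameProbe (M : Matrix (Fin 2) (Fin 2) ℝ) (σ x : ℝ) : Mode :=
  gaussianVector (M *ᵥ ![x, 0]) (M * Matrix.diagonal ![σ ^ 2, 1 / σ ^ 2] * Mᵀ)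

theorem isPureCov_diagonal {σ : ℝ} (hσ : 0 < σ) :
    IsPureCov (Matrix.diagonal ![σ ^ 2, 1 / σ ^ 2]) := by
  refine ⟨by simp; positivity, by simp, ?_⟩
  rw [Matrix.det_diagonal]
  simp
  field_simp

theorem Implements.map_frameProbe {U : Mode ≃ₗᵢ[ℂ] Mode} {S : Matrix (Fin 2) (Fin 2) ℝ}
    (h : Implements U S) (hS : S.det = 1) {M : Matrix (Fin 2) (Fin 2) ℝ} (hM : M.det = 1)
    {σ : ℝ} (hσ : 0 < σ) (x : ℝ) :
    ∃ c : ℂ, ‖c‖ = 1 ∧ U (frameProbe M σ x) = c • frameProbe (S * M) σ x := by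
  have := h.map_gaussianVector hS (M *ᵥ ![x, 0]) ((isPureCov_diagonal hσ).conj hM)
  rwa [Matrix.mulVec_mulVec, ← Matrix.mul_assoc, ← Matrix.mul_assoc, Matrix.mul_assoc _ Mᵀ,
    ← Matrix.transpose_mul] at this

/-- Joint probabilities with respect to symplectic frames. -/
def frameProb (ρ : TwoMode →L[ℂ] TwoMode) (M N : Matrix (Fin 2) (Fin 2) ℝ) (σ xA xB : ℝ) : ℝ :=
  (inner ℂ (tmul (frameProbe M σ xA) (frameProbe N σ xB))
    (ρ (tmul (frameProbe M σ xA) (frameProbe N σ xB)))).re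

theorem tmul_smul_smul (c c' : ℂ) (f g : Mode) : tmul (c • f) (c' • g) = (c * c') • tmul f g := by
  change tmulBilin (c • f) (c' • g) = (c * c') • tmulBilin f g
  rw [map_smul, map_smul, LinearMap.smul_apply, smul_smul, mul_comm]

theorem frameProb_conj (ρ : TwoMode →L[ℂ] TwoMode) {U V : Mode ≃ₗᵢ[ℂ] Mode}
    {S T : Matrix (Fin 2) (Fin 2) ℝ} (hU : Implements U S) (hV : Implements V T) (hS : S.det = 1)
    (hT : T.det = 1) {M N : Matrix (Fin 2) (Fin 2) ℝ} (hM : M.det = 1) (hN : N.det = 1) {σ : ℝ}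
    (hσ : 0 < σ) (xA xB : ℝ) :
    frameProb (conj (tensorUnitary U V) ρ) (S * M) (T * N) σ xA xB = frameProb ρ M N σ xA xB := by
  obtain ⟨c, hc, h1⟩ := hU.map_frameProbe hS hM hσ xA
  obtain ⟨c', hc', h2⟩ := hV.map_frameProbe hT hN hσ xB
  -- The phases of the two transformed probes occur once conjugated and once not, so they cancel.
  rw [frameProb, frameProb, ← inner_conj_apply (tensorUnitary U V) ρ, tensorUnitary_tmul, h1, h2,
    tmul_smul_smul, map_smul, inner_smul_left, inner_smul_right, ← mul_assoc, RCLike.conj_mul,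
    norm_mul, hc, hc']
  simp

/-! ### Gaussian means at Lebesgue points -/

section Lebesgue

variable {E : Type} [NormedAddCommGroup E] [InnerProductSpace ℂ E] [CompleteSpace E]

/-- Points at which the Gaussian means of the quadratic oscillation of `b` tend to zero. -/
def IsGaussPoint (b : ℝ × ℝ → E) (q : ℝ × ℝ) : Prop :=
  Tendsto (fun s : ℝ => (s ^ 2)⁻¹ * ∫ y, Real.exp (-(‖y‖ / s) ^ 2) * ‖b (q + y) - b q‖ ^ 2)
    (𝓝[>] 0) (𝓝 0)

theorem volume_real_closedBall (q : ℝ × ℝ) {r : ℝ} (hr : 0 ≤ r) :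
    (volume : Measure (ℝ × ℝ)).real (Metric.closedBall q r) = 4 * r ^ 2 := by
  rw [← closedBall_prod_same, Measure.volume_eq_prod, measureReal_prod_prod,
    Real.volume_real_closedBall hr, Real.volume_real_closedBall hr]
  ring

omit [InnerProductSpace ℂ E] [CompleteSpace E] in
theorem integrableOn_sq_sub {b : ℝ × ℝ → E} (hb : MemLp b 2) (q : ℝ × ℝ) (c : E) (r : ℝ) :
    IntegrableOn (fun y => ‖b y - c‖ ^ 2) (Metric.closedBall q r) := by
  have : IsFiniteMeasure ((volume : Measure (ℝ × ℝ)).restrict (Metric.closedBall q r)) :=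
    ⟨by rw [Measure.restrict_apply_univ]; exact measure_closedBall_lt_top⟩
  exact ((hb.restrict _).sub (memLp_const c)).integrable_norm_pow (by norm_num)

/-- Expanding the square leaves the ball means of `‖b‖²` and of `b`, which converge by Lebesgue
differentiation; their limits cancel. -/
theorem ae_tendsto_setIntegral_sq {b : ℝ × ℝ → E} (hb : MemLp b 2) :
    ∀ᵐ q, Tendsto (fun r : ℝ => (r ^ 2)⁻¹ * ∫ y in Metric.closedBall q r, ‖b y - b q‖ ^ 2)
      (𝓝[>] 0) (𝓝 0) := by
  have h1 : LocallyIntegrable (fun y => ‖b y‖ ^ 2) volume :=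
    (hb.integrable_norm_pow (by norm_num)).locallyIntegrable
  have h2 : LocallyIntegrable b volume := hb.locallyIntegrable (by norm_num)
  filter_upwards [IsUnifLocDoublingMeasure.ae_tendsto_average volume h1 0,
    IsUnifLocDoublingMeasure.ae_tendsto_average volume h2 0] with q k1 k2
  have hmem : ∀ᶠ r : ℝ in 𝓝[>] 0, q ∈ Metric.closedBall q (0 * r) := by simp
  have t1 := k1 (fun _ : ℝ => q) id tendsto_id hmem
  have t2 := k2 (fun _ : ℝ => q) id tendsto_id hmem
  -- The factor 4 appears because balls of the sup norm are squares of area `4 * r ^ 2`.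
  have t3 : Tendsto (fun r : ℝ => 4 * ((⨍ y in Metric.closedBall q r, ‖b y‖ ^ 2) -
      2 * (inner ℂ (b q) (⨍ y in Metric.closedBall q r, b y)).re + ‖b q‖ ^ 2)) (𝓝[>] 0)
      (𝓝 (4 * (‖b q‖ ^ 2 - 2 * (inner ℂ (b q) (b q)).re + ‖b q‖ ^ 2))) := by
    refine ((t1.sub (Tendsto.const_mul 2 ?_)).add tendsto_const_nhds).const_mul 4
    exact (Complex.continuous_re.tendsto _).comp (tendsto_const_nhds.inner t2)
  have e0 : (inner ℂ (b q) (b q)).re = ‖b q‖ ^ 2 := inner_self_eq_norm_sq (𝕜 := ℂ) (b q)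
  rw [e0, show 4 * (‖b q‖ ^ 2 - 2 * ‖b q‖ ^ 2 + ‖b q‖ ^ 2) = 0 by ring] at t3
  refine t3.congr' ?_
  filter_upwards [self_mem_nhdsWithin] with r hr
  have hr : 0 < r := hr
  have hv := volume_real_closedBall q hr.le
  have hfin : IsFiniteMeasure ((volume : Measure (ℝ × ℝ)).restrict (Metric.closedBall q r)) :=
    ⟨by rw [Measure.restrict_apply_univ]; exact measure_closedBall_lt_top⟩
  have i1 : IntegrableOn (fun y => ‖b y‖ ^ 2) (Metric.closedBall q r) :=
    (hb.integrable_norm_pow (by norm_num)).integrableOn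
  have i2 : IntegrableOn b (Metric.closedBall q r) := (hb.restrict _).integrable (by norm_num)
  have i3 : IntegrableOn (fun y => (inner ℂ (b q) (b y)).re) (Metric.closedBall q r) :=
    (i2.const_inner (𝕜 := ℂ) (b q)).re
  have e1 : ∀ y, ‖b y - b q‖ ^ 2 = ‖b y‖ ^ 2 - 2 * (inner ℂ (b q) (b y)).re + ‖b q‖ ^ 2 := by
    intro y
    rw [@norm_sub_sq ℂ, ← inner_conj_symm (b y), RCLike.conj_re]
    rfl
  simp_rw [e1]
  rw [integral_add (by exact i1.sub (i3.const_mul 2)) (integrable_const _),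
    integral_sub i1 (i3.const_mul 2), integral_const_mul, setIntegral_const, hv]
  have e2 : ∫ y in Metric.closedBall q r, (inner ℂ (b q) (b y)).re =
      (inner ℂ (b q) (∫ y in Metric.closedBall q r, b y)).re := by
    rw [← integral_inner i2]
    exact integral_re (i2.const_inner (𝕜 := ℂ) (b q))
  rw [e2, setAverage_eq, setAverage_eq, hv, ← Complex.coe_smul, inner_smul_right,
    Complex.re_ofReal_mul, smul_eq_mul, smul_eq_mul]
  field_simp

theorem summable_exp_neg_sq : Summable fun k : ℕ => Real.exp (-(k : ℝ) ^ 2) * ((k : ℝ) + 1) ^ 2 := by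
  have h0 := Real.summable_pow_mul_exp_neg_nat_mul 0 one_pos
  have h1 := Real.summable_pow_mul_exp_neg_nat_mul 1 one_pos
  have h2 := Real.summable_pow_mul_exp_neg_nat_mul 2 one_pos
  refine Summable.of_nonneg_of_le (fun k => by positivity) (fun k => ?_)
    ((h2.add (h1.mul_left 2)).add h0)
  have : Real.exp (-(k : ℝ) ^ 2) ≤ Real.exp (-1 * k) := by
    rw [Real.exp_le_exp]
    have : (k : ℝ) ≤ (k : ℝ) ^ 2 := by exact_mod_cast Nat.le_self_pow (by norm_num) k
    linarith
  calc _ ≤ Real.exp (-1 * k) * ((k : ℝ) + 1) ^ 2 := by gcongr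
    _ = _ := by ring

/-- With `k = ⌊‖y‖ / s⌋₊` the weight at `y` is at most `exp (-k²)` and `y` lies in the ball of
radius `(k + 1) * s`, so the `k`-th term alone dominates the integrand at `y`. -/
theorem integral_exp_mul_le_tsum {h : ℝ × ℝ → ℝ} (h0 : ∀ y, 0 ≤ h y)
    (hi : ∀ r, IntegrableOn h (Metric.closedBall 0 r)) {s : ℝ} (hs : 0 < s)
    (hsum : Summable fun k : ℕ => Real.exp (-(k : ℝ) ^ 2) *
      ∫ y in Metric.closedBall 0 (((k : ℝ) + 1) * s), h y) :
    ∫ y, Real.exp (-(‖y‖ / s) ^ 2) * h y ≤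
      ∑' k : ℕ, Real.exp (-(k : ℝ) ^ 2) * ∫ y in Metric.closedBall 0 (((k : ℝ) + 1) * s), h y := by
  have hterm : ∀ k : ℕ, 0 ≤ Real.exp (-(k : ℝ) ^ 2) *
      ∫ y in Metric.closedBall 0 (((k : ℝ) + 1) * s), h y := fun k =>
    mul_nonneg (Real.exp_pos _).le (integral_nonneg h0)
  have hm : AEStronglyMeasurable h volume := by
    have : LocallyIntegrable h volume := fun x => by
      refine ⟨Metric.closedBall 0 (‖x‖ + 1), ?_, hi _⟩
      exact Metric.closedBall_mem_nhds_of_mem (by simp)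
    exact this.aestronglyMeasurable
  rw [integral_eq_lintegral_of_nonneg_ae (ae_of_all _ fun y => mul_nonneg (Real.exp_pos _).le (h0 y))
    (AEStronglyMeasurable.mul (Measurable.aestronglyMeasurable (by fun_prop)) hm)]
  refine ENNReal.toReal_le_of_le_ofReal (tsum_nonneg hterm) ?_
  rw [ENNReal.ofReal_tsum_of_nonneg hterm hsum]
  have e : ∀ k : ℕ, ENNReal.ofReal (Real.exp (-(k : ℝ) ^ 2) *
      ∫ y in Metric.closedBall 0 (((k : ℝ) + 1) * s), h y) =
      ∫⁻ y, (Metric.closedBall (0 : ℝ × ℝ) (((k : ℝ) + 1) * s)).indicator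
        (fun y => ENNReal.ofReal (Real.exp (-(k : ℝ) ^ 2) * h y)) y := by
    intro k
    rw [lintegral_indicator measurableSet_closedBall, ← integral_const_mul,
      ofReal_integral_eq_lintegral_ofReal ((hi _).const_mul _)
        (ae_of_all _ fun y => mul_nonneg (Real.exp_pos _).le (h0 y))]
  simp_rw [e]
  rw [← lintegral_tsum fun k => AEMeasurable.indicator
    ((hm.aemeasurable.const_mul _).ennreal_ofReal) measurableSet_closedBall]
  refine lintegral_mono fun y => ?_
  refine le_trans ?_ (ENNReal.le_tsum ⌊‖y‖ / s⌋₊)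
  have hfl := Nat.floor_le (a := ‖y‖ / s) (by positivity)
  rw [Set.indicator_of_mem]
  · refine ENNReal.ofReal_le_ofReal ?_
    have := h0 y
    gcongr
  · rw [mem_closedBall_zero_iff]
    exact ((div_lt_iff₀ hs).1 (Nat.lt_floor_add_one _)).le

/-- The Gaussian mean is bounded by a series of ball means at the radii `(k + 1) * s` with rapidly
decaying weights. Each ball mean tends to zero, and a bound uniform in the radius permits dominated
convergence in `k`. -/
theorem ae_isGaussPoint {b : ℝ × ℝ → E} (hb : MemLp b 2) : ∀ᵐ q, IsGaussPoint b q := by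
  filter_upwards [ae_tendsto_setIntegral_sq hb] with q hq
  set I : ℝ → ℝ := fun r => ∫ y in Metric.closedBall q r, ‖b y - b q‖ ^ 2 with hI
  have hI0 : ∀ r, 0 ≤ I r := fun r => integral_nonneg fun _ => by positivity
  have hint : ∀ r, IntegrableOn (fun y => ‖b (q + y) - b q‖ ^ 2) (Metric.closedBall 0 r) := by
    intro r
    have := (measurePreserving_add_left volume q).integrableOn_comp_preimage
      (measurableEmbedding_addLeft q) (f := fun y => ‖b y - b q‖ ^ 2) (s := Metric.closedBall q r)
    have h2 := this.2 (integrableOn_sq_sub hb q (b q) r)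
    simpa [Function.comp_def] using h2
  have hIeq : ∀ r, ∫ y in Metric.closedBall 0 r, ‖b (q + y) - b q‖ ^ 2 = I r := by
    intro r
    have := (measurePreserving_add_left volume q).setIntegral_preimage_emb
      (measurableEmbedding_addLeft q) (fun y => ‖b y - b q‖ ^ 2) (Metric.closedBall q r)
    simpa using this
  -- Small radii are controlled by the Lebesgue property, which contributes the 1, and large radii
  -- by the `L²` norm of `b` together with the constant `‖b q‖²`.
  obtain ⟨C, hC⟩ : ∃ C, ∀ r > 0, (r ^ 2)⁻¹ * I r ≤ C := by
    have h1 : ∀ᶠ r in 𝓝[>] (0 : ℝ), (r ^ 2)⁻¹ * I r < 1 := hq.eventually (gt_mem_nhds one_pos)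
    obtain ⟨r₀, hr₀, h1⟩ := mem_nhdsGT_iff_exists_Ioo_subset.1 h1
    have hr₀ : 0 < r₀ := hr₀
    have hi2 : Integrable fun y => ‖b y‖ ^ 2 := hb.integrable_norm_pow (by norm_num)
    refine ⟨1 + 2 * (r₀ ^ 2)⁻¹ * (∫ y, ‖b y‖ ^ 2) + 8 * ‖b q‖ ^ 2, fun r hr => ?_⟩
    have hn : 0 ≤ ∫ y, ‖b y‖ ^ 2 := integral_nonneg fun _ => by positivity
    rcases lt_or_ge r r₀ with h | h
    · have h2 : (r ^ 2)⁻¹ * I r < 1 := h1 ⟨hr, h⟩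
      have h3 : 0 ≤ 2 * (r₀ ^ 2)⁻¹ * (∫ y, ‖b y‖ ^ 2) := by positivity
      nlinarith [sq_nonneg ‖b q‖]
    · have hfin : IsFiniteMeasure
          ((volume : Measure (ℝ × ℝ)).restrict (Metric.closedBall q r)) :=
        ⟨by rw [Measure.restrict_apply_univ]; exact measure_closedBall_lt_top⟩
      have h2 : I r ≤ ∫ y in Metric.closedBall q r, (2 * ‖b y‖ ^ 2 + 2 * ‖b q‖ ^ 2) := by
        refine integral_mono (integrableOn_sq_sub hb q (b q) r)
          ((hi2.integrableOn.const_mul 2).add (integrable_const _)) fun y => ?_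
        have := norm_sub_le (b y) (b q)
        nlinarith [sq_nonneg (‖b y‖ - ‖b q‖), norm_nonneg (b y - b q), norm_nonneg (b y),
          norm_nonneg (b q)]
      rw [integral_add (hi2.integrableOn.const_mul 2) (integrable_const _), integral_const_mul,
        setIntegral_const, volume_real_closedBall q hr.le, smul_eq_mul] at h2
      have h3 : ∫ y in Metric.closedBall q r, ‖b y‖ ^ 2 ≤ ∫ y, ‖b y‖ ^ 2 :=
        setIntegral_le_integral hi2 (ae_of_all _ fun _ => by positivity)
      have h4 : (r ^ 2)⁻¹ ≤ (r₀ ^ 2)⁻¹ := by gcongr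
      calc (r ^ 2)⁻¹ * I r ≤ (r ^ 2)⁻¹ * (2 * (∫ y, ‖b y‖ ^ 2) + 4 * r ^ 2 * (2 * ‖b q‖ ^ 2)) := by
            gcongr
            linarith
        _ = (r ^ 2)⁻¹ * (2 * (∫ y, ‖b y‖ ^ 2)) + 8 * ‖b q‖ ^ 2 := by field_simp; ring
        _ ≤ (r₀ ^ 2)⁻¹ * (2 * (∫ y, ‖b y‖ ^ 2)) + 8 * ‖b q‖ ^ 2 := by gcongr
        _ ≤ _ := by linarith
  have hlim : Tendsto (fun s : ℝ => ∑' k : ℕ, Real.exp (-(k : ℝ) ^ 2) * ((k : ℝ) + 1) ^ 2 *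
      (((((k : ℝ) + 1) * s) ^ 2)⁻¹ * I (((k : ℝ) + 1) * s))) (𝓝[>] 0)
      (𝓝 (∑' k : ℕ, Real.exp (-(k : ℝ) ^ 2) * ((k : ℝ) + 1) ^ 2 * 0)) := by
    refine tendsto_tsum_of_dominated_convergence
      (bound := fun k : ℕ => Real.exp (-(k : ℝ) ^ 2) * ((k : ℝ) + 1) ^ 2 * C)
      (summable_exp_neg_sq.mul_right C) (fun k => ?_) ?_
    · refine Tendsto.const_mul _ (hq.comp ?_)
      refine tendsto_nhdsWithin_iff.2 ⟨?_, ?_⟩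
      · have : Tendsto (fun s : ℝ => ((k : ℝ) + 1) * s) (𝓝 0) (𝓝 (((k : ℝ) + 1) * 0)) :=
          Continuous.tendsto (by fun_prop) 0
        rw [mul_zero] at this
        exact this.mono_left nhdsWithin_le_nhds
      · filter_upwards [self_mem_nhdsWithin] with s hs
        have : (0 : ℝ) < s := hs
        exact Set.mem_Ioi.2 (by positivity)
    · filter_upwards [self_mem_nhdsWithin] with s hs k
      have hs : (0 : ℝ) < s := hs
      have h5 := hI0 (((k : ℝ) + 1) * s)
      rw [Real.norm_of_nonneg (by positivity)]
      gcongr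
      exact hC _ (by positivity)
  simp only [mul_zero, tsum_zero] at hlim
  refine squeeze_zero' ?_ ?_ hlim
  · filter_upwards [self_mem_nhdsWithin] with s hs
    exact mul_nonneg (by positivity) (integral_nonneg fun y => by positivity)
  · filter_upwards [self_mem_nhdsWithin] with s hs
    have hs : (0 : ℝ) < s := hs
    have e : ∀ k : ℕ, Real.exp (-(k : ℝ) ^ 2) * ((k : ℝ) + 1) ^ 2 *
        (((((k : ℝ) + 1) * s) ^ 2)⁻¹ * I (((k : ℝ) + 1) * s)) =
        (s ^ 2)⁻¹ * (Real.exp (-(k : ℝ) ^ 2) * I (((k : ℝ) + 1) * s)) := by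
      intro k
      field_simp
    have hsum : Summable fun k : ℕ => Real.exp (-(k : ℝ) ^ 2) * I (((k : ℝ) + 1) * s) := by
      have : Summable fun k : ℕ => Real.exp (-(k : ℝ) ^ 2) * ((k : ℝ) + 1) ^ 2 *
          (((((k : ℝ) + 1) * s) ^ 2)⁻¹ * I (((k : ℝ) + 1) * s)) := by
        refine Summable.of_nonneg_of_le (fun k => ?_) (fun k => ?_) (summable_exp_neg_sq.mul_right C)
        · have h5 := hI0 (((k : ℝ) + 1) * s)
          positivity
        · gcongr
          exact hC _ (by positivity)
      simp_rw [e] at this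
      exact (summable_mul_left_iff (by positivity)).1 this
    simp_rw [e]
    rw [tsum_mul_left]
    gcongr
    simp_rw [← hIeq] at hsum ⊢
    exact integral_exp_mul_le_tsum (fun y => by positivity) hint hs hsum

end Lebesgue

/-! ### Gaussian means with anisotropic weights -/

section Kernel

/-- An anisotropic Gaussian weight of width `s` on the plane. -/
def gaussWeight (α β s : ℝ) (y : ℝ × ℝ) : ℝ := Real.exp (-(α * y.1 ^ 2 + β * y.2 ^ 2) / s ^ 2)

theorem gaussWeight_pos (α β s : ℝ) (y : ℝ × ℝ) : 0 < gaussWeight α β s y := Real.exp_pos _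

theorem measurable_gaussWeight (α β s : ℝ) : Measurable (gaussWeight α β s) := by
  unfold gaussWeight; fun_prop

theorem gaussWeight_le_one {α β : ℝ} (hα : 0 < α) (hβ : 0 < β) (s : ℝ) (y : ℝ × ℝ) :
    gaussWeight α β s y ≤ 1 := by
  rw [gaussWeight, Real.exp_le_one_iff, neg_div]
  have : 0 ≤ (α * y.1 ^ 2 + β * y.2 ^ 2) / s ^ 2 := by positivity
  linarith

theorem gaussWeight_eq_mul (α β s : ℝ) (y : ℝ × ℝ) : gaussWeight α β s y =
    Real.exp (-(α / s ^ 2) * y.1 ^ 2) * Real.exp (-(β / s ^ 2) * y.2 ^ 2) := by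
  rw [gaussWeight, ← Real.exp_add]
  congr 1
  ring

theorem integrable_gaussWeight {α β s : ℝ} (hα : 0 < α) (hβ : 0 < β) (hs : 0 < s) :
    Integrable (gaussWeight α β s) := by
  have := (integrable_exp_neg_mul_sq (b := α / s ^ 2) (by positivity)).mul_prod
    (integrable_exp_neg_mul_sq (b := β / s ^ 2) (by positivity))
  exact this.congr (ae_of_all _ fun y => (gaussWeight_eq_mul α β s y).symm)

theorem integral_gaussWeight {α β s : ℝ} (hs : 0 < s) :
    (s ^ 2)⁻¹ * ∫ y, gaussWeight α β s y = √(Real.pi / α) * √(Real.pi / β) := by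
  simp_rw [gaussWeight_eq_mul]
  rw [Measure.volume_eq_prod, integral_prod_mul (fun x : ℝ => Real.exp (-(α / s ^ 2) * x ^ 2))
    (fun x : ℝ => Real.exp (-(β / s ^ 2) * x ^ 2)), integral_gaussian, integral_gaussian]
  have h : ∀ a : ℝ, √(Real.pi / (a / s ^ 2)) = s * √(Real.pi / a) := by
    intro a
    rw [div_div_eq_mul_div, mul_comm, mul_div_assoc, Real.sqrt_mul (by positivity),
      Real.sqrt_sq hs.le]
  rw [h, h]
  field_simp

variable {E : Type} [NormedAddCommGroup E]

theorem integrable_gaussWeight_mul_sq {b : ℝ × ℝ → E} (hb : MemLp b 2) (q : ℝ × ℝ) (c : E)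
    {α β s : ℝ} (hα : 0 < α) (hβ : 0 < β) (hs : 0 < s) :
    Integrable fun y => gaussWeight α β s y * ‖b (q + y) - c‖ ^ 2 := by
  have hbq : MemLp (fun y => b (q + y)) 2 :=
    hb.comp_measurePreserving (measurePreserving_add_left volume q)
  have h1 : Integrable fun y => 2 * ‖b (q + y)‖ ^ 2 + 2 * ‖c‖ ^ 2 * gaussWeight α β s y :=
    ((hbq.integrable_norm_pow (by norm_num)).const_mul 2).add
      ((integrable_gaussWeight hα hβ hs).const_mul _)
  refine h1.mono' ?_ (ae_of_all _ fun y => ?_)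
  · exact (measurable_gaussWeight α β s).aestronglyMeasurable.mul
      ((hbq.1.sub aestronglyMeasurable_const).norm.pow 2)
  · have k0 := (gaussWeight_pos α β s y).le
    have k1 := gaussWeight_le_one hα hβ s y
    rw [Real.norm_of_nonneg (by positivity)]
    have : ‖b (q + y) - c‖ ^ 2 ≤ 2 * ‖b (q + y)‖ ^ 2 + 2 * ‖c‖ ^ 2 := by
      have := norm_sub_le (b (q + y)) c
      nlinarith [sq_nonneg (‖b (q + y)‖ - ‖c‖), norm_nonneg (b (q + y) - c),
        norm_nonneg (b (q + y)), norm_nonneg c]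
    calc _ ≤ gaussWeight α β s y * (2 * ‖b (q + y)‖ ^ 2 + 2 * ‖c‖ ^ 2) := by gcongr
      _ = gaussWeight α β s y * (2 * ‖b (q + y)‖ ^ 2) + 2 * ‖c‖ ^ 2 * gaussWeight α β s y := by
        ring
      _ ≤ 1 * (2 * ‖b (q + y)‖ ^ 2) + 2 * ‖c‖ ^ 2 * gaussWeight α β s y := by gcongr
      _ = _ := by ring

variable [InnerProductSpace ℂ E]

omit [InnerProductSpace ℂ E] in
theorem IsGaussPoint.tendsto_gaussWeight {b : ℝ × ℝ → E} (hb : MemLp b 2) {q : ℝ × ℝ}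
    (hq : IsGaussPoint b q) {α β : ℝ} (hα : 0 < α) (hβ : 0 < β) :
    Tendsto (fun s : ℝ => (s ^ 2)⁻¹ * ∫ y, gaussWeight α β s y * ‖b (q + y) - b q‖ ^ 2)
      (𝓝[>] 0) (𝓝 0) := by
  set m := √(min α β) with hm
  have hm0 : 0 < m := Real.sqrt_pos.2 (lt_min hα hβ)
  have hm2 : m ^ 2 = min α β := Real.sq_sqrt (lt_min hα hβ).le
  have ht : Tendsto (fun s : ℝ => s / m) (𝓝[>] 0) (𝓝[>] 0) := by
    refine tendsto_nhdsWithin_iff.2 ⟨?_, ?_⟩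
    · have : Tendsto (fun s : ℝ => s / m) (𝓝 0) (𝓝 (0 / m)) := Continuous.tendsto (by fun_prop) 0
      rw [zero_div] at this
      exact this.mono_left nhdsWithin_le_nhds
    · filter_upwards [self_mem_nhdsWithin] with s hs
      exact Set.mem_Ioi.2 (div_pos hs hm0)
  have h1 := (hq.comp ht).const_mul (m ^ 2)⁻¹
  rw [mul_zero] at h1
  refine squeeze_zero' ?_ ?_ h1
  · filter_upwards [self_mem_nhdsWithin] with s hs
    exact mul_nonneg (by positivity) (integral_nonneg fun y =>
      mul_nonneg (gaussWeight_pos _ _ _ _).le (by positivity))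
  · filter_upwards [self_mem_nhdsWithin] with s hs
    have hs : 0 < s := hs
    have e : (m ^ 2)⁻¹ * (((s / m) ^ 2)⁻¹) = (s ^ 2)⁻¹ := by field_simp
    simp only [Function.comp_apply]
    rw [← mul_assoc, e]
    gcongr ?_ * ?_
    -- The smaller of `α` and `β`, times the squared sup norm, bounds the quadratic form from below;
    -- hence the isotropic width `s / m`.
    have hle : ∀ y : ℝ × ℝ, gaussWeight α β s y ≤ Real.exp (-(‖y‖ / (s / m)) ^ 2) := by
      intro y
      rw [gaussWeight, Real.exp_le_exp, div_div_eq_mul_div, div_pow, ← neg_div]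
      gcongr
      rw [mul_pow, hm2, Prod.norm_def]
      have a1 := min_le_left α β
      have a2 := min_le_right α β
      have a0 := (lt_min hα hβ).le
      rcases max_cases ‖y.1‖ ‖y.2‖ with ⟨h, -⟩ | ⟨h, -⟩ <;> rw [h, Real.norm_eq_abs, sq_abs] <;>
        nlinarith [sq_nonneg y.1, sq_nonneg y.2]
    have hint : Integrable fun y => Real.exp (-(‖y‖ / (s / m)) ^ 2) * ‖b (q + y) - b q‖ ^ 2 := by
      have hbq : MemLp (fun y => b (q + y)) 2 :=
        hb.comp_measurePreserving (measurePreserving_add_left volume q)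
      -- The halves come from `(y.1 ^ 2 + y.2 ^ 2) / 2 ≤ ‖y‖ ^ 2` in the sup norm.
      refine (integrable_gaussWeight_mul_sq hb q (b q) (α := m ^ 2 / 2) (β := m ^ 2 / 2) (by positivity)
        (by positivity) hs).mono' ?_ (ae_of_all _ fun y => ?_)
      · exact Measurable.aestronglyMeasurable (by fun_prop) |>.mul
          ((hbq.1.sub aestronglyMeasurable_const).norm.pow 2)
      · rw [Real.norm_of_nonneg (by positivity)]
        gcongr
        rw [gaussWeight, Real.exp_le_exp, div_div_eq_mul_div, div_pow, ← neg_div]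
        gcongr
        rw [mul_pow, Prod.norm_def]
        have a3 : y.1 ^ 2 ≤ (max ‖y.1‖ ‖y.2‖) ^ 2 := by
          rw [← sq_abs, ← Real.norm_eq_abs]; gcongr; exact le_max_left _ _
        have a4 : y.2 ^ 2 ≤ (max ‖y.1‖ ‖y.2‖) ^ 2 := by
          rw [← sq_abs, ← Real.norm_eq_abs]; gcongr; exact le_max_right _ _
        nlinarith [sq_nonneg m]
    refine integral_mono (integrable_gaussWeight_mul_sq hb q (b q) hα hβ hs) hint fun y => ?_
    have := hle y
    simp only
    gcongr

omit [InnerProductSpace ℂ E] in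
/-- Convergence of Gaussian means of functions controlled by the quadratic oscillation. -/
theorem IsGaussPoint.tendsto_integral_smul {F : Type} [NormedAddCommGroup F] [NormedSpace ℝ F]
    [CompleteSpace F]
    {b : ℝ × ℝ → E} (hb : MemLp b 2) {q : ℝ × ℝ} (hq : IsGaussPoint b q) {Φ : ℝ × ℝ → F}
    (hΦ : AEStronglyMeasurable Φ volume) (c : F) {B : ℝ} (hB : 0 ≤ B)
    (hbound : ∀ y, ∀ δ > 0, ‖Φ y - c‖ ≤
      B * δ + (B + B / δ) * (‖b (q + y) - b q‖ ^ 2 + ‖b (q - y) - b q‖ ^ 2))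
    {α β : ℝ} (hα : 0 < α) (hβ : 0 < β) :
    Tendsto (fun s : ℝ => (s ^ 2)⁻¹ • ∫ y, gaussWeight α β s y • Φ y) (𝓝[>] 0)
      (𝓝 ((√(Real.pi / α) * √(Real.pi / β)) • c)) := by
  set κ := √(Real.pi / α) * √(Real.pi / β) with hκ
  have hκ0 : 0 < κ := by positivity
  set J : ℝ → ℝ := fun s => (s ^ 2)⁻¹ * ∫ y, gaussWeight α β s y * ‖b (q + y) - b q‖ ^ 2 with hJ
  have hJt : Tendsto J (𝓝[>] 0) (𝓝 0) := hq.tendsto_gaussWeight hb hα hβ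
  -- The first error term is made small by the choice of `δ`, the second by letting `s → 0` with `δ`
  -- fixed. Reflection in `y` identifies the contributions of `q + y` and `q - y`, hence the factor
  -- 2.
  have main : ∀ s > 0, ∀ δ > 0, ‖(s ^ 2)⁻¹ • (∫ y, gaussWeight α β s y • Φ y) - κ • c‖ ≤
      B * δ * κ + (B + B / δ) * (2 * J s) := by
    intro s hs δ hδ
    have i1 := integrable_gaussWeight_mul_sq hb q (b q) hα hβ hs
    have hsymm : ∀ y, gaussWeight α β s (-y) = gaussWeight α β s y := by
      intro y; simp [gaussWeight]
    have i2 : Integrable fun y => gaussWeight α β s y * ‖b (q - y) - b q‖ ^ 2 := by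
      have := i1.comp_neg
      simpa only [hsymm, ← sub_eq_add_neg] using this
    have e2 : ∫ y, gaussWeight α β s y * ‖b (q - y) - b q‖ ^ 2 =
        ∫ y, gaussWeight α β s y * ‖b (q + y) - b q‖ ^ 2 := by
      rw [← integral_neg_eq_self (fun y => gaussWeight α β s y * ‖b (q + y) - b q‖ ^ 2)]
      simp only [hsymm, ← sub_eq_add_neg]
    have i3 := integrable_gaussWeight hα hβ hs
    have i4 : Integrable fun y => B * δ * gaussWeight α β s y + (B + B / δ) *
        (gaussWeight α β s y * ‖b (q + y) - b q‖ ^ 2 +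
          gaussWeight α β s y * ‖b (q - y) - b q‖ ^ 2) :=
      (i3.const_mul _).add ((i1.add i2).const_mul _)
    have hle : ∀ y, ‖gaussWeight α β s y • (Φ y - c)‖ ≤ B * δ * gaussWeight α β s y + (B + B / δ) *
        (gaussWeight α β s y * ‖b (q + y) - b q‖ ^ 2 +
          gaussWeight α β s y * ‖b (q - y) - b q‖ ^ 2) := by
      intro y
      have k0 := (gaussWeight_pos α β s y).le
      rw [norm_smul, Real.norm_of_nonneg k0]
      calc _ ≤ gaussWeight α β s y * (B * δ + (B + B / δ) *
            (‖b (q + y) - b q‖ ^ 2 + ‖b (q - y) - b q‖ ^ 2)) := by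
              gcongr; exact hbound y δ hδ
        _ = _ := by ring
    have i5 : Integrable fun y => gaussWeight α β s y • (Φ y - c) :=
      i4.mono' ((measurable_gaussWeight α β s).aestronglyMeasurable.smul
        (hΦ.sub aestronglyMeasurable_const)) (ae_of_all _ hle)
    have i6 : Integrable fun y => gaussWeight α β s y • c := i3.smul_const c
    have e3 : ∫ y, gaussWeight α β s y • Φ y =
        (∫ y, gaussWeight α β s y • (Φ y - c)) + (∫ y, gaussWeight α β s y) • c := by
      rw [← integral_smul_const, ← integral_add i5 i6]
      congr 1
      ext y
      rw [smul_sub, sub_add_cancel]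
    rw [e3, smul_add, smul_smul, integral_gaussWeight hs, add_sub_cancel_right, norm_smul,
      Real.norm_of_nonneg (by positivity)]
    calc _ ≤ (s ^ 2)⁻¹ * ∫ y, (B * δ * gaussWeight α β s y + (B + B / δ) *
        (gaussWeight α β s y * ‖b (q + y) - b q‖ ^ 2 +
          gaussWeight α β s y * ‖b (q - y) - b q‖ ^ 2)) := by
          gcongr
          exact norm_integral_le_of_norm_le i4 (ae_of_all _ hle)
      _ = B * δ * ((s ^ 2)⁻¹ * ∫ y, gaussWeight α β s y) + (B + B / δ) * (2 * J s) := by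
          have e4 := integral_add (i3.const_mul (B * δ)) ((i1.add i2).const_mul (B + B / δ))
          simp only [Pi.add_apply] at e4
          rw [e4, integral_const_mul, integral_const_mul, integral_add i1 i2, e2]
          ring
      _ = _ := by rw [integral_gaussWeight hs]
  rw [tendsto_iff_norm_sub_tendsto_zero, Metric.tendsto_nhds]
  intro ε hε
  obtain ⟨δ, hδ, hδε⟩ : ∃ δ > 0, B * δ * κ < ε / 2 := by
    refine ⟨ε / (4 * (B * κ + 1)), by positivity, ?_⟩
    have : B * (ε / (4 * (B * κ + 1))) * κ = (B * κ) / (B * κ + 1) * (ε / 4) := by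
      field_simp
    rw [this]
    have h1 : (B * κ) / (B * κ + 1) ≤ 1 := by
      rw [div_le_one (by positivity)]; linarith
    nlinarith
  have hev : ∀ᶠ s in 𝓝[>] (0 : ℝ), (B + B / δ) * (2 * J s) < ε / 2 := by
    have : Tendsto (fun s => (B + B / δ) * (2 * J s)) (𝓝[>] 0) (𝓝 ((B + B / δ) * (2 * 0))) :=
      (hJt.const_mul 2).const_mul _
    rw [mul_zero, mul_zero] at this
    exact this.eventually (gt_mem_nhds (by positivity))
  filter_upwards [hev, self_mem_nhdsWithin] with s h1 hs
  rw [Real.dist_0_eq_abs, abs_of_nonneg (norm_nonneg _)]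
  linarith [main s hs δ hδ]

/-- `IsGaussPoint` controls only quadratic oscillations; this trades a linear one for a small
constant plus a quadratic one. -/
theorem le_add_sq_div (t : ℝ) {δ : ℝ} (hδ : 0 < δ) : t ≤ δ + t ^ 2 / δ := by
  rw [← sub_nonneg]
  have : δ + t ^ 2 / δ - t = ((t - δ / 2) ^ 2 + 3 / 4 * δ ^ 2) / δ := by field_simp; ring
  rw [this]
  positivity

theorem IsGaussPoint.tendsto_mean [CompleteSpace E] {b : ℝ × ℝ → E} (hb : MemLp b 2) {q : ℝ × ℝ}
    (hq : IsGaussPoint b q) {α β : ℝ} (hα : 0 < α) (hβ : 0 < β) :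
    Tendsto (fun s : ℝ => (s ^ 2)⁻¹ • ∫ y, gaussWeight α β s y • b (q + y)) (𝓝[>] 0)
      (𝓝 ((√(Real.pi / α) * √(Real.pi / β)) • b q)) := by
  have hbq : MemLp (fun y => b (q + y)) 2 :=
    hb.comp_measurePreserving (measurePreserving_add_left volume q)
  refine hq.tendsto_integral_smul hb hbq.1 (b q) zero_le_one (fun y δ hδ => ?_) hα hβ
  have h1 := le_add_sq_div ‖b (q + y) - b q‖ hδ
  have h2 : 0 ≤ ‖b (q + y) - b q‖ ^ 2 + (1 + 1 / δ) * ‖b (q - y) - b q‖ ^ 2 := by positivity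
  calc _ ≤ _ := h1
    _ ≤ _ := by rw [div_eq_mul_one_div]; linarith

theorem IsGaussPoint.tendsto_autocorrelation {b : ℝ × ℝ → E} (hb : MemLp b 2) {q : ℝ × ℝ}
    (hq : IsGaussPoint b q) {α β : ℝ} (hα : 0 < α) (hβ : 0 < β) :
    Tendsto (fun s : ℝ => (s ^ 2)⁻¹ • ∫ y, gaussWeight α β s y • inner ℂ (b (q + y)) (b (q - y)))
      (𝓝[>] 0) (𝓝 ((√(Real.pi / α) * √(Real.pi / β)) • inner ℂ (b q) (b q))) := by
  have h1 : MemLp (fun y => b (q + y)) 2 :=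
    hb.comp_measurePreserving (measurePreserving_add_left volume q)
  have h2 : MemLp (fun y => b (q - y)) 2 :=
    hb.comp_measurePreserving (Measure.measurePreserving_sub_left volume q)
  refine hq.tendsto_integral_smul hb (h1.1.inner h2.1) _ (B := 1 + 2 * ‖b q‖) (by positivity)
    (fun y δ hδ => ?_) hα hβ
  set u := b (q + y) - b q with hu
  set w := b (q - y) - b q with hw
  -- Expansion about `b q`: one term is quadratic in the oscillations `u`, `w`, and two are linear
  -- with coefficient `‖b q‖`, which explains the choice of `B`.
  have e : inner ℂ (b (q + y)) (b (q - y)) - inner ℂ (b q) (b q) =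
      inner ℂ u w + inner ℂ u (b q) + inner ℂ (b q) w := by
    rw [← sub_add_cancel (b (q + y)) (b q), ← sub_add_cancel (b (q - y)) (b q), ← hu, ← hw]
    simp only [inner_add_left, inner_add_right]
    ring
  rw [e]
  have k1 : ‖inner ℂ u w + inner ℂ u (b q) + inner ℂ (b q) w‖ ≤
      ‖u‖ * ‖w‖ + ‖u‖ * ‖b q‖ + ‖b q‖ * ‖w‖ :=
    (norm_add₃_le).trans (add_le_add_three (norm_inner_le_norm _ _) (norm_inner_le_norm _ _)
      (norm_inner_le_norm _ _))
  have k2 := le_add_sq_div ‖u‖ hδ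
  have k3 := le_add_sq_div ‖w‖ hδ
  have k4 : ‖u‖ * ‖w‖ ≤ ‖u‖ ^ 2 + ‖w‖ ^ 2 := by
    nlinarith [sq_nonneg (‖u‖ - ‖w‖), sq_nonneg ‖u‖, sq_nonneg ‖w‖]
  have k5 : ‖b q‖ * (‖u‖ + ‖w‖) ≤ ‖b q‖ * (2 * δ + (‖u‖ ^ 2 + ‖w‖ ^ 2) / δ) := by
    refine mul_le_mul_of_nonneg_left ?_ (norm_nonneg _)
    rw [add_div]
    linarith
  have k6 : 0 ≤ δ + (2 * ‖b q‖ + 1 / δ + ‖b q‖ / δ) * (‖u‖ ^ 2 + ‖w‖ ^ 2) := by positivity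
  calc _ ≤ _ := k1
    _ ≤ (‖u‖ ^ 2 + ‖w‖ ^ 2) + ‖b q‖ * (2 * δ + (‖u‖ ^ 2 + ‖w‖ ^ 2) / δ) := by linarith
    _ ≤ (‖u‖ ^ 2 + ‖w‖ ^ 2) + ‖b q‖ * (2 * δ + (‖u‖ ^ 2 + ‖w‖ ^ 2) / δ) +
        (δ + (2 * ‖b q‖ + 1 / δ + ‖b q‖ / δ) * (‖u‖ ^ 2 + ‖w‖ ^ 2)) := by linarith
    _ = _ := by field_simp; ring

end Kernel

/-! ### Amplitudes of a density operator -/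

section Amplitude

open scoped ComplexConjugate

/-- Square summable families of complex numbers. -/
abbrev SqSum (ι : Type) : Type := lp (fun _ : ι => ℂ) 2

variable {ι : Type}

open Classical in
/-- The family of the values of square integrable functions at a point, as a vector. -/
def amplitude (v : ι → TwoMode) (z : ℝ × ℝ) : SqSum ι :=
  if h : Memℓp (fun i => v i z) 2 then ⟨fun i => v i z, h⟩ else 0

theorem memℓp_two_iff {f : ι → ℂ} : Memℓp f 2 ↔ Summable fun i => ‖f i‖ ^ 2 := by
  rw [memℓp_gen_iff (by norm_num)]
  simp

theorem hasSum_norm_sq (f : SqSum ι) : HasSum (fun i => ‖f i‖ ^ 2) (‖f‖ ^ 2) := by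
  have := lp.hasSum_norm (p := 2) (by norm_num) f
  simpa using this

theorem integral_norm_sq {α : Type} [MeasurableSpace α] {μ : Measure α} (f : Lp ℂ 2 μ) :
    ∫ x, ‖f x‖ ^ 2 ∂μ = ‖f‖ ^ 2 := by
  rw [← @inner_self_eq_norm_sq ℂ, L2.inner_def, ← integral_re (L2.integrable_inner f f)]
  congr 1
  ext x
  rw [← @inner_self_eq_norm_sq ℂ]

variable [Countable ι] {v : ι → TwoMode}

theorem lintegral_tsum_norm_sq (hv : Summable fun i => ‖v i‖ ^ 2) :
    ∫⁻ z, ∑' i, ENNReal.ofReal (‖v i z‖ ^ 2) = ENNReal.ofReal (∑' i, ‖v i‖ ^ 2) := by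
  rw [lintegral_tsum fun i => ((Lp.stronglyMeasurable (v i)).norm.measurable.pow_const 2
    ).ennreal_ofReal.aemeasurable, ENNReal.ofReal_tsum_of_nonneg (fun i => by positivity) hv]
  congr 1
  ext i
  rw [← ofReal_integral_eq_lintegral_ofReal ((Lp.memLp (v i)).integrable_norm_pow (by norm_num))
    (ae_of_all _ fun _ => by positivity), integral_norm_sq]

theorem ae_memℓp (hv : Summable fun i => ‖v i‖ ^ 2) : ∀ᵐ z, Memℓp (fun i => v i z) 2 := by
  have hlt : ∀ᵐ z, ∑' i, ENNReal.ofReal (‖v i z‖ ^ 2) < ⊤ := by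
    refine ae_lt_top' (AEMeasurable.tsum fun i =>
      ((Lp.stronglyMeasurable (v i)).norm.measurable.pow_const 2).ennreal_ofReal.aemeasurable) ?_
    rw [lintegral_tsum_norm_sq hv]
    exact ENNReal.ofReal_ne_top
  filter_upwards [hlt] with z hz
  rw [memℓp_two_iff]
  have := ENNReal.summable_toReal hz.ne
  simpa using this

theorem ae_amplitude_apply (hv : Summable fun i => ‖v i‖ ^ 2) :
    ∀ᵐ z, ∀ i, amplitude v z i = v i z := by
  filter_upwards [ae_memℓp hv] with z hz i
  rw [amplitude, dif_pos hz]

/-- The amplitude is almost everywhere the limit of its finite partial sums; countability of `ι`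
makes `atTop` on finite sets countably generated. -/
theorem aestronglyMeasurable_amplitude (hv : Summable fun i => ‖v i‖ ^ 2) :
    AEStronglyMeasurable (amplitude v) volume := by
  classical
  refine aestronglyMeasurable_of_tendsto_ae (u := (atTop : Filter (Finset ι)))
    (f := fun s z => ∑ i ∈ s, lp.single (E := fun _ : ι => ℂ) 2 i (v i z)) (fun s => ?_) ?_
  · refine Finset.aestronglyMeasurable_fun_sum s fun i _ => ?_
    exact (lp.isometry_single (E := fun _ : ι => ℂ) (p := 2) i).continuous.comp_aestronglyMeasurable
      (Lp.aestronglyMeasurable (v i))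
  · filter_upwards [ae_amplitude_apply hv] with z hz
    have := lp.hasSum_single (p := 2) (by norm_num) (amplitude v z)
    simp_rw [hz] at this
    exact this

theorem memLp_amplitude (hv : Summable fun i => ‖v i‖ ^ 2) : MemLp (amplitude v) 2 := by
  have hm := aestronglyMeasurable_amplitude hv
  rw [memLp_two_iff_integrable_sq_norm hm]
  refine ⟨(hm.norm.pow 2), ?_⟩
  rw [hasFiniteIntegral_iff_ofReal (ae_of_all _ fun _ => by positivity)]
  have : ∀ᵐ z, ENNReal.ofReal (‖amplitude v z‖ ^ 2) = ∑' i, ENNReal.ofReal (‖v i z‖ ^ 2) := by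
    filter_upwards [ae_amplitude_apply hv] with z hz
    have h := hasSum_norm_sq (amplitude v z)
    simp_rw [hz] at h
    rw [← h.tsum_eq, ENNReal.ofReal_tsum_of_nonneg (fun i => by positivity) h.summable]
  rw [lintegral_congr_ae this, lintegral_tsum_norm_sq hv]
  exact ENNReal.ofReal_lt_top

/-- Evaluation at a coordinate commutes with the Bochner integral, so the inner products are, up to
conjugation, the coordinates of one vector in `ℓ²`. -/
theorem hasSum_inner_amplitude (hv : Summable fun i => ‖v i‖ ^ 2) (g : TwoMode) :
    HasSum (fun i => ‖inner ℂ (v i) g‖ ^ 2) (‖∫ z, conj (g z) • amplitude v z‖ ^ 2) := by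
  have hb := memLp_amplitude hv
  have hg : MemLp (fun z => conj (g z)) 2 volume := (Lp.memLp g).star
  have hi : Integrable fun z => conj (g z) • amplitude v z := by
    rw [← memLp_one_iff_integrable]
    exact hb.smul hg
  have := hasSum_norm_sq (∫ z, conj (g z) • amplitude v z)
  convert! this using 2 with i
  rw [norm_inner_symm]
  congr 2
  have e := (lp.evalCLM ℂ (fun _ : ι => ℂ) 2 i).integral_comp_comm hi
  rw [L2.inner_def]
  refine Eq.trans ?_ e
  apply integral_congr_ae
  filter_upwards [ae_amplitude_apply hv] with z hz
  rw [map_smul]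
  change inner ℂ (g z) (v i z) = conj (g z) • amplitude v z i
  rw [hz, RCLike.inner_apply, smul_eq_mul, mul_comm]

end Amplitude

/-! ### The Wigner function as the transform of an autocorrelation -/

theorem memLp_phase_mul {g : ℝ × ℝ → ℝ} (hg : Measurable g) (f : TwoMode) :
    MemLp (fun z => Complex.exp (Complex.I * g z) * f z) 2 (volume : Measure (ℝ × ℝ)) := by
  have hf := Lp.memLp f
  refine hf.of_le ?_ (ae_of_all _ fun z => ?_)
  · exact (by fun_prop : Measurable fun z => Complex.exp (Complex.I * g z)).aestronglyMeasurable.mul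
      hf.1
  · rw [norm_mul, norm_exp_I_mul, one_mul]

/-- Multiplication by a phase on the plane. -/
def planePhase {g : ℝ × ℝ → ℝ} (hg : Measurable g) : TwoMode →ₗᵢ[ℂ] TwoMode where
  toFun f := (memLp_phase_mul hg f).toLp _
  map_add' f f' := by
    apply Lp.ext
    filter_upwards [(memLp_phase_mul hg (f + f')).coeFn_toLp, (memLp_phase_mul hg f).coeFn_toLp,
      (memLp_phase_mul hg f').coeFn_toLp, Lp.coeFn_add f f',
      Lp.coeFn_add ((memLp_phase_mul hg f).toLp _) ((memLp_phase_mul hg f').toLp _)]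
      with x h1 h2 h3 h4 h5
    simp only [h1, h4, h5, Pi.add_apply, h2, h3, mul_add]
  map_smul' c f := by
    apply Lp.ext
    filter_upwards [(memLp_phase_mul hg (c • f)).coeFn_toLp, (memLp_phase_mul hg f).coeFn_toLp,
      Lp.coeFn_smul c f, Lp.coeFn_smul c ((memLp_phase_mul hg f).toLp _)] with x h1 h2 h4 h5
    simp only [RingHom.id_apply, h1, h4, h5, Pi.smul_apply, h2, smul_eq_mul]
    ring
  norm_map' f := by
    change ‖(memLp_phase_mul hg f).toLp _‖ = ‖f‖
    rw [Lp.norm_def, Lp.norm_def]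
    congr 1
    refine eLpNorm_congr_norm_ae ?_
    filter_upwards [(memLp_phase_mul hg f).coeFn_toLp] with x h1
    rw [h1, norm_mul, norm_exp_I_mul, one_mul]

theorem coeFn_planePhase {g : ℝ × ℝ → ℝ} (hg : Measurable g) (f : TwoMode) :
    planePhase hg f =ᵐ[volume] fun z => Complex.exp (Complex.I * g z) * f z :=
  (memLp_phase_mul hg f).coeFn_toLp

/-- Parity reverses displacements, so `D(ξ) Π D(ξ)† = D(2ξ) Π`: a reflection of the line about `ξ 0`
with a phase. -/
theorem coeFn_displacedParity (ξ : Fin 2 → ℝ) (f : Mode) :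
    displacedParity ξ f =ᵐ[volume] fun x =>
      Complex.exp (Complex.I * ((2 * ξ 1 * (x - ξ 0) : ℝ) : ℂ)) * f (2 * ξ 0 - x) := by
  have e : displacedParity ξ f = displacement ξ (displacement ξ (parity f)) := by
    change displacement ξ (parity ((displacement ξ).symm f)) = _
    rw [displacement_symm, parity_displacement, neg_neg]
  have h0 : symp ξ ξ = 0 := by simp [symp]; ring
  rw [e, displacement_displacement, h0]
  simp only [neg_zero, zero_div, Complex.ofReal_zero, mul_zero, Complex.exp_zero, one_smul]
  filter_upwards [coeFn_displacement (ξ + ξ) (parity f),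
    (measurePreserving_sub_right volume ((ξ + ξ) 0)).quasiMeasurePreserving.ae
      (coeFn_compUnitary (MeasurableEquiv.neg ℝ) (Measure.measurePreserving_neg volume) f)]
    with x h1 h2
  rw [h1]
  refine (congrArg _ h2).trans ?_
  simp only [MeasurableEquiv.neg_apply, Pi.add_apply]
  congr 2
  · push_cast; ring_nf
  · ring

theorem coeFn_tensorUnitary_displacedParity (ξ η : Fin 2 → ℝ) (f : TwoMode) :
    tensorUnitary (displacedParity ξ) (displacedParity η) f =ᵐ[volume] fun z =>
      Complex.exp (Complex.I * ((2 * ξ 1 * (z.1 - ξ 0) + 2 * η 1 * (z.2 - η 0) : ℝ) : ℂ)) *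
        f ((2 * ξ 0, 2 * η 0) - z) := by
  have hmp := Measure.measurePreserving_sub_left (volume : Measure (ℝ × ℝ)) (2 * ξ 0, 2 * η 0)
  have hm : Measurable fun z : ℝ × ℝ => 2 * ξ 1 * (z.1 - ξ 0) + 2 * η 1 * (z.2 - η 0) := by
    fun_prop
  set B : TwoMode →L[ℂ] TwoMode := (planePhase hm).toContinuousLinearMap ∘L
    (Lp.compMeasurePreservingₗᵢ ℂ _ hmp).toContinuousLinearMap with hB
  have hBc : ∀ f : TwoMode, B f =ᵐ[volume] fun z =>
      Complex.exp (Complex.I * ((2 * ξ 1 * (z.1 - ξ 0) + 2 * η 1 * (z.2 - η 0) : ℝ) : ℂ)) *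
        f ((2 * ξ 0, 2 * η 0) - z) := by
    intro f
    filter_upwards [coeFn_planePhase hm (Lp.compMeasurePreserving _ hmp f),
      Lp.coeFn_compMeasurePreserving f hmp] with z h1 h2
    refine h1.trans ?_
    rw [h2]
    rfl
  have key : toOp (tensorUnitary (displacedParity ξ) (displacedParity η)) = B := by
    refine ext_tmul fun f g => ?_
    rw [toOp_apply, tensorUnitary_tmul]
    apply Lp.ext
    filter_upwards [coeFn_tmul (displacedParity ξ f) (displacedParity η g),
      ae_fst (coeFn_displacedParity ξ f), ae_snd (coeFn_displacedParity η g), hBc (tmul f g),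
      hmp.quasiMeasurePreserving.ae (coeFn_tmul f g)] with z h1 h2 h3 h4 h5
    rw [h1, h2, h3, h4, h5, Complex.ofReal_add, mul_add, Complex.exp_add]
    simp only [Prod.fst_sub, Prod.snd_sub]
    ring
  have := hBc f
  rw [← key] at this
  exact this

/-- The diagonal representation of a density operator by a square integrable vector-valued
amplitude on the plane. -/
structure IsAmplitude {E : Type} [NormedAddCommGroup E] [InnerProductSpace ℂ E]
    (ρ : TwoMode →L[ℂ] TwoMode) (b : ℝ × ℝ → E) : Prop where
  memLp : MemLp b 2
  inner_apply : ∀ g : TwoMode,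
    (inner ℂ g (ρ g)).re = ‖∫ z, (starRingEnd ℂ) (g z) • b z‖ ^ 2
  wigner_eq : ∀ ξ η : Fin 2 → ℝ, wigner ρ ξ η =
    (∫ y : ℝ × ℝ, Complex.exp (Complex.I * ((2 * (ξ 1 * y.1 + η 1 * y.2) : ℝ) : ℂ)) *
      inner ℂ (b ((ξ 0, η 0) + y)) (b ((ξ 0, η 0) - y))).re / Real.pi ^ 2

/-- The displaced parity is isometric, so the `i`-th integrand has `L¹` norm at most `‖v i‖²` and
sum and integral may be exchanged. Centring at `q = (ξ 0, η 0)` turns the reflection `z ↦ 2q - z`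
into `y ↦ -y`. -/
theorem hasSum_integral_amplitude {ι : Type} [Countable ι] {v : ι → TwoMode}
    (hv : Summable fun i => ‖v i‖ ^ 2) (ξ η : Fin 2 → ℝ) :
    HasSum (fun i => inner ℂ (v i) (tensorUnitary (displacedParity ξ) (displacedParity η) (v i)))
      (∫ y : ℝ × ℝ, Complex.exp (Complex.I * ((2 * (ξ 1 * y.1 + η 1 * y.2) : ℝ) : ℂ)) *
        inner ℂ (amplitude v ((ξ 0, η 0) + y)) (amplitude v ((ξ 0, η 0) - y))) := by
  set A := tensorUnitary (displacedParity ξ) (displacedParity η)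
  have h1 := hasSum_integral_of_summable_integral_norm (μ := (volume : Measure (ℝ × ℝ)))
    (F := fun i z => inner ℂ (v i z) (A (v i) z)) (fun i => L2.integrable_inner _ _) ?_
  · convert! h1 using 1
    rw [← integral_add_left_eq_self (μ := volume) (fun z => ∑' i, inner ℂ (v i z) (A (v i) z))
      (ξ 0, η 0)]
    have hA : ∀ᵐ z, ∀ i, A (v i) z =
        Complex.exp (Complex.I * ((2 * ξ 1 * (z.1 - ξ 0) + 2 * η 1 * (z.2 - η 0) : ℝ) : ℂ)) *
        v i ((2 * ξ 0, 2 * η 0) - z) :=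
      ae_all_iff.2 fun i => coeFn_tensorUnitary_displacedParity ξ η (v i)
    have hq := (measurePreserving_add_left (volume : Measure (ℝ × ℝ))
      (ξ 0, η 0)).quasiMeasurePreserving
    have hq' := (Measure.measurePreserving_sub_left (volume : Measure (ℝ × ℝ))
      (ξ 0, η 0)).quasiMeasurePreserving
    apply integral_congr_ae
    filter_upwards [hq.ae hA, hq.ae (ae_amplitude_apply hv), hq'.ae (ae_amplitude_apply hv)]
      with y k1 k2 k3
    rw [lp.inner_eq_tsum, ← tsum_mul_left]
    congr 1
    ext i
    rw [k2, k3, k1]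
    have e : ((2 * ξ 0, 2 * η 0) : ℝ × ℝ) - ((ξ 0, η 0) + y) = (ξ 0, η 0) - y := by
      ext <;> simp <;> ring
    rw [e]
    simp only [RCLike.inner_apply, Prod.fst_add, Prod.snd_add, add_sub_cancel_left]
    rw [← mul_assoc]
    congr 4
    push_cast
    ring
  · refine Summable.of_nonneg_of_le (fun i => integral_nonneg fun _ => norm_nonneg _)
      (fun i => ?_) hv
    have hle : ∀ z, ‖inner ℂ (v i z) (A (v i) z)‖ ≤ (‖v i z‖ ^ 2 + ‖A (v i) z‖ ^ 2) / 2 := by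
      intro z
      have := norm_inner_le_norm (𝕜 := ℂ) (v i z) (A (v i) z)
      nlinarith [sq_nonneg (‖v i z‖ - ‖A (v i) z‖)]
    have j1 : Integrable fun z => ‖v i z‖ ^ 2 :=
      (Lp.memLp (v i)).integrable_norm_pow (by norm_num)
    have j2 : Integrable fun z => ‖A (v i) z‖ ^ 2 :=
      (Lp.memLp (A (v i))).integrable_norm_pow (by norm_num)
    refine (integral_mono (L2.integrable_inner _ _).norm ((j1.add j2).div_const 2) hle).trans ?_
    rw [integral_div]
    simp only [Pi.add_apply]
    rw [integral_add j1 j2, integral_norm_sq, integral_norm_sq, LinearIsometryEquiv.norm_map]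
    linarith

theorem exists_isAmplitude {ρ : TwoMode →L[ℂ] TwoMode} (hρ : IsDensityOperator ρ)
    (U : TwoMode ≃ₗᵢ[ℂ] TwoMode) :
    ∃ (ι : Type) (b : ℝ × ℝ → SqSum ι), IsAmplitude (conj U ρ) b := by
  obtain ⟨v, hv, htr, hin⟩ := exists_family hρ
  -- The amplitude needs a countable index set. Summability leaves only countably many nonzero `v
  -- i`, and the rest contribute nothing.
  set s : Set (basisSet TwoMode) := Function.support fun i => ‖v i‖ ^ 2 with hs
  have : Countable s := hv.countable_support.to_subtype
  have hv0 : ∀ i, i ∉ s → v i = 0 := by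
    intro i hi
    simpa [hs] using hi
  let w : s → TwoMode := fun i => U (v i)
  have hw : Summable fun i => ‖w i‖ ^ 2 := by
    simp only [w, LinearIsometryEquiv.norm_map]
    exact hv.subtype s
  refine ⟨s, amplitude w, memLp_amplitude hw, fun g => ?_, fun ξ η => ?_⟩
  · have h1 := hin (U.symm g)
    rw [← inner_conj_apply U, LinearIsometryEquiv.apply_symm_apply] at h1
    have e : ∀ i, inner ℂ (v i) (U.symm g) = inner ℂ (U (v i)) g := by
      intro i
      rw [← LinearIsometryEquiv.inner_map_map U, LinearIsometryEquiv.apply_symm_apply]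
    simp_rw [e] at h1
    rw [← hasSum_subtype_iff_of_support_subset (s := s)] at h1
    · exact h1.unique (hasSum_inner_amplitude hw g)
    · intro i hi
      by_contra h
      simp [hv0 i h] at hi
  · have h1 := htr U (toOp (tensorUnitary (displacedParity ξ) (displacedParity η)))
    rw [← hasSum_subtype_iff_of_support_subset (s := s)] at h1
    · rw [wigner, ← h1.unique (hasSum_integral_amplitude hw ξ η)]
    · intro i hi
      by_contra h
      simp [hv0 i h] at hi

/-! ### Bit correlations with respect to symplectic frames -/

/-- The strength of the bit correlations of a joint density `P`. -/
def bitStrength (P : ℝ → ℝ → ℝ) (x y : ℝ) : ℝ :=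
  |(P |x| |y| + P (-|x|) (-|y|)) / (P |x| |y| + P |x| (-|y|) + P (-|x|) |y| + P (-|x|) (-|y|)) -
    (P |x| (-|y|) + P (-|x|) |y|) / (P |x| |y| + P |x| (-|y|) + P (-|x|) |y| + P (-|x|) (-|y|))|

/-- The marginal distribution of the positions in symplectic frames. -/
def frameMarginal (ρ : TwoMode →L[ℂ] TwoMode) (M N : Matrix (Fin 2) (Fin 2) ℝ) (xA xB : ℝ) : ℝ :=
  limUnder (𝓝[>] (0 : ℝ)) fun ε => ∫ p : ℝ × ℝ, Real.exp (-ε * (p.1 ^ 2 + p.2 ^ 2)) *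
    wigner ρ (M *ᵥ ![xA, p.1]) (N *ᵥ ![xB, p.2])

/-- The averaged strength of the bit correlations in symplectic frames. -/
def frameAverage (ρ : TwoMode →L[ℂ] TwoMode) (M N : Matrix (Fin 2) (Fin 2) ℝ) : ℝ :=
  ∫ x : ℝ × ℝ, frameMarginal ρ M N x.1 x.2 *
    limUnder (𝓝[>] (0 : ℝ)) fun σ => bitStrength (frameProb ρ M N σ) x.1 x.2

theorem averageStrength_eq_frameAverage (ρ : TwoMode →L[ℂ] TwoMode) (θ φ : ℝ) :
    averageStrength ρ θ φ = frameAverage ρ (rotation θ) (rotation φ) := rfl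

theorem limUnder_congr {f g : ℝ → ℝ} {l : Filter ℝ} (h : f =ᶠ[l] g) :
    limUnder l f = limUnder l g := by
  rw [limUnder, limUnder, Filter.map_congr h]

theorem frameAverage_conj {ρ : TwoMode →L[ℂ] TwoMode} (hρ : IsDensityOperator ρ)
    {U V : Mode ≃ₗᵢ[ℂ] Mode} {S T : Matrix (Fin 2) (Fin 2) ℝ} (hU : Implements U S)
    (hV : Implements V T) (hS : S.det = 1) (hT : T.det = 1) {M N : Matrix (Fin 2) (Fin 2) ℝ}
    (hM : M.det = 1) (hN : N.det = 1) :
    frameAverage (conj (tensorUnitary U V) ρ) (S * M) (T * N) = frameAverage ρ M N := by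
  rw [frameAverage, frameAverage]
  congr 1
  ext x
  congr 1
  · simp only [frameMarginal, ← Matrix.mulVec_mulVec, wigner_conj hρ hU hV hS hT]
  · refine limUnder_congr ?_
    filter_upwards [self_mem_nhdsWithin] with σ hσ
    have : frameProb (conj (tensorUnitary U V) ρ) (S * M) (T * N) σ = frameProb ρ M N σ := by
      ext xA xB
      exact frameProb_conj ρ hU hV hS hT hM hN hσ xA xB
    rw [this]

/-- The strength is homogeneous of degree zero, so the normalisation of the probes, which makes the
probabilities vanish as `σ → 0`, drops out. -/
theorem bitStrength_const_mul {c : ℝ} (hc : c ≠ 0) (P : ℝ → ℝ → ℝ) (x y : ℝ) :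
    bitStrength (fun x y => c * P x y) x y = bitStrength P x y := by
  simp only [bitStrength, ← mul_add, mul_div_mul_left _ _ hc]

theorem tendsto_bitStrength {P : ℝ → ℝ → ℝ → ℝ} {Q : ℝ → ℝ → ℝ} {l : Filter ℝ} {x y : ℝ}
    (h : ∀ s t : ℝ, |s| = |x| → |t| = |y| → Tendsto (fun σ => P σ s t) l (𝓝 (Q s t)))
    (h0 : Q |x| |y| + Q |x| (-|y|) + Q (-|x|) |y| + Q (-|x|) (-|y|) ≠ 0) :
    Tendsto (fun σ => bitStrength (P σ) x y) l (𝓝 (bitStrength Q x y)) := by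
  have h1 := h |x| |y| (by simp) (by simp)
  have h2 := h |x| (-|y|) (by simp) (by simp)
  have h3 := h (-|x|) |y| (by simp) (by simp)
  have h4 := h (-|x|) (-|y|) (by simp) (by simp)
  have ht := ((h1.add h2).add h3).add h4
  exact (((h1.add h4).div ht h0).sub ((h2.add h3).div ht h0)).abs

/-! ### Lower triangular frames -/

/-- Lower triangular symplectic matrices. -/
def lower (l c : ℝ) : Matrix (Fin 2) (Fin 2) ℝ := !![l, 0; c, l⁻¹]

theorem det_lower {l : ℝ} (hl : l ≠ 0) (c : ℝ) : (lower l c).det = 1 := by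
  simp [lower, Matrix.det_fin_two_of, hl]

theorem lower_mulVec (l c x p : ℝ) : lower l c *ᵥ ![x, p] = ![l * x, c * x + l⁻¹ * p] := by
  ext i
  fin_cases i <;> simp [lower, Matrix.mulVec, dotProduct, Fin.sum_univ_two]

theorem lower_one_zero : lower 1 0 = 1 := by
  ext i j
  fin_cases i <;> fin_cases j <;> simp [lower]

theorem lower_mul_lower_inv {l : ℝ} (hl : l ≠ 0) (c : ℝ) : lower l c * lower l⁻¹ (-c) = 1 := by
  ext i j
  fin_cases i <;> fin_cases j <;> simp [lower, Matrix.mul_apply, Fin.sum_univ_two, hl]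
  field_simp
  ring

/-- The Iwasawa decomposition. -/
theorem exists_eq_rotation_mul_lower {M : Matrix (Fin 2) (Fin 2) ℝ} (hM : M.det = 1) :
    ∃ θ l c : ℝ, 0 < l ∧ M = rotation θ * lower l c := by
  rw [Matrix.det_fin_two] at hM
  -- The second column of `rotation θ * lower l c` is `l⁻¹ (-sin θ, cos θ)`, so `z` has to equal
  -- `l⁻¹ * exp (i θ)`, which determines `θ` and `l`.
  set z : ℂ := ⟨M 1 1, -M 0 1⟩ with hz
  have hz0 : z ≠ 0 := by
    intro h
    have h1 : M 1 1 = 0 := congrArg Complex.re h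
    have h2 : -M 0 1 = 0 := congrArg Complex.im h
    rw [neg_eq_zero] at h2
    rw [h1, h2] at hM
    norm_num at hM
  have hn : 0 < ‖z‖ := norm_pos_iff.2 hz0
  have hcos := Complex.norm_mul_cos_arg z
  have hsin := Complex.norm_mul_sin_arg z
  set θ := z.arg
  have hre : z.re = M 1 1 := rfl
  have him : z.im = -M 0 1 := rfl
  rw [hre] at hcos
  rw [him] at hsin
  have hl : ‖z‖⁻¹ = Real.cos θ * M 0 0 + Real.sin θ * M 1 0 := by
    rw [inv_eq_iff_eq_inv, eq_comm]
    refine inv_eq_of_mul_eq_one_left ?_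
    linear_combination hM + M 0 0 * hcos + M 1 0 * hsin
  refine ⟨θ, ‖z‖⁻¹, -Real.sin θ * M 0 0 + Real.cos θ * M 1 0, by positivity, ?_⟩
  have hcs := Real.sin_sq_add_cos_sq θ
  ext i j
  fin_cases i <;> fin_cases j <;>
    simp only [rotation, lower, Matrix.mul_apply, Fin.sum_univ_two, Fin.zero_eta, Fin.mk_one,
      Matrix.of_apply, Matrix.cons_val', Matrix.cons_val_zero, Matrix.cons_val_one,
      Matrix.cons_val_fin_one, inv_inv, mul_zero, zero_add]
  · rw [hl]; linear_combination -M 0 0 * hcs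
  · linear_combination hsin
  · rw [hl]; linear_combination -M 1 0 * hcs
  · linear_combination -hcos

/-! ### Chirped amplitudes -/

section Chirp

variable {E : Type} [NormedAddCommGroup E] [InnerProductSpace ℂ E]

/-- The quadratic phase of a chirp. -/
def chirpPhase (τ τ' : ℝ) (z : ℝ × ℝ) : ℝ := τ / 2 * z.1 ^ 2 + τ' / 2 * z.2 ^ 2

/-- Multiplication of an amplitude by a chirp. -/
def chirp (τ τ' : ℝ) (b : ℝ × ℝ → E) (z : ℝ × ℝ) : E :=
  Complex.exp (Complex.I * ((-chirpPhase τ τ' z : ℝ) : ℂ)) • b z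

theorem norm_chirp (τ τ' : ℝ) (b : ℝ × ℝ → E) (z : ℝ × ℝ) : ‖chirp τ τ' b z‖ = ‖b z‖ := by
  rw [chirp, norm_smul, norm_exp_I_mul, one_mul]

theorem memLp_chirp (τ τ' : ℝ) {b : ℝ × ℝ → E} (hb : MemLp b 2) : MemLp (chirp τ τ' b) 2 := by
  refine hb.of_le ?_ (ae_of_all _ fun z => (norm_chirp τ τ' b z).le)
  refine AEStronglyMeasurable.smul (Measurable.aestronglyMeasurable ?_) hb.1
  unfold chirpPhase
  fun_prop

/-- The difference of a quadratic phase between `q + y` and `q - y` is linear in `y`; a chirp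
therefore acts on the autocorrelation as a momentum shift proportional to `q`. -/
theorem inner_chirp (τ τ' : ℝ) (b : ℝ × ℝ → E) (q y : ℝ × ℝ) :
    inner ℂ (chirp τ τ' b (q + y)) (chirp τ τ' b (q - y)) =
      Complex.exp (Complex.I * ((2 * (τ * q.1 * y.1 + τ' * q.2 * y.2) : ℝ) : ℂ)) *
        inner ℂ (b (q + y)) (b (q - y)) := by
  rw [chirp, chirp, inner_smul_left, inner_smul_right, ← mul_assoc, ← Complex.exp_conj,
    ← Complex.exp_add]
  congr 2
  simp only [map_mul, Complex.conj_I, Complex.conj_ofReal, chirpPhase, Prod.fst_add, Prod.snd_add,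
    Prod.fst_sub, Prod.snd_sub]
  push_cast
  ring

/-! ### The marginal distribution in a lower triangular frame -/

theorem integral_gaussian_momentum_plane {ε : ℝ} (hε : 0 < ε) (u : ℝ × ℝ) :
    ∫ p : ℝ × ℝ, (Real.exp (-ε * (p.1 ^ 2 + p.2 ^ 2)) : ℂ) *
      Complex.exp (Complex.I * ((2 * (u.1 * p.1 + u.2 * p.2) : ℝ) : ℂ)) =
      ((Real.pi / ε * Real.exp (-(u.1 ^ 2 + u.2 ^ 2) / ε) : ℝ) : ℂ) := by
  have h1 : ∀ t : ℝ, ∫ x : ℝ, Complex.exp ((-ε : ℂ) * (x : ℂ) ^ 2 + (2 * Complex.I * t) * x + 0) =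
      ((√(Real.pi / ε) * Real.exp (-t ^ 2 / ε) : ℝ) : ℂ) := by
    intro t
    rw [integral_cexp_quadratic (by simpa using hε), neg_neg,
      show (1 / 2 : ℂ) = ((1 / 2 : ℝ) : ℂ) by push_cast; rfl, ← Complex.ofReal_div,
      ← Complex.ofReal_cpow (by positivity), ← Real.sqrt_eq_rpow, Complex.ofReal_mul,
      Complex.ofReal_exp]
    congr 2
    have : (ε : ℂ) ≠ 0 := by exact_mod_cast hε.ne'
    push_cast
    field_simp
    linear_combination 4 * (t : ℂ) ^ 2 * Complex.I_sq
  have h2 : ∀ p : ℝ × ℝ, (Real.exp (-ε * (p.1 ^ 2 + p.2 ^ 2)) : ℂ) *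
      Complex.exp (Complex.I * ((2 * (u.1 * p.1 + u.2 * p.2) : ℝ) : ℂ)) =
      Complex.exp ((-ε : ℂ) * (p.1 : ℂ) ^ 2 + (2 * Complex.I * u.1) * p.1 + 0) *
      Complex.exp ((-ε : ℂ) * (p.2 : ℂ) ^ 2 + (2 * Complex.I * u.2) * p.2 + 0) := by
    intro p
    rw [Complex.ofReal_exp, ← Complex.exp_add, ← Complex.exp_add]
    congr 1
    push_cast
    ring
  simp_rw [h2]
  rw [Measure.volume_eq_prod, integral_prod_mul
    (fun x : ℝ => Complex.exp ((-ε : ℂ) * (x : ℂ) ^ 2 + (2 * Complex.I * u.1) * x + 0))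
    (fun x : ℝ => Complex.exp ((-ε : ℂ) * (x : ℂ) ^ 2 + (2 * Complex.I * u.2) * x + 0)), h1, h1,
    ← Complex.ofReal_mul]
  congr 1
  rw [mul_mul_mul_comm, Real.mul_self_sqrt (by positivity), ← Real.exp_add]
  congr 2
  ring

variable {ρ : TwoMode →L[ℂ] TwoMode} {b : ℝ × ℝ → E}

theorem integrable_autocorrelation (hb : MemLp b 2) (q : ℝ × ℝ) :
    Integrable fun y => inner ℂ (b (q + y)) (b (q - y)) := by
  have h1 : MemLp (fun y => b (q + y)) 2 :=
    hb.comp_measurePreserving (measurePreserving_add_left volume q)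
  have h2 : MemLp (fun y => b (q - y)) 2 :=
    hb.comp_measurePreserving (Measure.measurePreserving_sub_left volume q)
  have j1 : Integrable fun y => ‖b (q + y)‖ ^ 2 := h1.integrable_norm_pow (by norm_num)
  have j2 : Integrable fun y => ‖b (q - y)‖ ^ 2 := h2.integrable_norm_pow (by norm_num)
  refine ((j1.add j2).div_const 2).mono' (h1.1.inner h2.1) (ae_of_all _ fun y => ?_)
  have := norm_inner_le_norm (𝕜 := ℂ) (b (q + y)) (b (q - y))
  simp only [Pi.add_apply]
  nlinarith [sq_nonneg (‖b (q + y)‖ - ‖b (q - y)‖)]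

/-- After Fubini the regulariser in the momenta becomes a Gaussian weight of width `√ε` on the
autocorrelation. The shear `c * x.1 = (c / l) * (l * x.1)` is absorbed by a chirp of rate `c / l`.
-/
theorem integral_exp_mul_wigner (h : IsAmplitude ρ b) {l l' : ℝ} (hl : 0 < l) (hl' : 0 < l')
    (c c' : ℝ) (x : ℝ × ℝ) {ε : ℝ} (hε : 0 < ε) :
    ∫ p : ℝ × ℝ, Real.exp (-ε * (p.1 ^ 2 + p.2 ^ 2)) *
      wigner ρ (lower l c *ᵥ ![x.1, p.1]) (lower l' c' *ᵥ ![x.2, p.2]) =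
    Real.pi⁻¹ * ((√ε ^ 2)⁻¹ • ∫ y, gaussWeight (l⁻¹ ^ 2) (l'⁻¹ ^ 2) (√ε) y •
      inner ℂ (chirp (c / l) (c' / l') b ((l * x.1, l' * x.2) + y))
        (chirp (c / l) (c' / l') b ((l * x.1, l' * x.2) - y))).re := by
  set q : ℝ × ℝ := (l * x.1, l' * x.2) with hq
  set B := chirp (c / l) (c' / l') b with hB
  have hBm : MemLp B 2 := memLp_chirp _ _ h.memLp
  have hac := integrable_autocorrelation hBm q
  set G : (ℝ × ℝ) → (ℝ × ℝ) → ℂ := fun p y => ((Real.exp (-ε * (p.1 ^ 2 + p.2 ^ 2)) : ℂ) *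
      Complex.exp (Complex.I * ((2 * (l⁻¹ * y.1 * p.1 + l'⁻¹ * y.2 * p.2) : ℝ) : ℂ))) *
      inner ℂ (B (q + y)) (B (q - y)) with hG
  have hw : ∀ p : ℝ × ℝ, Real.exp (-ε * (p.1 ^ 2 + p.2 ^ 2)) *
      wigner ρ (lower l c *ᵥ ![x.1, p.1]) (lower l' c' *ᵥ ![x.2, p.2]) =
      (Real.pi ^ 2)⁻¹ * (∫ y, G p y).re := by
    intro p
    rw [lower_mulVec, lower_mulVec, h.wigner_eq]
    simp only [Matrix.cons_val_zero, Matrix.cons_val_one]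
    have : ∫ y, G p y = ((Real.exp (-ε * (p.1 ^ 2 + p.2 ^ 2)) : ℝ) : ℂ) * ∫ y : ℝ × ℝ,
        Complex.exp (Complex.I * ((2 * ((c * x.1 + l⁻¹ * p.1) * y.1 +
          (c' * x.2 + l'⁻¹ * p.2) * y.2) : ℝ) : ℂ)) * inner ℂ (b (q + y)) (b (q - y)) := by
      rw [← integral_const_mul]
      congr 1
      ext y
      simp only [hG, hB]
      rw [inner_chirp, mul_assoc, ← mul_assoc (Complex.exp _) (Complex.exp _), ← Complex.exp_add]
      congr 3
      simp only [hq]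
      have e1 : c / l * (l * x.1) = c * x.1 := by field_simp
      have e2 : c' / l' * (l' * x.2) = c' * x.2 := by field_simp
      rw [e1, e2]
      push_cast
      ring
    rw [this, Complex.re_ofReal_mul]
    ring
  simp_rw [hw]
  rw [integral_const_mul]
  have hgi : Integrable fun p : ℝ × ℝ => Real.exp (-ε * (p.1 ^ 2 + p.2 ^ 2)) := by
    have := (integrable_exp_neg_mul_sq hε).mul_prod (integrable_exp_neg_mul_sq hε)
    refine this.congr (ae_of_all _ fun p => ?_)
    simp only
    rw [← Real.exp_add, mul_add]
  have hGi : Integrable (Function.uncurry G) (volume.prod volume) := by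
    have h0 := hgi.ofReal (𝕜 := ℂ).mul_prod hac
    refine h0.mono ?_ (ae_of_all _ fun w => ?_)
    · refine AEStronglyMeasurable.mul (Measurable.aestronglyMeasurable (by fun_prop)) ?_
      exact hac.1.comp_snd
    · simp only [hG, Function.uncurry, norm_mul, norm_exp_I_mul, mul_one]
      rfl
  have hre : ∫ p, (∫ y, G p y).re = (∫ p, ∫ y, G p y).re :=
    integral_re (𝕜 := ℂ) hGi.integral_prod_left
  rw [hre, integral_integral_swap hGi]
  have hin : ∀ y : ℝ × ℝ, ∫ p, G p y = ((Real.pi / ε : ℝ) : ℂ) *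
      (gaussWeight (l⁻¹ ^ 2) (l'⁻¹ ^ 2) (√ε) y • inner ℂ (B (q + y)) (B (q - y))) := by
    intro y
    simp only [hG]
    rw [integral_mul_const]
    have := integral_gaussian_momentum_plane hε (l⁻¹ * y.1, l'⁻¹ * y.2)
    simp only at this
    rw [this, ← Complex.coe_smul, smul_eq_mul, ← mul_assoc, ← Complex.ofReal_mul, gaussWeight,
      Real.sq_sqrt hε.le]
    congr 4
    ring_nf
  simp_rw [hin]
  rw [integral_const_mul, Complex.re_ofReal_mul, Real.sq_sqrt hε.le, ← Complex.coe_smul,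
    smul_eq_mul, Complex.re_ofReal_mul]
  field_simp

theorem tendsto_sqrt_nhdsGT : Tendsto (fun ε : ℝ => √ε) (𝓝[>] 0) (𝓝[>] 0) := by
  refine tendsto_nhdsWithin_iff.2 ⟨?_, ?_⟩
  · have : Tendsto (fun ε : ℝ => √ε) (𝓝 0) (𝓝 √0) := Real.continuous_sqrt.tendsto 0
    rw [Real.sqrt_zero] at this
    exact this.mono_left nhdsWithin_le_nhds
  · filter_upwards [self_mem_nhdsWithin] with ε hε
    exact Real.sqrt_pos.2 hε

theorem frameMarginal_lower (h : IsAmplitude ρ b) {l l' : ℝ} (hl : 0 < l) (hl' : 0 < l')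
    (c c' : ℝ) (x : ℝ × ℝ) (hx : IsGaussPoint (chirp (c / l) (c' / l') b) (l * x.1, l' * x.2)) :
    frameMarginal ρ (lower l c) (lower l' c') x.1 x.2 = l * l' * ‖b (l * x.1, l' * x.2)‖ ^ 2 := by
  apply Tendsto.limUnder_eq
  have h1 := (hx.tendsto_autocorrelation (memLp_chirp _ _ h.memLp) (α := l⁻¹ ^ 2) (β := l'⁻¹ ^ 2)
    (by positivity) (by positivity)).comp tendsto_sqrt_nhdsGT
  have h2 := ((Complex.continuous_re.tendsto _).comp h1).const_mul Real.pi⁻¹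
  -- Each mode contributes `√π` times its scale, and the two factors `√π` cancel the prefactor
  -- `π⁻¹`.
  have e : ∀ a : ℝ, 0 < a → √(Real.pi / a⁻¹ ^ 2) = √Real.pi * a := by
    intro a ha
    rw [inv_pow, div_inv_eq_mul, Real.sqrt_mul Real.pi_pos.le, Real.sqrt_sq ha.le]
  have e2 : Real.pi⁻¹ * ((√(Real.pi / l⁻¹ ^ 2) * √(Real.pi / l'⁻¹ ^ 2)) •
      inner ℂ (chirp (c / l) (c' / l') b (l * x.1, l' * x.2))
        (chirp (c / l) (c' / l') b (l * x.1, l' * x.2))).re =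
      l * l' * ‖b (l * x.1, l' * x.2)‖ ^ 2 := by
    rw [e l hl, e l' hl', ← Complex.coe_smul, smul_eq_mul, Complex.re_ofReal_mul]
    have := inner_self_eq_norm_sq (𝕜 := ℂ) (chirp (c / l) (c' / l') b (l * x.1, l' * x.2))
    rw [norm_chirp] at this
    change Real.pi⁻¹ * (√Real.pi * l * (√Real.pi * l') * RCLike.re (inner ℂ _ _)) = _
    rw [this, mul_mul_mul_comm, Real.mul_self_sqrt Real.pi_pos.le]
    field_simp
  rw [e2] at h2
  refine h2.congr' ?_
  filter_upwards [self_mem_nhdsWithin] with ε hε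
  rw [integral_exp_mul_wigner h hl hl' c c' x hε]
  rfl

end Chirp

/-! ### The outcome probabilities in a lower triangular frame -/

/-- The phases linear in `y` from the correlated covariance and from the mean momentum `c * x`
cancel. What remains is a chirp independent of `x`, which can be moved onto the amplitude, and a
constant phase. -/
theorem coeFn_frameProbe_lower {l : ℝ} (hl : 0 < l) (c : ℝ) {σ : ℝ} (hσ : 0 < σ) (x : ℝ) :
    frameProbe (lower l c) σ x =ᵐ[volume] fun y =>
      (((Real.pi * (l ^ 2 * σ ^ 2)) ^ (-(1 / 4) : ℝ) *
        Real.exp (-(l⁻¹ ^ 2 / 2 * (y - l * x) ^ 2) / σ ^ 2) : ℝ) : ℂ) *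
      Complex.exp (Complex.I * ((c / l / 2 * y ^ 2 + c * l / 2 * x ^ 2 : ℝ) : ℂ)) := by
  set γ := lower l c * Matrix.diagonal ![σ ^ 2, 1 / σ ^ 2] * (lower l c)ᵀ with hγ
  have h00 : γ 0 0 = l ^ 2 * σ ^ 2 := by
    simp only [hγ, lower, Matrix.mul_apply, Fin.sum_univ_two, Matrix.transpose_apply]
    simp
    ring
  have h01 : γ 0 1 = l * c * σ ^ 2 := by
    simp only [hγ, lower, Matrix.mul_apply, Fin.sum_univ_two, Matrix.transpose_apply]
    simp
    ring
  have hpos : 0 < γ 0 0 := by rw [h00]; positivity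
  filter_upwards [coeFn_gaussianVector (lower l c *ᵥ ![x, 0]) hpos] with y hy
  rw [frameProbe, hy, gaussianWave, h00, h01, lower_mulVec,
    Complex.ofReal_mul ((Real.pi * (l ^ 2 * σ ^ 2)) ^ (-(1 / 4) : ℝ)), mul_assoc (Complex.ofReal _) (Complex.ofReal _),
    Complex.ofReal_exp, ← Complex.exp_add]
  congr 2
  have hl' : (l : ℂ) ≠ 0 := by exact_mod_cast hl.ne'
  have hσ' : (σ : ℂ) ≠ 0 := by exact_mod_cast hσ.ne'
  simp only [Matrix.cons_val_zero, Matrix.cons_val_one, mul_zero, add_zero]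
  push_cast
  field_simp
  ring

section Prob

variable {E : Type} [NormedAddCommGroup E] [InnerProductSpace ℂ E]
  {ρ : TwoMode →L[ℂ] TwoMode} {b : ℝ × ℝ → E}

theorem frameProb_lower (h : IsAmplitude ρ b) {l l' : ℝ} (hl : 0 < l) (hl' : 0 < l') (c c' : ℝ)
    {σ : ℝ} (hσ : 0 < σ) (xA xB : ℝ) :
    frameProb ρ (lower l c) (lower l' c') σ xA xB =
      ((Real.pi * (l ^ 2 * σ ^ 2)) ^ (-(1 / 4) : ℝ) *
        (Real.pi * (l' ^ 2 * σ ^ 2)) ^ (-(1 / 4) : ℝ) * σ ^ 2) ^ 2 *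
      ‖(σ ^ 2)⁻¹ • ∫ y, gaussWeight (l⁻¹ ^ 2 / 2) (l'⁻¹ ^ 2 / 2) σ y •
        chirp (c / l) (c' / l') b ((l * xA, l' * xB) + y)‖ ^ 2 := by
  set q : ℝ × ℝ := (l * xA, l' * xB) with hq
  set A := (Real.pi * (l ^ 2 * σ ^ 2)) ^ (-(1 / 4) : ℝ)
  set A' := (Real.pi * (l' ^ 2 * σ ^ 2)) ^ (-(1 / 4) : ℝ)
  set B := chirp (c / l) (c' / l') b with hB
  have hA : 0 < A := by positivity
  have hA' : 0 < A' := by positivity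
  rw [frameProb, h.inner_apply]
  have hi : ∫ z, (starRingEnd ℂ) (tmul (frameProbe (lower l c) σ xA)
      (frameProbe (lower l' c') σ xB) z) • b z =
      Complex.exp (Complex.I * ((-(c * l / 2 * xA ^ 2 + c' * l' / 2 * xB ^ 2) : ℝ) : ℂ)) •
      ((A * A') • ∫ y, gaussWeight (l⁻¹ ^ 2 / 2) (l'⁻¹ ^ 2 / 2) σ y • B (q + y)) := by
    rw [← integral_smul, ← integral_smul, ← integral_sub_right_eq_self (fun y =>
      Complex.exp (Complex.I * ((-(c * l / 2 * xA ^ 2 + c' * l' / 2 * xB ^ 2) : ℝ) : ℂ)) •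
        (A * A') • gaussWeight (l⁻¹ ^ 2 / 2) (l'⁻¹ ^ 2 / 2) σ y • B (q + y)) q]
    apply integral_congr_ae
    filter_upwards [coeFn_tmul (frameProbe (lower l c) σ xA) (frameProbe (lower l' c') σ xB),
      ae_fst (coeFn_frameProbe_lower hl c hσ xA), ae_snd (coeFn_frameProbe_lower hl' c' hσ xB)]
      with z h1 h2 h3
    rw [h1, h2, h3, add_sub_cancel, hB, chirp, ← Complex.coe_smul, ← Complex.coe_smul, smul_smul,
      smul_smul, smul_smul]
    congr 1
    simp only [map_mul, ← Complex.exp_conj, Complex.conj_ofReal, Complex.conj_I, gaussWeight]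
    rw [Complex.ofReal_mul, Complex.ofReal_mul]
    have e1 : Complex.exp (-Complex.I * ((c / l / 2 * z.1 ^ 2 + c * l / 2 * xA ^ 2 : ℝ) : ℂ)) *
        Complex.exp (-Complex.I * ((c' / l' / 2 * z.2 ^ 2 + c' * l' / 2 * xB ^ 2 : ℝ) : ℂ)) =
        Complex.exp (Complex.I * ((-(c * l / 2 * xA ^ 2 + c' * l' / 2 * xB ^ 2) : ℝ) : ℂ)) *
        Complex.exp (Complex.I * ((-chirpPhase (c / l) (c' / l') z : ℝ) : ℂ)) := by
      rw [← Complex.exp_add, ← Complex.exp_add]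
      congr 1
      simp only [chirpPhase]
      push_cast
      ring
    have e2 : Real.exp (-(l⁻¹ ^ 2 / 2 * (z.1 - l * xA) ^ 2) / σ ^ 2) *
        Real.exp (-(l'⁻¹ ^ 2 / 2 * (z.2 - l' * xB) ^ 2) / σ ^ 2) =
        Real.exp (-(l⁻¹ ^ 2 / 2 * (z - q).1 ^ 2 + l'⁻¹ ^ 2 / 2 * (z - q).2 ^ 2) / σ ^ 2) := by
      rw [← Real.exp_add]
      congr 1
      simp only [hq, Prod.fst_sub, Prod.snd_sub]
      ring
    rw [← e2, mul_mul_mul_comm, e1]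
    push_cast
    ring
  rw [hi, norm_smul, norm_exp_I_mul, one_mul, norm_smul, norm_smul,
    Real.norm_of_nonneg (by positivity), Real.norm_of_nonneg (by positivity)]
  field_simp

theorem limUnder_bitStrength_lower [CompleteSpace E] (h : IsAmplitude ρ b) {l l' : ℝ} (hl : 0 < l)
    (hl' : 0 < l') (c c' : ℝ) (x : ℝ × ℝ)
    (hx : ∀ s t : ℝ, |s| = |x.1| → |t| = |x.2| →
      IsGaussPoint (chirp (c / l) (c' / l') b) (l * s, l' * t))
    (h0 : ‖b (l * x.1, l' * x.2)‖ ≠ 0) :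
    limUnder (𝓝[>] (0 : ℝ)) (fun σ => bitStrength (frameProb ρ (lower l c) (lower l' c') σ) x.1 x.2) =
      bitStrength (fun s t => ‖b (s, t)‖ ^ 2) (l * x.1) (l' * x.2) := by
  set κ := √(Real.pi / (l⁻¹ ^ 2 / 2)) * √(Real.pi / (l'⁻¹ ^ 2 / 2)) with hκ
  have hκ0 : 0 < κ := by positivity
  set B := chirp (c / l) (c' / l') b with hB
  set P : ℝ → ℝ → ℝ → ℝ := fun σ s t => ‖(σ ^ 2)⁻¹ • ∫ y,
    gaussWeight (l⁻¹ ^ 2 / 2) (l'⁻¹ ^ 2 / 2) σ y • B ((l * s, l' * t) + y)‖ ^ 2 with hP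
  set Q : ℝ → ℝ → ℝ := fun s t => κ ^ 2 * ‖b (l * s, l' * t)‖ ^ 2 with hQ
  have hlim : ∀ s t : ℝ, |s| = |x.1| → |t| = |x.2| →
      Tendsto (fun σ => P σ s t) (𝓝[>] 0) (𝓝 (Q s t)) := by
    intro s t hs ht
    have := ((hx s t hs ht).tendsto_mean (memLp_chirp _ _ h.memLp) (α := l⁻¹ ^ 2 / 2)
      (β := l'⁻¹ ^ 2 / 2) (by positivity) (by positivity)).norm.pow 2
    rwa [norm_smul, norm_chirp, Real.norm_of_nonneg hκ0.le, mul_pow] at this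
  have hQ0 : ∀ s t, 0 ≤ Q s t := fun s t => by positivity
  have hQx : 0 < Q x.1 x.2 := by positivity
  -- One of the four nonnegative terms is `Q x.1 x.2`, which is positive.
  have htot : Q |x.1| |x.2| + Q |x.1| (-|x.2|) + Q (-|x.1|) |x.2| + Q (-|x.1|) (-|x.2|) ≠ 0 := by
    have k1 := hQ0 |x.1| |x.2|
    have k2 := hQ0 |x.1| (-|x.2|)
    have k3 := hQ0 (-|x.1|) |x.2|
    have k4 := hQ0 (-|x.1|) (-|x.2|)
    refine ne_of_gt ?_
    rcases abs_choice x.1 with h1 | h1 <;> rcases abs_choice x.2 with h2 | h2 <;>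
      rw [h1, h2] at k1 k2 k3 k4 ⊢ <;> try simp only [neg_neg] at k1 k2 k3 k4 ⊢
    all_goals linarith
  have ht := tendsto_bitStrength hlim htot
  have e1 : bitStrength Q x.1 x.2 =
      bitStrength (fun s t => ‖b (s, t)‖ ^ 2) (l * x.1) (l' * x.2) := by
    rw [hQ, bitStrength_const_mul (by positivity)]
    simp only [bitStrength, abs_mul, abs_of_pos hl, abs_of_pos hl', mul_neg]
  rw [← e1]
  refine Tendsto.limUnder_eq (ht.congr' ?_)
  filter_upwards [self_mem_nhdsWithin] with σ hσ
  have hσ : 0 < σ := hσ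
  have e2 : frameProb ρ (lower l c) (lower l' c') σ = fun s t =>
      ((Real.pi * (l ^ 2 * σ ^ 2)) ^ (-(1 / 4) : ℝ) *
        (Real.pi * (l' ^ 2 * σ ^ 2)) ^ (-(1 / 4) : ℝ) * σ ^ 2) ^ 2 * P σ s t := by
    ext s t
    exact frameProb_lower h hl hl' c c' hσ s t
  rw [e2, bitStrength_const_mul (by positivity)]

/-! ### The average in a lower triangular frame -/

/-- The dilation of the plane along the axes. -/
def planeDilation {l l' : ℝ} (hl : l ≠ 0) (hl' : l' ≠ 0) : ℝ × ℝ ≃ᵐ ℝ × ℝ :=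
  (MeasurableEquiv.mulLeft₀ l hl).prodCongr (MeasurableEquiv.mulLeft₀ l' hl')

theorem map_planeDilation {l l' : ℝ} (hl : l ≠ 0) (hl' : l' ≠ 0) :
    Measure.map (planeDilation hl hl') volume =
      (ENNReal.ofReal |l⁻¹| * ENNReal.ofReal |l'⁻¹|) • (volume : Measure (ℝ × ℝ)) := by
  have : (planeDilation hl hl' : ℝ × ℝ → ℝ × ℝ) = Prod.map (l * ·) (l' * ·) := rfl
  rw [this, Measure.volume_eq_prod, ← Measure.map_prod_map _ _ (by fun_prop) (by fun_prop),
    Real.map_volume_mul_left hl, Real.map_volume_mul_left hl', Measure.prod_smul_left,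
    Measure.prod_smul_right, smul_smul]

theorem integral_planeDilation {l l' : ℝ} (hl : 0 < l) (hl' : 0 < l') (G : ℝ × ℝ → ℝ) :
    ∫ x : ℝ × ℝ, l * l' * G (l * x.1, l' * x.2) = ∫ z, G z := by
  have h := integral_map_equiv (μ := volume) (planeDilation hl.ne' hl'.ne') G
  rw [map_planeDilation, integral_smul_measure] at h
  rw [integral_const_mul]
  change _ = ∫ x : ℝ × ℝ, G (l * x.1, l' * x.2) at h
  rw [← h, smul_eq_mul, ENNReal.toReal_mul, ENNReal.toReal_ofReal (abs_nonneg _),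
    ENNReal.toReal_ofReal (abs_nonneg _), abs_of_pos (inv_pos.2 hl), abs_of_pos (inv_pos.2 hl')]
  field_simp

theorem ae_planeDilation {p : ℝ × ℝ → Prop} (hp : ∀ᵐ z, p z) {l l' : ℝ} (hl : l ≠ 0)
    (hl' : l' ≠ 0) : ∀ᵐ x : ℝ × ℝ, p (l * x.1, l' * x.2) := by
  have : Measure.QuasiMeasurePreserving (planeDilation hl hl') volume volume :=
    ⟨(planeDilation hl hl').measurable, by
      rw [map_planeDilation]; exact Measure.smul_absolutelyContinuous⟩
  exact this.ae hp

/-- The marginal supplies exactly the Jacobian `l * l'` of the dilation, and the chirps disappear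
because only norms of `b` enter. The value is therefore the same for all triangular frames. -/
theorem frameAverage_lower [CompleteSpace E] (h : IsAmplitude ρ b) {l l' : ℝ} (hl : 0 < l)
    (hl' : 0 < l') (c c' : ℝ) : frameAverage ρ (lower l c) (lower l' c') =
      ∫ z : ℝ × ℝ, ‖b z‖ ^ 2 * bitStrength (fun s t => ‖b (s, t)‖ ^ 2) z.1 z.2 := by
  rw [← integral_planeDilation hl hl', frameAverage]
  have hg := ae_isGaussPoint (memLp_chirp (c / l) (c' / l') h.memLp)
  apply integral_congr_ae
  filter_upwards [ae_planeDilation hg hl.ne' hl'.ne',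
    ae_planeDilation hg hl.ne' (neg_ne_zero.2 hl'.ne'),
    ae_planeDilation hg (neg_ne_zero.2 hl.ne') hl'.ne',
    ae_planeDilation hg (neg_ne_zero.2 hl.ne') (neg_ne_zero.2 hl'.ne')] with x h1 h2 h3 h4
  rw [frameMarginal_lower h hl hl' c c' x h1]
  -- Where `b` vanishes so does the marginal, and the value of the limit, which need not exist
  -- there, is irrelevant.
  rcases eq_or_ne ‖b (l * x.1, l' * x.2)‖ 0 with h0 | h0
  · simp [h0]
  · rw [limUnder_bitStrength_lower h hl hl' c c' x ?_ h0, mul_assoc]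
    intro s t hs ht
    simp only [neg_mul, ← mul_neg] at h2 h3 h4
    rcases abs_eq_abs.1 hs with rfl | rfl <;> rcases abs_eq_abs.1 ht with rfl | rfl <;> assumption

end Prob

/-! ### Independence of the triangular factor and transport of the averages -/

theorem frameAverage_mul_lower {ρ : TwoMode →L[ℂ] TwoMode} (hρ : IsDensityOperator ρ) (θ φ : ℝ)
    {l l' : ℝ} (hl : 0 < l) (hl' : 0 < l') (c c' : ℝ) :
    frameAverage ρ (rotation θ * lower l c) (rotation φ * lower l' c') = averageStrength ρ θ φ := by
  obtain ⟨V, hV⟩ := exists_implements_rotation θ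
  obtain ⟨V', hV'⟩ := exists_implements_rotation φ
  have hθ := det_rotation θ
  have hφ := det_rotation φ
  have hinv : ∀ (α : ℝ) (L : Matrix (Fin 2) (Fin 2) ℝ), (rotation α)⁻¹ * (rotation α * L) = L := by
    intro α L
    rw [← Matrix.mul_assoc, Matrix.nonsing_inv_mul _ (by rw [det_rotation]; exact isUnit_one),
      Matrix.one_mul]
  -- Unitaries undoing the rotations leave a triangular frame for a state that does not depend on
  -- `m` and `d`, so the given frame can be compared with `lower 1 0 = 1`.
  have key : ∀ {m m' : ℝ} (d d' : ℝ), 0 < m → 0 < m' →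
      frameAverage ρ (rotation θ * lower m d) (rotation φ * lower m' d') =
        frameAverage (conj (tensorUnitary V.symm V'.symm) ρ) (lower m d) (lower m' d') := by
    intro m m' d d' hm hm'
    rw [← frameAverage_conj hρ (hV.symm hθ) (hV'.symm hφ) (det_inv_eq_one hθ) (det_inv_eq_one hφ)
      (by rw [Matrix.det_mul, hθ, det_lower hm.ne', one_mul])
      (by rw [Matrix.det_mul, hφ, det_lower hm'.ne', one_mul]), hinv, hinv]
  obtain ⟨ι, b, hb⟩ := exists_isAmplitude hρ (tensorUnitary V.symm V'.symm)
  have h1 := key 0 0 one_pos one_pos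
  rw [lower_one_zero, Matrix.mul_one, Matrix.mul_one, ← averageStrength_eq_frameAverage,
    ← lower_one_zero, frameAverage_lower hb one_pos one_pos] at h1
  rw [key c c' hl hl', frameAverage_lower hb hl hl', h1]

/-- By covariance the rotated frames for the transformed state correspond to `S⁻¹ * rotation θ` and
`T⁻¹ * rotation φ` for `ρ`; the new angles are their Iwasawa angles. -/
theorem exists_averageStrength_conj_eq {ρ : TwoMode →L[ℂ] TwoMode} (hρ : IsDensityOperator ρ)
    {U V : Mode ≃ₗᵢ[ℂ] Mode} {S T : Matrix (Fin 2) (Fin 2) ℝ} (hU : Implements U S)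
    (hV : Implements V T) (hS : S.det = 1) (hT : T.det = 1) (θ φ : ℝ) :
    ∃ θ' φ' : ℝ, averageStrength (conj (tensorUnitary U V) ρ) θ φ = averageStrength ρ θ' φ' := by
  have hθ : (S⁻¹ * rotation θ).det = 1 := by
    rw [Matrix.det_mul, det_inv_eq_one hS, det_rotation, one_mul]
  have hφ : (T⁻¹ * rotation φ).det = 1 := by
    rw [Matrix.det_mul, det_inv_eq_one hT, det_rotation, one_mul]
  obtain ⟨θ', l, c, hl, e⟩ := exists_eq_rotation_mul_lower hθ
  obtain ⟨φ', l', c', hl', e'⟩ := exists_eq_rotation_mul_lower hφ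
  refine ⟨θ', φ', ?_⟩
  have h := frameAverage_conj hρ hU hV hS hT hθ hφ
  rw [← Matrix.mul_assoc, ← Matrix.mul_assoc,
    Matrix.mul_nonsing_inv _ (by rw [hS]; exact isUnit_one),
    Matrix.mul_nonsing_inv _ (by rw [hT]; exact isUnit_one), Matrix.one_mul, Matrix.one_mul, e, e',
    frameAverage_mul_lower hρ θ' φ' hl hl'] at h
  exact h

theorem exists_eq_averageStrength_conj {ρ : TwoMode →L[ℂ] TwoMode} (hρ : IsDensityOperator ρ)
    {U V : Mode ≃ₗᵢ[ℂ] Mode} {S T : Matrix (Fin 2) (Fin 2) ℝ} (hU : Implements U S)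
    (hV : Implements V T) (hS : S.det = 1) (hT : T.det = 1) (θ φ : ℝ) :
    ∃ θ' φ' : ℝ, averageStrength (conj (tensorUnitary U V) ρ) θ' φ' = averageStrength ρ θ φ := by
  have hθ : (S * rotation θ).det = 1 := by rw [Matrix.det_mul, hS, det_rotation, one_mul]
  have hφ : (T * rotation φ).det = 1 := by rw [Matrix.det_mul, hT, det_rotation, one_mul]
  obtain ⟨θ', l, c, hl, e⟩ := exists_eq_rotation_mul_lower hθ
  obtain ⟨φ', l', c', hl', e'⟩ := exists_eq_rotation_mul_lower hφ
  refine ⟨θ', φ', ?_⟩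
  -- The triangular factor of `S * rotation θ` is moved to the side of `ρ`, where it does not affect
  -- the average.
  have h1 : S * (rotation θ * lower l⁻¹ (-c)) = rotation θ' := by
    rw [← Matrix.mul_assoc, e, Matrix.mul_assoc, lower_mul_lower_inv hl.ne', Matrix.mul_one]
  have h2 : T * (rotation φ * lower l'⁻¹ (-c')) = rotation φ' := by
    rw [← Matrix.mul_assoc, e', Matrix.mul_assoc, lower_mul_lower_inv hl'.ne', Matrix.mul_one]
  have hd : ∀ (α : ℝ) {m : ℝ} (d : ℝ), m ≠ 0 → (rotation α * lower m d).det = 1 := by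
    intro α m d hm
    rw [Matrix.det_mul, det_rotation, det_lower hm, one_mul]
  have h := frameAverage_conj hρ hU hV hS hT (hd θ (-c) (inv_ne_zero hl.ne'))
    (hd φ (-c') (inv_ne_zero hl'.ne'))
  rw [h1, h2, frameAverage_mul_lower hρ θ φ (inv_pos.2 hl) (inv_pos.2 hl')] at h
  exact h

end BitCorr

end

theorem lemma3 (ρ : BitCorr.TwoMode →L[ℂ] BitCorr.TwoMode) (hρ : BitCorr.IsDensityOperator ρ)
    (UA UB : BitCorr.Mode ≃ₗᵢ[ℂ] BitCorr.Mode) (SA SB : Matrix (Fin 2) (Fin 2) ℝ)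
    (hSA : BitCorr.IsSymplectic SA) (hSB : BitCorr.IsSymplectic SB)
    (hUA : BitCorr.Implements UA SA) (hUB : BitCorr.Implements UB SB) :
    BitCorr.bitCorr (BitCorr.conj (BitCorr.tensorUnitary UA UB) ρ) = BitCorr.bitCorr ρ := by
  rw [BitCorr.isSymplectic_iff_det] at hSA hSB
  -- The two sets of values are shown to be equal, so no bound on them is needed for the suprema to
  -- agree.
  rw [BitCorr.bitCorr, BitCorr.bitCorr, iSup, iSup]
  congr 1
  ext r
  constructor
  · rintro ⟨⟨θ, φ⟩, rfl⟩
    obtain ⟨θ', φ', h⟩ := BitCorr.exists_averageStrength_conj_eq hρ hUA hUB hSA hSB θ φ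
    exact ⟨(θ', φ'), h.symm⟩
  · rintro ⟨⟨θ, φ⟩, rfl⟩
    obtain ⟨θ', φ', h⟩ := BitCorr.exists_eq_averageStrength_conj hρ hUA hUB hSA hSB θ φ
    exact ⟨(θ', φ'), h⟩
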